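/- Let $n\ge 1$ and let $\mathcal D=\bigcup_{k\in\mathbb Z}\mathcal D_k$ be a dyadic system on $\mathbb R^n$: each $\mathcal D_k$ is a partition of $\mathbb R^n$ into half-open cubes $\prod_i[a_i,a_i+2^{-k})$, and any two cubes of $\mathcal D$ are disjoint or nested. For $Q\in\mathcal D_k$ let $\mathcal D_r(Q)$ be the set of $R\in\mathcal D_{k+r}$ with $R\subseteq Q$. Let $\mu$ be a Borel measure on $\mathbb R^n$ with $0<\mu(Q)<\infty$ for all $Q\in\mathcal D$ and such that all dyadic quadrants $\bigcup\{R\in\mathcal D: R\supseteq Q\}$, $Q\in\mathcal D$, have infinite measure. (All functions are real-valued.) Let $\{h_Q^j\}_{Q\in\mathcal D,\,1\le j<2^n}$ be a Haar system for $\mu$: $h_Q^j$ vanishes off $Q$, is constant on each $R\in\mathcal D_1(Q)$, $\int h_Q^j\,d\mu=0$, and all these functions form an orthonormal basis of $L^2(\mu)$. (For $n=1$ it is unique up to signs.) Assume that $\mu$ is balanced: $$\sup_{Q\in\mathcal D}\ \sup_{R\in\mathcal D_1(Q)}\ \sup_{i,j}\Big[\|h_Q^i\|_{L^1(\mu)}\|h_R^j\|_{L^\infty(\mu)}+\|h_Q^i\|_{L^\infty(\mu)}\|h_R^j\|_{L^1(\mu)}\Big]<\infty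 .$$ Let $r,s\in\mathbb N=\{0,1,\dots\}$ and let $T$ be a Haar shift of complexity $(r,s)$ that is bounded on $L^2(\mu)$, that is, a bounded linear operator on $L^2(\mu)$ such that for some real coefficients $\alpha$ and all $f\in L^2(\mu)$ $$Tf=\sum_{Q\in\mathcal D}\ \sum_{R\in\mathcal D_r(Q),\,S\in\mathcal D_s(Q)}\ \sum_{i,j}\alpha^{Q,i,j}_{R,S}\,\langle f,h_R^i\rangle\,h_S^j ,$$ with unconditional convergence in $L^2(\mu)$. Write $\mathsf E_kf=\sum_{Q\in\mathcal D_k}\langle f\rangle_Q1_Q$, where $\langle f\rangle_Q=\mu(Q)^{-1}\int_Qf\,d\mu$, and $\mathsf D_kf=\mathsf E_kf-\mathsf E_{k-1}f$. Let $\mathrm H^1(\mu)$ be the space of $f\in L^1(\mu)$ with $\|f\|_{\mathrm H^1}=\big\|(\sum_{k\in\mathbb Z}|\mathsf D_kf|^2)^{1/2}\big\|_{L^1(\mu)}<\infty$. Let $\mathrm{BMO}(\mu)$ be the space of functions $f$, integrable on every $Q\in\mathcal D$, with $\|f\|_{\mathrm{BMO}}=\sup_{k\in\mathbb Z}\big\|\mathsf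 E_k|f-\mathsf E_{k-1}f|\big\|_{L^\infty(\mu)}<\infty$, modulo those with $\|f\|_{\mathrm{BMO}}=0$. Then: (i) there is a bounded linear operator on $\mathrm H^1(\mu)$ that coincides with $T$ on $\mathrm H^1(\mu)\cap L^2(\mu)$; (ii) there is a bounded linear operator $\widetilde T$ on $\mathrm{BMO}(\mu)$ that coincides with $T$ on $\mathrm{BMO}(\mu)\cap L^2(\mu)$ (as classes in $\mathrm{BMO}(\mu)$). Moreover, for every $f\in\mathrm{BMO}(\mu)$, every $P\in\mathcal D$ and every $Q\in\mathcal D_{r+s}(P)$, the function $f1_P$ lies in $L^2(\mu)$, and any representative of $\widetilde Tf$ equals $T(f1_P)$ plus a constant $\mu$-a.e. on $Q$. -/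

import Mathlib

open MeasureTheory Set
open scoped ENNReal NNReal

/-- A dyadic system on `ℝⁿ`: `gen k` is the family of cubes of side length `2 ^ (-k)`. -/
structure DyadicSystem (n : ℕ) where
  gen : ℤ → Set (Set (Fin n → ℝ))
  isCube : ∀ k, ∀ Q ∈ gen k, ∃ a : Fin n → ℝ,
    Q = Set.univ.pi fun i => Set.Ico (a i) (a i + (2 : ℝ) ^ (-k))
  partition : ∀ k, ∀ x : Fin n → ℝ, ∃! Q, Q ∈ gen k ∧ x ∈ Q
  nested : ∀ k l, ∀ Q ∈ gen k, ∀ R ∈ gen l, Disjoint Q R ∨ Q ⊆ R ∨ R ⊆ Q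

namespace DyadicSystem

variable {n : ℕ}

/-- All the cubes of the system. -/
def cubes (D : DyadicSystem n) : Set (Set (Fin n → ℝ)) := {Q | ∃ k, Q ∈ D.gen k}

/-- The cubes `R ⊆ Q` of the system with `ℓ(Q) = 2 ^ r * ℓ(R)`. -/
def desc (D : DyadicSystem n) (r : ℕ) (Q : Set (Fin n → ℝ)) : Set (Set (Fin n → ℝ)) :=
  {R | ∃ k : ℤ, Q ∈ D.gen k ∧ R ∈ D.gen (k + r) ∧ R ⊆ Q}

/-- The quadrant of `Q`: the union of all cubes of the system that contain `Q`. For the standard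
dyadic intervals of `ℝ` the quadrants are `[0, ∞)` and `(-∞, 0)`. -/
def quadrant (D : DyadicSystem n) (Q : Set (Fin n → ℝ)) : Set (Fin n → ℝ) :=
  ⋃₀ {R | R ∈ D.cubes ∧ Q ⊆ R}

/-- The cube of generation `k` that contains `x`. -/
def cell (D : DyadicSystem n) (k : ℤ) (x : Fin n → ℝ) : Set (Fin n → ℝ) :=
  ⋃₀ {Q | Q ∈ D.gen k ∧ x ∈ Q}

/-- The conditional expectation `E_k f = ∑_{Q ∈ D_k} ⟨f⟩_Q 1_Q`. -/
noncomputable def expect (D : DyadicSystem n) (μ : Measure (Fin n → ℝ)) (k : ℤ)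
    (f : (Fin n → ℝ) → ℝ) (x : Fin n → ℝ) : ℝ :=
  ⨍ y in D.cell k x, f y ∂μ

/-- The martingale difference `D_k f = E_k f - E_{k-1} f`. -/
noncomputable def mdiff (D : DyadicSystem n) (μ : Measure (Fin n → ℝ)) (k : ℤ)
    (f : (Fin n → ℝ) → ℝ) (x : Fin n → ℝ) : ℝ :=
  D.expect μ k f x - D.expect μ (k - 1) f x

/-- The martingale square function `(∑_k |D_k f|²)^{1/2}`, with values in `[0, ∞]`. -/
noncomputable def squareFn (D : DyadicSystem n) (μ : Measure (Fin n → ℝ))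
    (f : (Fin n → ℝ) → ℝ) (x : Fin n → ℝ) : ℝ≥0∞ :=
  (∑' k : ℤ, ‖D.mdiff μ k f x‖ₑ ^ (2 : ℝ)) ^ (1 / 2 : ℝ)

/-- The martingale Hardy norm `‖S f‖₁`, with values in `[0, ∞]`. -/
noncomputable def h1Norm (D : DyadicSystem n) (μ : Measure (Fin n → ℝ))
    (f : (Fin n → ℝ) → ℝ) : ℝ≥0∞ :=
  ∫⁻ x, D.squareFn μ f x ∂μ

/-- The martingale BMO seminorm `sup_k ‖E_k |f - E_{k-1} f|‖_∞`, with values in `[0, ∞]`. -/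
noncomputable def bmoNorm (D : DyadicSystem n) (μ : Measure (Fin n → ℝ))
    (f : (Fin n → ℝ) → ℝ) : ℝ≥0∞ :=
  ⨆ k : ℤ, essSup (fun x => ⨍⁻ y in D.cell k x, ‖f y - D.expect μ (k - 1) f y‖ₑ ∂μ) μ

theorem cell_eq (D : DyadicSystem n) {k : ℤ} {Q : Set (Fin n → ℝ)} (hQ : Q ∈ D.gen k)
    {x : Fin n → ℝ} (hx : x ∈ Q) : D.cell k x = Q := by
  have h : {Q' | Q' ∈ D.gen k ∧ x ∈ Q'} = {Q} := by
    ext Q'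
    exact ⟨fun h' => (D.partition k x).unique h' ⟨hQ, hx⟩, fun h' => h' ▸ ⟨hQ, hx⟩⟩
  rw [cell, h, sUnion_singleton]

theorem cell_mem (D : DyadicSystem n) (k : ℤ) (x : Fin n → ℝ) : D.cell k x ∈ D.gen k := by
  obtain ⟨Q, ⟨hQ, hx⟩, -⟩ := D.partition k x
  rwa [D.cell_eq hQ hx]

theorem countable_gen (D : DyadicSystem n) (k : ℤ) : (D.gen k).Countable := by
  apply PairwiseDisjoint.countable_of_nonempty_interior (s := id)
  · intro Q hQ R hR hne
    refine Set.disjoint_left.2 fun x hx hx' => hne ?_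
    exact (D.partition k x).unique ⟨hQ, hx⟩ ⟨hR, hx'⟩
  · intro Q hQ
    obtain ⟨a, rfl⟩ := D.isCube k Q hQ
    have h2 : (0 : ℝ) < (2 : ℝ) ^ (-k) := by positivity
    rw [id, interior_pi_set Set.finite_univ]
    refine ⟨fun i => a i + (2 : ℝ) ^ (-k) / 2, fun i _ => ?_⟩
    simp only [interior_Ico, mem_Ioo]
    constructor <;> linarith

theorem measurableSet_of_gen (D : DyadicSystem n) {k : ℤ} {Q : Set (Fin n → ℝ)}
    (hQ : Q ∈ D.gen k) : MeasurableSet Q := by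
  obtain ⟨a, rfl⟩ := D.isCube k Q hQ
  exact MeasurableSet.univ_pi fun i => measurableSet_Ico

/-- A function of the cell of `x` is measurable. -/
theorem measurable_comp_cell (D : DyadicSystem n) {β : Type*} [MeasurableSpace β] (k : ℤ)
    (F : Set (Fin n → ℝ) → β) : Measurable fun x => F (D.cell k x) := by
  intro s _
  have h : (fun x => F (D.cell k x)) ⁻¹' s = ⋃ Q ∈ {Q | Q ∈ D.gen k ∧ F Q ∈ s}, Q := by
    ext x
    simp only [mem_preimage, mem_iUnion, mem_ofPred_eq, exists_prop]
    constructor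
    · intro hx
      obtain ⟨Q, ⟨hQ, hxQ⟩, -⟩ := D.partition k x
      rw [D.cell_eq hQ hxQ] at hx
      exact ⟨Q, ⟨hQ, hx⟩, hxQ⟩
    · rintro ⟨Q, ⟨hQ, hs⟩, hxQ⟩
      rwa [D.cell_eq hQ hxQ]
  rw [h]
  exact MeasurableSet.biUnion ((D.countable_gen k).mono fun Q hQ => hQ.1)
    fun Q hQ => D.measurableSet_of_gen hQ.1

theorem measurable_expect (D : DyadicSystem n) (μ : Measure (Fin n → ℝ)) (k : ℤ)
    (f : (Fin n → ℝ) → ℝ) : Measurable (D.expect μ k f) :=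
  D.measurable_comp_cell k fun Q => ⨍ y in Q, f y ∂μ

theorem measurable_squareFn (D : DyadicSystem n) (μ : Measure (Fin n → ℝ))
    (f : (Fin n → ℝ) → ℝ) : Measurable (D.squareFn μ f) := by
  refine Measurable.pow_const (Measurable.tsum fun k => ?_) _
  exact (((D.measurable_expect μ k f).sub
    (D.measurable_expect μ (k - 1) f)).enorm).pow_const _

theorem expect_congr (D : DyadicSystem n) {μ : Measure (Fin n → ℝ)} {f g : (Fin n → ℝ) → ℝ}
    (h : f =ᵐ[μ] g) (k : ℤ) : D.expect μ k f = D.expect μ k g := by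
  funext x
  simp only [expect, setAverage_eq]
  rw [integral_congr_ae (ae_restrict_of_ae h)]

theorem expect_add (D : DyadicSystem n) {μ : Measure (Fin n → ℝ)} {f g : (Fin n → ℝ) → ℝ}
    (hf : ∀ Q ∈ D.cubes, IntegrableOn f Q μ) (hg : ∀ Q ∈ D.cubes, IntegrableOn g Q μ) (k : ℤ) :
    D.expect μ k (f + g) = D.expect μ k f + D.expect μ k g := by
  funext x
  have hc : D.cell k x ∈ D.cubes := ⟨k, D.cell_mem k x⟩
  simp only [expect, setAverage_eq, Pi.add_apply]
  rw [integral_add (hf _ hc) (hg _ hc), smul_add]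

theorem expect_smul (D : DyadicSystem n) (μ : Measure (Fin n → ℝ)) (c : ℝ)
    (f : (Fin n → ℝ) → ℝ) (k : ℤ) : D.expect μ k (c • f) = c • D.expect μ k f := by
  funext x
  simp only [expect, setAverage_eq, Pi.smul_apply]
  rw [integral_smul, smul_comm]

theorem h1Norm_congr (D : DyadicSystem n) {μ : Measure (Fin n → ℝ)} {f g : (Fin n → ℝ) → ℝ}
    (h : f =ᵐ[μ] g) : D.h1Norm μ f = D.h1Norm μ g := by
  simp only [h1Norm, squareFn, mdiff, D.expect_congr h]

theorem h1Norm_zero (D : DyadicSystem n) (μ : Measure (Fin n → ℝ)) :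
    D.h1Norm μ 0 = 0 := by
  simp [h1Norm, squareFn, mdiff, expect]

theorem h1Norm_add_le (D : DyadicSystem n) {μ : Measure (Fin n → ℝ)} {f g : (Fin n → ℝ) → ℝ}
    (hf : ∀ Q ∈ D.cubes, IntegrableOn f Q μ) (hg : ∀ Q ∈ D.cubes, IntegrableOn g Q μ) :
    D.h1Norm μ (f + g) ≤ D.h1Norm μ f + D.h1Norm μ g := by
  rw [h1Norm, h1Norm, h1Norm, ← lintegral_add_left (D.measurable_squareFn μ f)]
  refine lintegral_mono fun x => ?_
  have key := ENNReal.lintegral_Lp_add_le (μ := (Measure.count : Measure ℤ)) (p := 2)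
    (f := fun k => ‖D.mdiff μ k f x‖ₑ) (g := fun k => ‖D.mdiff μ k g x‖ₑ)
    (measurable_of_countable _).aemeasurable (measurable_of_countable _).aemeasurable one_le_two
  simp only [lintegral_count, Pi.add_apply] at key
  refine le_trans ?_ key
  refine ENNReal.rpow_le_rpow (ENNReal.tsum_le_tsum fun k => ?_) (by norm_num)
  refine ENNReal.rpow_le_rpow ?_ (by norm_num)
  refine le_trans (le_of_eq ?_) (enorm_add_le _ _)
  congr 1
  simp only [mdiff, D.expect_add hf hg, Pi.add_apply]
  ring

theorem h1Norm_smul (D : DyadicSystem n) (μ : Measure (Fin n → ℝ)) (c : ℝ)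
    (f : (Fin n → ℝ) → ℝ) : D.h1Norm μ (c • f) = ‖c‖ₑ * D.h1Norm μ f := by
  rw [h1Norm, h1Norm, ← lintegral_const_mul _ (D.measurable_squareFn μ f)]
  refine lintegral_congr fun x => ?_
  have h : ∀ k, ‖D.mdiff μ k (c • f) x‖ₑ ^ (2 : ℝ) =
      ‖c‖ₑ ^ (2 : ℝ) * ‖D.mdiff μ k f x‖ₑ ^ (2 : ℝ) := fun k => by
    rw [← ENNReal.mul_rpow_of_nonneg _ _ (by norm_num), ← enorm_mul]
    simp only [mdiff, D.expect_smul, Pi.smul_apply, smul_eq_mul, mul_sub]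
  simp only [squareFn, h]
  rw [ENNReal.tsum_mul_left, ENNReal.mul_rpow_of_nonneg _ _ (by norm_num), ← ENNReal.rpow_mul]
  norm_num

/-- The martingale Hardy space: the `f ∈ L¹(μ)` with `S f ∈ L¹(μ)`. -/
noncomputable def H1 (D : DyadicSystem n) (μ : Measure (Fin n → ℝ)) :
    Submodule ℝ (Lp ℝ 1 μ) where
  carrier := {f | D.h1Norm μ f < ∞}
  zero_mem' := by
    have h : D.h1Norm μ (0 : Lp ℝ 1 μ) = 0 := by
      rw [D.h1Norm_congr (Lp.coeFn_zero ℝ 1 μ), D.h1Norm_zero]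
    change D.h1Norm μ (0 : Lp ℝ 1 μ) < ∞
    rw [h]
    exact ENNReal.zero_lt_top
  add_mem' := by
    intro f g hf hg
    simp only [mem_ofPred_eq] at hf hg ⊢
    rw [D.h1Norm_congr (Lp.coeFn_add f g)]
    exact (D.h1Norm_add_le (fun Q _ => (L1.integrable_coeFn f).integrableOn)
      (fun Q _ => (L1.integrable_coeFn g).integrableOn)).trans_lt (ENNReal.add_lt_top.2 ⟨hf, hg⟩)
  smul_mem' := by
    intro c f hf
    simp only [mem_ofPred_eq] at hf ⊢
    rw [D.h1Norm_congr (Lp.coeFn_smul c f), D.h1Norm_smul]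
    exact ENNReal.mul_lt_top enorm_lt_top hf

theorem bmoNorm_congr (D : DyadicSystem n) {μ : Measure (Fin n → ℝ)} {f g : (Fin n → ℝ) → ℝ}
    (h : f =ᵐ[μ] g) : D.bmoNorm μ f = D.bmoNorm μ g := by
  simp only [bmoNorm, D.expect_congr h, setLAverage_eq]
  congr! 5 with k x
  refine lintegral_congr_ae ?_
  filter_upwards [ae_restrict_of_ae h] with y hy
  rw [hy]

theorem bmoNorm_zero (D : DyadicSystem n) (μ : Measure (Fin n → ℝ)) :
    D.bmoNorm μ 0 = 0 := by
  have h : ∀ k, D.expect μ k 0 = 0 := fun k => by funext x; simp [expect]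
  simp only [bmoNorm, h, setLAverage_eq, Pi.zero_apply, sub_zero, enorm_zero, lintegral_zero,
    ENNReal.zero_div, ENNReal.iSup_eq_zero]
  intro k
  exact nonpos_iff_eq_zero.1 (essSup_le_of_ae_le 0 (Filter.Eventually.of_forall fun x => le_rfl))

theorem bmoNorm_add_le (D : DyadicSystem n) {μ : Measure (Fin n → ℝ)} {f g : (Fin n → ℝ) → ℝ}
    (hf : ∀ Q ∈ D.cubes, IntegrableOn f Q μ) (hg : ∀ Q ∈ D.cubes, IntegrableOn g Q μ) :
    D.bmoNorm μ (f + g) ≤ D.bmoNorm μ f + D.bmoNorm μ g := by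
  refine iSup_le fun k => le_trans ?_ (add_le_add
    (le_iSup (fun k : ℤ => essSup (fun x => ⨍⁻ y in D.cell k x,
      ‖f y - D.expect μ (k - 1) f y‖ₑ ∂μ) μ) k)
    (le_iSup (fun k : ℤ => essSup (fun x => ⨍⁻ y in D.cell k x,
      ‖g y - D.expect μ (k - 1) g y‖ₑ ∂μ) μ) k))
  refine le_trans (essSup_mono_ae (Filter.Eventually.of_forall fun x => ?_))
    (ENNReal.essSup_add_le _ _)
  have hc : D.cell k x ∈ D.cubes := ⟨k, D.cell_mem k x⟩
  simp only [Pi.add_apply, setLAverage_eq]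
  have hm : AEMeasurable (fun y => ‖f y - D.expect μ (k - 1) f y‖ₑ) (μ.restrict (D.cell k x)) :=
    ((hf _ hc).aestronglyMeasurable.aemeasurable.sub
      (D.measurable_expect μ (k - 1) f).aemeasurable).enorm
  rw [← ENNReal.add_div, ← lintegral_add_left' hm]
  refine ENNReal.div_le_div_right (lintegral_mono fun y => ?_) _
  refine le_trans (le_of_eq ?_) (enorm_add_le _ _)
  congr 1
  simp only [D.expect_add hf hg, Pi.add_apply]
  ring

theorem bmoNorm_smul_le (D : DyadicSystem n) (μ : Measure (Fin n → ℝ)) (c : ℝ)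
    (f : (Fin n → ℝ) → ℝ) : D.bmoNorm μ (c • f) ≤ ‖c‖ₑ * D.bmoNorm μ f := by
  refine iSup_le fun k => le_trans ?_ (mul_le_mul_right
    (le_iSup (fun k : ℤ => essSup (fun x => ⨍⁻ y in D.cell k x,
      ‖f y - D.expect μ (k - 1) f y‖ₑ ∂μ) μ) k) _)
  rw [← ENNReal.essSup_const_mul]
  refine essSup_mono_ae (Filter.Eventually.of_forall fun x => ?_)
  simp only [setLAverage_eq]
  rw [← mul_div_assoc, ← lintegral_const_mul' _ _ enorm_ne_top]
  refine ENNReal.div_le_div_right (lintegral_mono fun y => le_of_eq ?_) _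
  rw [← enorm_mul]
  simp only [D.expect_smul, Pi.smul_apply, smul_eq_mul, mul_sub]

/-- The (classes of) functions, integrable on every dyadic cube, with finite martingale BMO
seminorm. -/
noncomputable def BMO (D : DyadicSystem n) (μ : Measure (Fin n → ℝ)) :
    Submodule ℝ ((Fin n → ℝ) →ₘ[μ] ℝ) where
  carrier := {f | (∀ Q ∈ D.cubes, IntegrableOn f Q μ) ∧ D.bmoNorm μ f < ∞}
  zero_mem' := by
    have h0 : ((0 : (Fin n → ℝ) →ₘ[μ] ℝ) : (Fin n → ℝ) → ℝ) =ᵐ[μ] 0 := AEEqFun.coeFn_zero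
    refine ⟨fun Q _ => ?_, ?_⟩
    · exact ((integrable_zero _ _ _).congr h0.symm).integrableOn
    · rw [D.bmoNorm_congr h0, D.bmoNorm_zero]
      exact ENNReal.zero_lt_top
  add_mem' := by
    rintro f g ⟨hf, hf'⟩ ⟨hg, hg'⟩
    refine ⟨fun Q hQ => ?_, ?_⟩
    · exact ((hf Q hQ).add (hg Q hQ)).congr (ae_restrict_of_ae (AEEqFun.coeFn_add f g).symm)
    · rw [D.bmoNorm_congr (AEEqFun.coeFn_add f g)]
      exact (D.bmoNorm_add_le hf hg).trans_lt (ENNReal.add_lt_top.2 ⟨hf', hg'⟩)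
  smul_mem' := by
    rintro c f ⟨hf, hf'⟩
    refine ⟨fun Q hQ => ?_, ?_⟩
    · exact ((hf Q hQ).smul c).congr (ae_restrict_of_ae (AEEqFun.coeFn_smul c f).symm)
    · rw [D.bmoNorm_congr (AEEqFun.coeFn_smul c f)]
      exact (D.bmoNorm_smul_le μ c f).trans_lt (ENNReal.mul_lt_top enorm_lt_top hf')

/-- The elements of `BMO` whose seminorm vanishes. -/
noncomputable def BMONull (D : DyadicSystem n) (μ : Measure (Fin n → ℝ)) :
    Submodule ℝ (D.BMO μ) where
  carrier := {f | D.bmoNorm μ f.1 = 0}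
  zero_mem' := by
    have h0 : ((0 : (Fin n → ℝ) →ₘ[μ] ℝ) : (Fin n → ℝ) → ℝ) =ᵐ[μ] 0 := AEEqFun.coeFn_zero
    change D.bmoNorm μ (0 : (Fin n → ℝ) →ₘ[μ] ℝ) = 0
    rw [D.bmoNorm_congr h0, D.bmoNorm_zero]
  add_mem' := by
    intro f g hf hg
    change D.bmoNorm μ (f.1 + g.1 : (Fin n → ℝ) →ₘ[μ] ℝ) = 0
    rw [mem_ofPred_eq] at hf hg
    rw [D.bmoNorm_congr (AEEqFun.coeFn_add f.1 g.1), ← nonpos_iff_eq_zero]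
    exact (D.bmoNorm_add_le f.2.1 g.2.1).trans (by rw [hf, hg, add_zero])
  smul_mem' := by
    intro c f hf
    change D.bmoNorm μ (c • f.1 : (Fin n → ℝ) →ₘ[μ] ℝ) = 0
    rw [mem_ofPred_eq] at hf
    rw [D.bmoNorm_congr (AEEqFun.coeFn_smul c f.1), ← nonpos_iff_eq_zero]
    exact (D.bmoNorm_smul_le μ c f.1).trans (by rw [hf, mul_zero])

/-- The normed space `BMO(μ)`: functions of finite seminorm modulo those of seminorm zero. -/
abbrev BMOSpace (D : DyadicSystem n) (μ : Measure (Fin n → ℝ)) : Type :=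
  D.BMO μ ⧸ D.BMONull μ

/-- The class in `BMO(μ)` of a function. -/
noncomputable abbrev toBMO (D : DyadicSystem n) (μ : Measure (Fin n → ℝ)) (f : D.BMO μ) :
    D.BMOSpace μ :=
  (D.BMONull μ).mkQ f

end DyadicSystem

/-- A Haar system for `μ`: to each cube `Q` are attached `2 ^ n - 1` functions that vanish off `Q`,
are constant on the dyadic children of `Q` and have integral `0`; all of them together form an
orthonormal basis of `L²(μ)`. -/
structure HaarSystem {n : ℕ} (D : DyadicSystem n) (μ : Measure (Fin n → ℝ)) where
  fn : D.cubes → Fin (2 ^ n - 1) → (Fin n → ℝ) → ℝ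
  support_subset : ∀ Q j, Function.support (fn Q j) ⊆ Q
  const_on_children : ∀ (Q : D.cubes) (j), ∀ R ∈ D.desc 1 Q, ∀ x ∈ R, ∀ y ∈ R,
    fn Q j x = fn Q j y
  memLp : ∀ Q j, MemLp (fn Q j) 2 μ
  integral_eq_zero : ∀ Q j, ∫ x, fn Q j x ∂μ = 0
  orthonormal : Orthonormal ℝ
    fun p : D.cubes × Fin (2 ^ n - 1) => (memLp p.1 p.2).toLp (fn p.1 p.2)
  dense_span : (Submodule.span ℝ (Set.range
    fun p : D.cubes × Fin (2 ^ n - 1) =>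
      (memLp p.1 p.2).toLp (fn p.1 p.2))).topologicalClosure = ⊤

namespace HaarSystem

variable {n : ℕ} {D : DyadicSystem n} {μ : Measure (Fin n → ℝ)}

/-- The Haar function as an element of `L²(μ)`. -/
noncomputable def vec (h : HaarSystem D μ) (Q : D.cubes) (j : Fin (2 ^ n - 1)) : Lp ℝ 2 μ :=
  (h.memLp Q j).toLp (h.fn Q j)

/-- `μ` is balanced: for cubes `Q` and children `R` of `Q`,
`‖h_Q‖₁ ‖h_R‖_∞ + ‖h_Q‖_∞ ‖h_R‖₁` is bounded. -/
def Balanced (h : HaarSystem D μ) : Prop :=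
  ∃ C : ℝ≥0, ∀ Q R : D.cubes, R.1 ∈ D.desc 1 Q → ∀ i j : Fin (2 ^ n - 1),
    eLpNorm (h.fn Q i) 1 μ * eLpNorm (h.fn R j) ∞ μ +
      eLpNorm (h.fn Q i) ∞ μ * eLpNorm (h.fn R j) 1 μ ≤ C

/-- The triples `(Q, R, S)` of cubes with `R` in the `r`-th and `S` in the `s`-th generation of
descendants of `Q`. -/
def Triple (D : DyadicSystem n) (r s : ℕ) : Type :=
  {p : D.cubes × D.cubes × D.cubes // p.2.1.1 ∈ D.desc r p.1 ∧ p.2.2.1 ∈ D.desc s p.1}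

/-- The bounded operator `T` on `L²(μ)` is a Haar shift of complexity `(r, s)`:
`T f = ∑_Q ∑_{R, S} ∑_{i, j} α ⟨f, h_R^i⟩ h_S^j`, the coefficient `α` depending on `Q, R, S, i, j`
and the series converging unconditionally in `L²(μ)`. -/
def IsHaarShift (h : HaarSystem D μ) (r s : ℕ) (T : Lp ℝ 2 μ →L[ℝ] Lp ℝ 2 μ) : Prop :=
  ∃ α : Triple D r s → Fin (2 ^ n - 1) → Fin (2 ^ n - 1) → ℝ, ∀ f : Lp ℝ 2 μ,
    HasSum (fun p : Triple D r s × Fin (2 ^ n - 1) × Fin (2 ^ n - 1) =>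
      (α p.1 p.2.1 p.2.2 * inner ℝ (h.vec p.1.1.2.1 p.2.1) f) • h.vec p.1.1.2.2 p.2.2) (T f)

end HaarSystem

namespace DyadicSystem

open Filter Topology

variable {n : ℕ}

theorem mem_cell (D : DyadicSystem n) (k : ℤ) (x : Fin n → ℝ) : x ∈ D.cell k x := by
  obtain ⟨Q, ⟨hQ, hx⟩, -⟩ := D.partition k x
  rwa [D.cell_eq hQ hx]

theorem cell_eq_of_mem (D : DyadicSystem n) {k : ℤ} {x y : Fin n → ℝ} (h : y ∈ D.cell k x) :
    D.cell k y = D.cell k x :=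
  D.cell_eq (D.cell_mem k x) h

theorem measurableSet_cell (D : DyadicSystem n) (k : ℤ) (x : Fin n → ℝ) :
    MeasurableSet (D.cell k x) :=
  D.measurableSet_of_gen (D.cell_mem k x)

theorem cell_mem_cubes (D : DyadicSystem n) (k : ℤ) (x : Fin n → ℝ) : D.cell k x ∈ D.cubes :=
  ⟨k, D.cell_mem k x⟩

theorem nonempty_of_gen (D : DyadicSystem n) {k : ℤ} {Q : Set (Fin n → ℝ)} (hQ : Q ∈ D.gen k) :
    Q.Nonempty := by
  obtain ⟨a, rfl⟩ := D.isCube k Q hQ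
  have h2 : (0 : ℝ) < (2 : ℝ) ^ (-k) := by positivity
  exact ⟨a, fun i _ => ⟨le_rfl, by linarith⟩⟩

theorem volume_of_gen (D : DyadicSystem n) {k : ℤ} {Q : Set (Fin n → ℝ)} (hQ : Q ∈ D.gen k) :
    volume Q = ENNReal.ofReal ((2 : ℝ) ^ (-k)) ^ n := by
  obtain ⟨a, rfl⟩ := D.isCube k Q hQ
  rw [volume_pi_pi]
  simp

theorem le_of_gen_subset (D : DyadicSystem n) (hn : 1 ≤ n) {k l : ℤ} {Q R : Set (Fin n → ℝ)}
    (hQ : Q ∈ D.gen k) (hR : R ∈ D.gen l) (h : R ⊆ Q) : k ≤ l := by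
  have h1 := measure_mono (μ := volume) h
  rw [D.volume_of_gen hQ, D.volume_of_gen hR] at h1
  have h2 := (ENNReal.pow_le_pow_left_iff (by omega : n ≠ 0)).1 h1
  rw [ENNReal.ofReal_le_ofReal_iff (by positivity)] at h2
  have := (zpow_le_zpow_iff_right₀ (by norm_num : (1 : ℝ) < 2)).1 h2
  omega

theorem gen_unique (D : DyadicSystem n) (hn : 1 ≤ n) {k l : ℤ} {Q : Set (Fin n → ℝ)}
    (hQ : Q ∈ D.gen k) (hQ' : Q ∈ D.gen l) : k = l :=
  le_antisymm (D.le_of_gen_subset hn hQ hQ' subset_rfl) (D.le_of_gen_subset hn hQ' hQ subset_rfl)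

theorem cell_subset (D : DyadicSystem n) (hn : 1 ≤ n) {k l : ℤ} (hkl : k ≤ l) (x : Fin n → ℝ) :
    D.cell l x ⊆ D.cell k x := by
  rcases D.nested l k _ (D.cell_mem l x) _ (D.cell_mem k x) with h | h | h
  · exact absurd (D.mem_cell k x) (Set.disjoint_left.1 h (D.mem_cell l x))
  · exact h
  · have := D.le_of_gen_subset hn (D.cell_mem l x) (D.cell_mem k x) h
    obtain rfl := le_antisymm hkl this
    exact subset_rfl

theorem cell_eq_of_le (D : DyadicSystem n) (hn : 1 ≤ n) {k l : ℤ} (hkl : k ≤ l)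
    {x y : Fin n → ℝ} (h : D.cell l x = D.cell l y) : D.cell k x = D.cell k y := by
  apply D.cell_eq_of_mem
  apply D.cell_subset hn hkl
  rw [← h]
  exact D.mem_cell l x

theorem cell_subset_of_mem_gen (D : DyadicSystem n) (hn : 1 ≤ n) {k l : ℤ} (hkl : k ≤ l)
    {Q : Set (Fin n → ℝ)} (hQ : Q ∈ D.gen k) {x : Fin n → ℝ} (hx : x ∈ Q) : D.cell l x ⊆ Q := by
  rw [← D.cell_eq hQ hx]
  exact D.cell_subset hn hkl x

theorem subset_or_disjoint (D : DyadicSystem n) (hn : 1 ≤ n) {k l : ℤ} (hkl : k ≤ l)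
    {Q R : Set (Fin n → ℝ)} (hQ : Q ∈ D.gen k) (hR : R ∈ D.gen l) : R ⊆ Q ∨ Disjoint R Q := by
  by_cases h : Disjoint R Q
  · exact Or.inr h
  · obtain ⟨x, hx, hx'⟩ := Set.not_disjoint_iff.1 h
    rw [← D.cell_eq hR hx]
    exact Or.inl (D.cell_subset_of_mem_gen hn hkl hQ hx')

theorem countable_cubes (D : DyadicSystem n) : D.cubes.Countable := by
  have : D.cubes = ⋃ k, D.gen k := by
    ext Q
    simp [cubes]
  rw [this]
  exact countable_iUnion fun k => D.countable_gen k

instance (D : DyadicSystem n) : Countable D.cubes := D.countable_cubes.to_subtype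

/-- The generation of a cube. -/
noncomputable def level (D : DyadicSystem n) (Q : D.cubes) : ℤ := Q.2.choose

theorem mem_gen_level (D : DyadicSystem n) (Q : D.cubes) : Q.1 ∈ D.gen (D.level Q) :=
  Q.2.choose_spec

theorem level_eq (D : DyadicSystem n) (hn : 1 ≤ n) {Q : D.cubes} {k : ℤ} (h : Q.1 ∈ D.gen k) :
    D.level Q = k :=
  D.gen_unique hn (D.mem_gen_level Q) h

/-- The cell of `x` as an element of the type of cubes. -/
def cellCube (D : DyadicSystem n) (k : ℤ) (x : Fin n → ℝ) : D.cubes :=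
  ⟨D.cell k x, D.cell_mem_cubes k x⟩

theorem level_cellCube (D : DyadicSystem n) (hn : 1 ≤ n) (k : ℤ) (x : Fin n → ℝ) :
    D.level (D.cellCube k x) = k :=
  D.level_eq hn (D.cell_mem k x)

theorem cellCube_eq_of_mem (D : DyadicSystem n) {k : ℤ} {x y : Fin n → ℝ} (h : y ∈ D.cell k x) :
    D.cellCube k y = D.cellCube k x :=
  Subtype.ext (D.cell_eq_of_mem h)

theorem cellCube_level (D : DyadicSystem n) {Q : D.cubes} {x : Fin n → ℝ} (hx : x ∈ Q.1) :
    D.cellCube (D.level Q) x = Q :=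
  Subtype.ext (D.cell_eq (D.mem_gen_level Q) hx)

theorem cellCube_injective (D : DyadicSystem n) (hn : 1 ≤ n) (x : Fin n → ℝ) :
    Function.Injective fun k => D.cellCube k x := fun k l h => by
  have h1 := D.level_cellCube hn k x
  have h2 := D.level_cellCube hn l x
  simp only at h
  rw [← h1, ← h2, h]

theorem mem_desc_iff (D : DyadicSystem n) (hn : 1 ≤ n) {k : ℤ} {r : ℕ}
    {Q R : Set (Fin n → ℝ)} (hQ : Q ∈ D.gen k) :
    R ∈ D.desc r Q ↔ R ∈ D.gen (k + r) ∧ R ⊆ Q := by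
  constructor
  · rintro ⟨l, hl, hR, h⟩
    obtain rfl := D.gen_unique hn hQ hl
    exact ⟨hR, h⟩
  · rintro ⟨hR, h⟩
    exact ⟨k, hQ, hR, h⟩

theorem cell_mem_desc (D : DyadicSystem n) (hn : 1 ≤ n) (k : ℤ) (r : ℕ) (x : Fin n → ℝ) :
    D.cell (k + r) x ∈ D.desc r (D.cell k x) :=
  ⟨k, D.cell_mem k x, D.cell_mem _ x, D.cell_subset hn (by omega) x⟩

theorem card_le_of_subset_desc (D : DyadicSystem n) (hn : 1 ≤ n) (r : ℕ) (Q : Set (Fin n → ℝ))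
    (F : Finset (Set (Fin n → ℝ))) (hF : (F : Set (Set (Fin n → ℝ))) ⊆ D.desc r Q) :
    F.card ≤ 2 ^ (n * r) := by
  rcases F.eq_empty_or_nonempty with rfl | ⟨R₀, hR₀⟩
  · simp
  obtain ⟨k, hQ, -⟩ := hF hR₀
  have hR : ∀ R ∈ F, R ∈ D.gen (k + r) ∧ R ⊆ Q := fun R h => (D.mem_desc_iff hn hQ).1 (hF h)
  have hd : Set.PairwiseDisjoint (F : Set (Set (Fin n → ℝ))) id := by
    intro A hA B hB hne
    refine Set.disjoint_left.2 fun x hx hx' => hne ?_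
    exact (D.partition _ x).unique ⟨(hR A hA).1, hx⟩ ⟨(hR B hB).1, hx'⟩
  have h1 : volume (⋃ R ∈ F, id R) ≤ volume Q :=
    measure_mono (Set.iUnion₂_subset fun R h => (hR R h).2)
  rw [measure_biUnion_finset hd fun R h => D.measurableSet_of_gen (hR R h).1] at h1
  simp only [id] at h1
  rw [Finset.sum_congr rfl fun R h => D.volume_of_gen (hR R h).1, D.volume_of_gen hQ,
    Finset.sum_const, nsmul_eq_mul] at h1
  have h2 : ENNReal.ofReal ((2 : ℝ) ^ (-k)) ^ n =
      (2 ^ (n * r) : ℕ) * ENNReal.ofReal ((2 : ℝ) ^ (-(k + r))) ^ n := by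
    rw [← ENNReal.ofReal_pow (by positivity), ← ENNReal.ofReal_pow (by positivity),
      ← ENNReal.ofReal_natCast, ← ENNReal.ofReal_mul (by positivity)]
    congr 1
    have h3 : (2 : ℝ) ^ (-k) = 2 ^ r * 2 ^ (-(k + r)) := by
      rw [← zpow_natCast, ← zpow_add₀ (by norm_num)]
      congr 1
      ring
    rw [h3, mul_pow]
    push_cast
    rw [mul_comm n r, pow_mul]
  rw [h2] at h1
  have h0 : ENNReal.ofReal ((2 : ℝ) ^ (-(k + r))) ^ n ≠ 0 :=
    pow_ne_zero _ (ENNReal.ofReal_pos.2 (by positivity)).ne'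
  have h4 := ENNReal.div_le_div_right h1 (ENNReal.ofReal ((2 : ℝ) ^ (-(k + r))) ^ n)
  rw [ENNReal.mul_div_cancel_right h0 (by simp), ENNReal.mul_div_cancel_right h0 (by simp)] at h4
  exact_mod_cast h4

theorem finite_desc (D : DyadicSystem n) (hn : 1 ≤ n) (r : ℕ) (Q : Set (Fin n → ℝ)) :
    (D.desc r Q).Finite := by
  by_contra h
  obtain ⟨F, hF, hc⟩ := Set.Infinite.exists_subset_card_eq h (2 ^ (n * r) + 1)
  have := D.card_le_of_subset_desc hn r Q F hF
  omega

/-- `θ` is constant on the cubes of generation `k`. -/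
def Adapted (D : DyadicSystem n) {β : Type*} (k : ℤ) (θ : (Fin n → ℝ) → β) : Prop :=
  ∀ x y, y ∈ D.cell k x → θ y = θ x

theorem Adapted.measurable {D : DyadicSystem n} {β : Type*} [MeasurableSpace β] {k : ℤ}
    {θ : (Fin n → ℝ) → β} (h : D.Adapted k θ) : Measurable θ := by
  classical
  have : θ = fun x => (fun Q : Set (Fin n → ℝ) =>
      if hQ : Q.Nonempty then θ hQ.some else θ 0) (D.cell k x) := by
    funext x
    have hne : (D.cell k x).Nonempty := ⟨x, D.mem_cell k x⟩
    simp only [hne, dif_pos]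
    exact (h x _ hne.some_mem).symm
  rw [this]
  exact D.measurable_comp_cell k (fun Q : Set (Fin n → ℝ) =>
      if hQ : Q.Nonempty then θ hQ.some else θ 0)

theorem Adapted.mono {D : DyadicSystem n} {β : Type*} (hn : 1 ≤ n) {k l : ℤ} (hkl : k ≤ l)
    {θ : (Fin n → ℝ) → β} (h : D.Adapted k θ) : D.Adapted l θ :=
  fun x y hy => h x y (D.cell_subset hn hkl x hy)

theorem Adapted.comp {D : DyadicSystem n} {β γ : Type*} {k : ℤ} {θ : (Fin n → ℝ) → β}
    (h : D.Adapted k θ) (g : β → γ) : D.Adapted k fun x => g (θ x) :=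
  fun x y hy => congrArg g (h x y hy)

theorem adapted_expect (D : DyadicSystem n) (μ : Measure (Fin n → ℝ)) (k : ℤ)
    (f : (Fin n → ℝ) → ℝ) : D.Adapted k (D.expect μ k f) := fun x y hy => by
  rw [expect, expect, D.cell_eq_of_mem hy]

theorem Adapted.bddOn {D : DyadicSystem n} (hn : 1 ≤ n) {k l : ℤ} {θ : (Fin n → ℝ) → ℝ}
    (h : D.Adapted k θ) {Q : Set (Fin n → ℝ)} (hQ : Q ∈ D.gen l) : ∃ C, ∀ x ∈ Q, ‖θ x‖ ≤ C := by
  classical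
  have h' : D.Adapted (l + (k - l).toNat) θ := h.mono hn (by omega)
  have hfin : (θ '' Q).Finite := by
    refine ((D.finite_desc hn (k - l).toNat Q).image
      fun R => if hR : R.Nonempty then θ hR.some else θ 0).subset ?_
    rintro _ ⟨x, hx, rfl⟩
    have hd := D.cell_mem_desc hn l (k - l).toNat x
    rw [D.cell_eq hQ hx] at hd
    refine ⟨_, hd, ?_⟩
    have hne : (D.cell (l + (k - l).toNat) x).Nonempty := ⟨x, D.mem_cell _ x⟩
    simp only [hne, dif_pos]
    exact h' x _ hne.some_mem
  obtain ⟨C, hC⟩ := hfin.isBounded.exists_norm_le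
  exact ⟨C, fun x hx => hC _ ⟨x, hx, rfl⟩⟩

theorem Adapted.integrableOn_mul {D : DyadicSystem n} (hn : 1 ≤ n) {μ : Measure (Fin n → ℝ)}
    {k l : ℤ} {θ : (Fin n → ℝ) → ℝ} (h : D.Adapted k θ) {Q : Set (Fin n → ℝ)} (hQ : Q ∈ D.gen l)
    {f : (Fin n → ℝ) → ℝ} (hf : IntegrableOn f Q μ) :
    IntegrableOn (fun x => θ x * f x) Q μ := by
  obtain ⟨C, hC⟩ := h.bddOn hn hQ
  exact Integrable.bdd_mul (c := C) hf h.measurable.aestronglyMeasurable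
    ((ae_restrict_iff' (D.measurableSet_of_gen hQ)).2 (Eventually.of_forall hC))

theorem Adapted.integrableOn {D : DyadicSystem n} (hn : 1 ≤ n) {μ : Measure (Fin n → ℝ)}
    {k l : ℤ} {θ : (Fin n → ℝ) → ℝ} (h : D.Adapted k θ) {Q : Set (Fin n → ℝ)} (hQ : Q ∈ D.gen l)
    (hμQ : μ Q < ∞) : IntegrableOn θ Q μ := by
  have := h.integrableOn_mul hn hQ (f := fun _ => 1) (μ := μ) (integrableOn_const hμQ.ne)
  simpa using this

theorem expect_adapted_mul (D : DyadicSystem n) (μ : Measure (Fin n → ℝ)) {k : ℤ}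
    {θ : (Fin n → ℝ) → ℝ} (h : D.Adapted k θ) (f : (Fin n → ℝ) → ℝ) (x : Fin n → ℝ) :
    D.expect μ k (fun y => θ y * f y) x = θ x * D.expect μ k f x := by
  simp only [expect, setAverage_eq, smul_eq_mul]
  rw [setIntegral_congr_fun (D.measurableSet_cell k x)
    (g := fun y => θ x * f y) fun y hy => by simp only [h x y hy], integral_const_mul]
  ring

theorem expect_one (D : DyadicSystem n) {μ : Measure (Fin n → ℝ)}
    (hμ : ∀ Q ∈ D.cubes, 0 < μ Q ∧ μ Q < ∞) (k : ℤ) (x : Fin n → ℝ) :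
    D.expect μ k (fun _ => 1) x = 1 := by
  have h := hμ _ (D.cell_mem_cubes k x)
  rw [expect, setAverage_const h.1.ne' h.2.ne]

theorem expect_of_adapted (D : DyadicSystem n) {μ : Measure (Fin n → ℝ)}
    (hμ : ∀ Q ∈ D.cubes, 0 < μ Q ∧ μ Q < ∞) {k : ℤ}
    {θ : (Fin n → ℝ) → ℝ} (h : D.Adapted k θ) (x : Fin n → ℝ) : D.expect μ k θ x = θ x := by
  have := D.expect_adapted_mul μ h (fun _ => 1) x
  simpa [D.expect_one hμ] using this

theorem expect_eq_of_mem (D : DyadicSystem n) (μ : Measure (Fin n → ℝ)) {k : ℤ}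
    {Q : Set (Fin n → ℝ)} (hQ : Q ∈ D.gen k) (f : (Fin n → ℝ) → ℝ) {x : Fin n → ℝ} (hx : x ∈ Q) :
    D.expect μ k f x = ⨍ y in Q, f y ∂μ := by
  rw [expect, D.cell_eq hQ hx]

theorem setIntegral_eq_expect_mul (D : DyadicSystem n) {μ : Measure (Fin n → ℝ)}
    (hμ : ∀ Q ∈ D.cubes, 0 < μ Q ∧ μ Q < ∞) (k : ℤ) (f : (Fin n → ℝ) → ℝ) (x : Fin n → ℝ) :
    ∫ y in D.cell k x, f y ∂μ = D.expect μ k f x * μ.real (D.cell k x) := by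
  have h := hμ _ (D.cell_mem_cubes k x)
  have h' : μ.real (D.cell k x) ≠ 0 := (ENNReal.toReal_pos h.1.ne' h.2.ne).ne'
  rw [expect, setAverage_eq, smul_eq_mul]
  field_simp

theorem iUnion_desc (D : DyadicSystem n) (hn : 1 ≤ n) {k : ℤ} {r : ℕ} {Q : Set (Fin n → ℝ)}
    (hQ : Q ∈ D.gen k) : Q = ⋃ R ∈ (D.finite_desc hn r Q).toFinset, R := by
  ext x
  simp only [mem_iUnion, Set.Finite.mem_toFinset, exists_prop]
  constructor
  · intro hx
    have hd := D.cell_mem_desc hn k r x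
    rw [D.cell_eq hQ hx] at hd
    exact ⟨_, hd, D.mem_cell _ x⟩
  · rintro ⟨R, hR, hx⟩
    exact ((D.mem_desc_iff hn hQ).1 hR).2 hx

theorem setIntegral_congr_of_gen (D : DyadicSystem n) (hn : 1 ≤ n) {μ : Measure (Fin n → ℝ)}
    {k l : ℤ} (hlk : l ≤ k) {Q : Set (Fin n → ℝ)} (hQ : Q ∈ D.gen l) {f g : (Fin n → ℝ) → ℝ}
    (hf : IntegrableOn f Q μ) (hg : IntegrableOn g Q μ)
    (h : ∀ R ∈ D.gen k, R ⊆ Q → ∫ x in R, f x ∂μ = ∫ x in R, g x ∂μ) :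
    ∫ x in Q, f x ∂μ = ∫ x in Q, g x ∂μ := by
  obtain ⟨r, rfl⟩ : ∃ r : ℕ, k = l + r := ⟨(k - l).toNat, by omega⟩
  have hd : ∀ R ∈ (D.finite_desc hn r Q).toFinset, R ∈ D.gen (l + r) ∧ R ⊆ Q := fun R hR =>
    (D.mem_desc_iff hn hQ).1 ((D.finite_desc hn r Q).mem_toFinset.1 hR)
  have hm : ∀ R ∈ (D.finite_desc hn r Q).toFinset, MeasurableSet R := fun R hR =>
    D.measurableSet_of_gen (hd R hR).1
  have hdis : Set.Pairwise ((D.finite_desc hn r Q).toFinset : Set (Set (Fin n → ℝ)))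
      (Function.onFun Disjoint fun R => R) := by
    intro A hA B hB hne
    refine Set.disjoint_left.2 fun x hx hx' => hne ?_
    exact (D.partition _ x).unique ⟨(hd A hA).1, hx⟩ ⟨(hd B hB).1, hx'⟩
  rw [D.iUnion_desc hn (r := r) hQ,
    integral_biUnion_finset _ hm hdis fun R hR => hf.mono_set (hd R hR).2,
    integral_biUnion_finset _ hm hdis fun R hR => hg.mono_set (hd R hR).2]
  exact Finset.sum_congr rfl fun R hR => h R (hd R hR).1 (hd R hR).2

theorem setIntegral_expect (D : DyadicSystem n) (hn : 1 ≤ n) {μ : Measure (Fin n → ℝ)}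
    (hμ : ∀ Q ∈ D.cubes, 0 < μ Q ∧ μ Q < ∞) {k l : ℤ} (hlk : l ≤ k) {Q : Set (Fin n → ℝ)}
    (hQ : Q ∈ D.gen l) {f : (Fin n → ℝ) → ℝ} (hf : IntegrableOn f Q μ) :
    ∫ x in Q, D.expect μ k f x ∂μ = ∫ x in Q, f x ∂μ := by
  refine D.setIntegral_congr_of_gen hn hlk hQ
    ((D.adapted_expect μ k f).integrableOn hn hQ (hμ Q ⟨l, hQ⟩).2) hf fun R hR hRQ => ?_
  obtain ⟨x, hx⟩ := D.nonempty_of_gen hR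
  rw [← D.cell_eq hR hx, D.setIntegral_eq_expect_mul hμ, D.setIntegral_eq_expect_mul hμ,
    D.expect_of_adapted hμ (D.adapted_expect μ k f)]

/-- The filtration generated by the cubes of generation `k, k + 1, …`. -/
noncomputable def filtration (D : DyadicSystem n) (hn : 1 ≤ n) (k : ℤ) :
    Filtration ℕ (inferInstance : MeasurableSpace (Fin n → ℝ)) where
  seq m := MeasurableSpace.comap (D.cell (k + m)) ⊤
  mono' := by
    rintro i j hij _ ⟨s, -, rfl⟩
    refine ⟨{R | ∃ x ∈ D.cell (k + i) ⁻¹' s, R = D.cell (k + j) x}, trivial, ?_⟩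
    ext y
    simp only [mem_preimage, mem_ofPred_eq]
    constructor
    · rintro ⟨x, hx, h⟩
      rwa [D.cell_eq_of_le hn (by omega : k + (i : ℤ) ≤ k + j) h]
    · intro hy
      exact ⟨y, hy, rfl⟩
  le' := by
    rintro i _ ⟨s, -, rfl⟩
    exact @measurable_comp_cell n D _ ⊤ (k + i) (fun Q => Q) s trivial

theorem dist_le_of_mem_cell (D : DyadicSystem n) {k : ℤ} {x y : Fin n → ℝ}
    (h : y ∈ D.cell k x) : dist y x ≤ (2 : ℝ) ^ (-k) := by
  have hx := D.mem_cell k x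
  obtain ⟨a, ha⟩ := D.isCube k _ (D.cell_mem k x)
  rw [ha] at h hx
  rw [dist_pi_le_iff (by positivity)]
  intro i
  have h1 := h i trivial
  have h2 := hx i trivial
  simp only [mem_Ico] at h1 h2
  rw [Real.dist_eq, abs_le]
  constructor <;> linarith

theorem borel_le_iSup_filtration (D : DyadicSystem n) (hn : 1 ≤ n) (k : ℤ) :
    (inferInstance : MeasurableSpace (Fin n → ℝ)) ≤ ⨆ m, D.filtration hn k m := by
  refine (BorelSpace.measurable_eq (α := Fin n → ℝ)).le.trans ?_
  refine MeasurableSpace.generateFrom_le fun U hU => ?_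
  have : U = ⋃ m : ℕ, {x | D.cell (k + m) x ⊆ U} := by
    ext x
    simp only [mem_iUnion, mem_ofPred_eq]
    constructor
    · intro hx
      obtain ⟨ε, hε, hb⟩ := Metric.isOpen_iff.1 (show IsOpen U from hU) x hx
      have hlim : Tendsto (fun m : ℕ => (2 : ℝ) ^ (-k) * (1 / 2) ^ m) atTop (𝓝 0) := by
        simpa using (tendsto_pow_atTop_nhds_zero_of_lt_one (r := (1 / 2 : ℝ))
          (by norm_num) (by norm_num)).const_mul ((2 : ℝ) ^ (-k))
      obtain ⟨m, hm⟩ := (hlim.eventually (gt_mem_nhds hε)).exists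
      refine ⟨m, fun y hy => hb ?_⟩
      refine (D.dist_le_of_mem_cell hy).trans_lt (lt_of_eq_of_lt ?_ hm)
      rw [neg_add, zpow_add₀ (by norm_num), zpow_neg _ (m : ℤ), zpow_natCast]
      simp
    · rintro ⟨m, hm⟩
      exact hm (D.mem_cell _ x)
  rw [this]
  refine MeasurableSet.iUnion fun m => ?_
  have h1 : MeasurableSet[D.filtration hn k m] {x | D.cell (k + m) x ⊆ U} :=
    ⟨{R | R ⊆ U}, trivial, rfl⟩
  exact le_iSup (fun m => (D.filtration hn k m : MeasurableSpace (Fin n → ℝ))) m _ h1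

/-- Lebesgue differentiation along the dyadic cubes. -/
theorem ae_tendsto_expect (D : DyadicSystem n) (hn : 1 ≤ n) {μ : Measure (Fin n → ℝ)}
    (hμ : ∀ Q ∈ D.cubes, 0 < μ Q ∧ μ Q < ∞) {k : ℤ} {Q : Set (Fin n → ℝ)} (hQ : Q ∈ D.gen k)
    {f : (Fin n → ℝ) → ℝ} (hf : IntegrableOn f Q μ) :
    ∀ᵐ x ∂μ.restrict Q, Tendsto (fun m : ℕ => D.expect μ (k + m) f x) atTop (𝓝 (f x)) := by
  have : IsFiniteMeasure (μ.restrict Q) := ⟨by simpa using (hμ Q ⟨k, hQ⟩).2⟩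
  have hQm := D.measurableSet_of_gen hQ
  have hmk := hf.aestronglyMeasurable.ae_eq_mk
  have hfm : Integrable (hf.aestronglyMeasurable.mk f) (μ.restrict Q) := hf.congr hmk
  have hlim := hfm.tendsto_ae_condExp (ℱ := D.filtration hn k)
    (hf.aestronglyMeasurable.stronglyMeasurable_mk.mono (D.borel_le_iSup_filtration hn k))
  have hE : ∀ m : ℕ, D.expect μ (k + m) f =ᵐ[μ.restrict Q]
      (μ.restrict Q)[hf.aestronglyMeasurable.mk f | D.filtration hn k m] := by
    intro m
    refine EventuallyEq.trans ?_ (condExp_congr_ae (m := D.filtration hn k m) hmk)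
    have hint : IntegrableOn (D.expect μ (k + m) f) Q μ :=
      (D.adapted_expect μ _ f).integrableOn hn hQ (hμ Q ⟨k, hQ⟩).2
    refine ae_eq_condExp_of_forall_setIntegral_eq ((D.filtration hn k).le m) hf
      (fun s _ _ => Integrable.integrableOn hint) ?_ ?_
    · rintro A hA -
      have hAm : MeasurableSet A := (D.filtration hn k).le m _ hA
      obtain ⟨s, -, rfl⟩ := hA
      set A := D.cell (k + m) ⁻¹' s
      have hAd : D.Adapted (k + m) (A.indicator fun _ => (1 : ℝ)) := by
        intro x y hy
        have : y ∈ A ↔ x ∈ A := by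
          simp only [A, mem_preimage, D.cell_eq_of_mem hy]
        by_cases hx : x ∈ A <;> simp [hx, this]
      have hi : ∀ g : (Fin n → ℝ) → ℝ, ∫ x in A, g x ∂(μ.restrict Q) =
          ∫ x in Q, A.indicator (fun _ => (1 : ℝ)) x * g x ∂μ := by
        intro g
        rw [← integral_indicator hAm]
        refine integral_congr_ae (Eventually.of_forall fun x => ?_)
        by_cases hx : x ∈ A <;> simp [hx]
      rw [hi, hi, ← D.setIntegral_expect hn hμ (by omega : k ≤ k + m) hQ
        (hAd.integrableOn_mul hn hQ hf)]
      refine setIntegral_congr_fun hQm fun x _ => ?_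
      simp only [D.expect_adapted_mul μ hAd]
    · refine StronglyMeasurable.aestronglyMeasurable ?_
      refine Measurable.stronglyMeasurable ?_
      have hc : Measurable[D.filtration hn k m, ⊤] (D.cell (k + m)) := fun s hs => ⟨s, hs, rfl⟩
      exact (measurable_from_top (f := fun R => ⨍ y in R, f y ∂μ)).comp hc
  filter_upwards [hlim, ae_all_iff.2 hE, hmk] with x h1 h2 h3
  rw [h3]
  exact h1.congr fun m => (h2 m).symm

end DyadicSystem

namespace HaarSystem

open Filter Topology

variable {n : ℕ} {D : DyadicSystem n} {μ : Measure (Fin n → ℝ)}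

/-- The Haar function with index `p = (Q, j)`. -/
def haar (h : HaarSystem D μ) (p : D.cubes × Fin (2 ^ n - 1)) : (Fin n → ℝ) → ℝ := h.fn p.1 p.2

/-- The Haar coefficient of a function. -/
noncomputable def coef (h : HaarSystem D μ) (f : (Fin n → ℝ) → ℝ)
    (p : D.cubes × Fin (2 ^ n - 1)) : ℝ := ∫ x, f x * h.haar p x ∂μ

/-- The `L¹` norm of a Haar function. -/
noncomputable def mass (h : HaarSystem D μ) (p : D.cubes × Fin (2 ^ n - 1)) : ℝ :=
  ∫ x, |h.haar p x| ∂μ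

/-- The indices of the Haar functions attached to the cubes contained in `Q`. -/
def below (D : DyadicSystem n) (Q : Set (Fin n → ℝ)) : Set (D.cubes × Fin (2 ^ n - 1)) :=
  {p | p.1.1 ⊆ Q}

theorem haar_eq_zero (h : HaarSystem D μ) {p : D.cubes × Fin (2 ^ n - 1)} {x : Fin n → ℝ}
    (hx : x ∉ p.1.1) : h.haar p x = 0 := by
  by_contra h0
  exact hx (h.support_subset p.1 p.2 h0)

theorem adapted_haar (h : HaarSystem D μ) (hn : 1 ≤ n) (p : D.cubes × Fin (2 ^ n - 1)) :
    D.Adapted (D.level p.1 + 1) (h.haar p) := by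
  intro x y hy
  have hQ := D.mem_gen_level p.1
  by_cases hx : x ∈ p.1.1
  · have hd := D.cell_mem_desc hn (D.level p.1) 1 x
    rw [D.cell_eq hQ hx] at hd
    exact h.const_on_children p.1 p.2 _ hd y hy x (D.mem_cell _ x)
  · have hy' : y ∉ p.1.1 := fun hy' => hx <| by
      have h1 := D.cell_subset hn (by omega : D.level p.1 ≤ D.level p.1 + 1) x hy
      rw [← D.cell_eq hQ hy', D.cell_eq_of_mem h1]
      exact D.mem_cell _ x
    rw [h.haar_eq_zero hx, h.haar_eq_zero hy']

theorem measurable_haar (h : HaarSystem D μ) (hn : 1 ≤ n) (p : D.cubes × Fin (2 ^ n - 1)) :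
    Measurable (h.haar p) :=
  (h.adapted_haar hn p).measurable

theorem exists_haar_le (h : HaarSystem D μ) (hn : 1 ≤ n) (p : D.cubes × Fin (2 ^ n - 1)) :
    ∃ C, ∀ x, ‖h.haar p x‖ ≤ C := by
  obtain ⟨C, hC⟩ := (h.adapted_haar hn p).bddOn hn (D.mem_gen_level p.1)
  refine ⟨C, fun x => ?_⟩
  by_cases hx : x ∈ p.1.1
  · exact hC x hx
  · obtain ⟨y, hy⟩ := D.nonempty_of_gen (D.mem_gen_level p.1)
    rw [h.haar_eq_zero hx, norm_zero]
    exact (norm_nonneg _).trans (hC y hy)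

theorem mul_haar_eq_indicator (h : HaarSystem D μ) (f : (Fin n → ℝ) → ℝ)
    (p : D.cubes × Fin (2 ^ n - 1)) :
    (fun x => f x * h.haar p x) = p.1.1.indicator fun x => f x * h.haar p x := by
  funext x
  by_cases hx : x ∈ p.1.1
  · simp [hx]
  · simp [hx, h.haar_eq_zero hx]

theorem integrable_mul_haar (h : HaarSystem D μ) (hn : 1 ≤ n) {f : (Fin n → ℝ) → ℝ}
    {p : D.cubes × Fin (2 ^ n - 1)} (hf : IntegrableOn f p.1.1 μ) :
    Integrable (fun x => f x * h.haar p x) μ := by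
  rw [h.mul_haar_eq_indicator, integrable_indicator_iff (D.measurableSet_of_gen
    (D.mem_gen_level p.1))]
  have := (h.adapted_haar hn p).integrableOn_mul hn (D.mem_gen_level p.1) hf
  simpa only [mul_comm] using this

theorem coef_eq_setIntegral (h : HaarSystem D μ) (f : (Fin n → ℝ) → ℝ)
    (p : D.cubes × Fin (2 ^ n - 1)) : h.coef f p = ∫ x in p.1.1, f x * h.haar p x ∂μ := by
  rw [coef, h.mul_haar_eq_indicator, integral_indicator (D.measurableSet_of_gen
    (D.mem_gen_level p.1))]
  refine setIntegral_congr_fun (D.measurableSet_of_gen (D.mem_gen_level p.1)) fun x hx => ?_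
  simp [hx]

theorem coef_add (h : HaarSystem D μ) (hn : 1 ≤ n) {f g : (Fin n → ℝ) → ℝ}
    {p : D.cubes × Fin (2 ^ n - 1)} (hf : IntegrableOn f p.1.1 μ) (hg : IntegrableOn g p.1.1 μ) :
    h.coef (f + g) p = h.coef f p + h.coef g p := by
  simp only [coef, Pi.add_apply, add_mul]
  exact integral_add (h.integrable_mul_haar hn hf) (h.integrable_mul_haar hn hg)

theorem coef_sub (h : HaarSystem D μ) (hn : 1 ≤ n) {f g : (Fin n → ℝ) → ℝ}
    {p : D.cubes × Fin (2 ^ n - 1)} (hf : IntegrableOn f p.1.1 μ) (hg : IntegrableOn g p.1.1 μ) :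
    h.coef (f - g) p = h.coef f p - h.coef g p := by
  simp only [coef, Pi.sub_apply, sub_mul]
  exact integral_sub (h.integrable_mul_haar hn hf) (h.integrable_mul_haar hn hg)

theorem coef_smul (h : HaarSystem D μ) (c : ℝ) (f : (Fin n → ℝ) → ℝ)
    (p : D.cubes × Fin (2 ^ n - 1)) : h.coef (c • f) p = c * h.coef f p := by
  simp only [coef, Pi.smul_apply, smul_eq_mul, mul_assoc]
  exact integral_const_mul _ _

theorem coef_congr (h : HaarSystem D μ) {f g : (Fin n → ℝ) → ℝ}
    {p : D.cubes × Fin (2 ^ n - 1)} (hfg : f =ᵐ[μ.restrict p.1.1] g) :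
    h.coef f p = h.coef g p := by
  rw [h.coef_eq_setIntegral, h.coef_eq_setIntegral]
  refine integral_congr_ae ?_
  filter_upwards [hfg] with x hx
  rw [hx]

theorem coef_congr' (h : HaarSystem D μ) {f g : (Fin n → ℝ) → ℝ} (hfg : f =ᵐ[μ] g) :
    h.coef f = h.coef g :=
  funext fun _ => h.coef_congr (ae_restrict_of_ae hfg)

theorem integrable_haar (hn : 1 ≤ n) (hμ : ∀ Q ∈ D.cubes, 0 < μ Q ∧ μ Q < ∞)
    (h : HaarSystem D μ) (p : D.cubes × Fin (2 ^ n - 1)) :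
    Integrable (h.haar p) μ := by
  have h1 : IntegrableOn (fun _ => (1 : ℝ)) p.1.1 μ := integrableOn_const (hμ _ p.1.2).2.ne
  simpa using h.integrable_mul_haar hn h1

theorem coef_const (h : HaarSystem D μ) (c : ℝ) (p : D.cubes × Fin (2 ^ n - 1)) :
    h.coef (fun _ => c) p = 0 := by
  have h0 : ∫ x, h.haar p x ∂μ = 0 := h.integral_eq_zero p.1 p.2
  rw [coef, integral_const_mul, h0, mul_zero]

theorem expect_haar (hn : 1 ≤ n) (hμ : ∀ Q ∈ D.cubes, 0 < μ Q ∧ μ Q < ∞)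
    (h : HaarSystem D μ) (k : ℤ) (p : D.cubes × Fin (2 ^ n - 1))
    (x : Fin n → ℝ) :
    D.expect μ k (h.haar p) x = if D.level p.1 < k then h.haar p x else 0 := by
  split_ifs with hk
  · exact D.expect_of_adapted hμ ((h.adapted_haar hn p).mono hn (by omega)) x
  · rw [DyadicSystem.expect, setAverage_eq]
    have h0 : ∫ y in D.cell k x, h.haar p y ∂μ = 0 := by
      rcases D.subset_or_disjoint hn (not_lt.1 hk) (D.cell_mem k x) (D.mem_gen_level p.1) with
        hs | hs
      · rw [setIntegral_eq_integral_of_forall_compl_eq_zero fun y hy =>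
          h.haar_eq_zero fun hy' => hy (hs hy')]
        exact h.integral_eq_zero p.1 p.2
      · rw [setIntegral_eq_zero_of_forall_eq_zero]
        exact fun y hy => h.haar_eq_zero fun hy' => Set.disjoint_left.1 hs hy' hy
    rw [h0, smul_zero]

theorem inner_vec (h : HaarSystem D μ) (p : D.cubes × Fin (2 ^ n - 1)) (F : Lp ℝ 2 μ) :
    inner ℝ (h.vec p.1 p.2) F = h.coef F p := by
  rw [L2.inner_def, coef]
  refine integral_congr_ae ?_
  filter_upwards [(h.memLp p.1 p.2).coeFn_toLp] with x hx
  rw [vec, hx]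
  simp [haar]

/-- The Haar system as a Hilbert basis. -/
noncomputable def basis (h : HaarSystem D μ) :
    HilbertBasis (D.cubes × Fin (2 ^ n - 1)) ℝ (Lp ℝ 2 μ) :=
  HilbertBasis.mk h.orthonormal h.dense_span.ge

theorem basis_apply (h : HaarSystem D μ) (p : D.cubes × Fin (2 ^ n - 1)) :
    h.basis p = h.vec p.1 p.2 := by
  simp [basis, vec]

theorem ext_coef (h : HaarSystem D μ) {F G : Lp ℝ 2 μ} (hFG : ∀ p, h.coef F p = h.coef G p) :
    F = G := by
  refine h.basis.repr.injective (lp.ext (funext fun p => ?_))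
  rw [h.basis.repr_apply_apply, h.basis.repr_apply_apply, h.basis_apply, h.inner_vec,
    h.inner_vec, hFG]

theorem coef_haar (h : HaarSystem D μ) [DecidableEq (D.cubes × Fin (2 ^ n - 1))]
    (p q : D.cubes × Fin (2 ^ n - 1)) :
    h.coef (h.haar q) p = if p = q then 1 else 0 := by
  rw [← orthonormal_iff_ite.1 h.orthonormal p q]
  change _ = inner ℝ (h.vec p.1 p.2) _
  rw [h.inner_vec]
  exact congrFun (h.coef_congr' (h.memLp q.1 q.2).coeFn_toLp.symm) p

theorem tsum_coef_sq (h : HaarSystem D μ) {v : (Fin n → ℝ) → ℝ} (hv : MemLp v 2 μ) :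
    ∑' p, ‖h.coef v p‖ₑ ^ 2 = ∫⁻ x, ‖v x‖ₑ ^ 2 ∂μ := by
  have h1 := h.basis.hasSum_inner_mul_inner (hv.toLp v) (hv.toLp v)
  have h2 : ∀ p, inner ℝ (hv.toLp v) (h.basis p) * inner ℝ (h.basis p) (hv.toLp v) =
      ‖h.coef v p‖ ^ 2 := fun p => by
    rw [real_inner_comm, h.basis_apply, h.inner_vec, h.coef_congr' hv.coeFn_toLp, ← sq,
      Real.norm_eq_abs, sq_abs]
  simp only [h2] at h1
  have h3 : inner ℝ (hv.toLp v) (hv.toLp v) = ‖hv.toLp v‖ ^ 2 := real_inner_self_eq_norm_sq _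
  rw [h3] at h1
  have h4 : ∑' p, ‖h.coef v p‖ₑ ^ 2 = ENNReal.ofReal (‖hv.toLp v‖ ^ 2) := by
    rw [← h1.tsum_eq, ENNReal.ofReal_tsum_of_nonneg (fun p => by positivity) h1.summable]
    refine tsum_congr fun p => ?_
    rw [ENNReal.ofReal_pow (norm_nonneg _), ofReal_norm]
  rw [h4, ENNReal.ofReal_pow (norm_nonneg _), Lp.norm_toLp,
    ENNReal.ofReal_toReal hv.eLpNorm_ne_top,
    eLpNorm_eq_lintegral_rpow_enorm_toReal (by norm_num) (by norm_num)]
  simp only [ENNReal.toReal_ofNat, ENNReal.rpow_ofNat]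
  rw [← ENNReal.rpow_natCast, ← ENNReal.rpow_mul]
  norm_num

/-- The martingale difference of `f` in terms of the Haar coefficients of `f`. -/
theorem mdiff_eq (hn : 1 ≤ n) (hμ : ∀ Q ∈ D.cubes, 0 < μ Q ∧ μ Q < ∞)
    (h : HaarSystem D μ) (k : ℤ) (x : Fin n → ℝ) {f : (Fin n → ℝ) → ℝ}
    (hf : IntegrableOn f (D.cell k x) μ) :
    D.expect μ (k + 1) f x - D.expect μ k f x =
      ∑ j, h.coef f (D.cellCube k x, j) * h.haar (D.cellCube k x, j) x := by
  classical
  set w : (Fin n → ℝ) → ℝ := fun y =>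
    (D.cell (k + 1) x).indicator (fun _ => (μ.real (D.cell (k + 1) x))⁻¹) y -
      (D.cell k x).indicator (fun _ => (μ.real (D.cell k x))⁻¹) y with hw
  have hm := D.measurableSet_cell
  have hwL : MemLp w 2 μ := by
    have hL : ∀ l, MemLp ((D.cell l x).indicator fun _ => (μ.real (D.cell l x))⁻¹) 2 μ :=
      fun l => memLp_indicator_const 2 (hm l x) _ (Or.inr (hμ _ (D.cell_mem_cubes l x)).2.ne)
    exact (hL (k + 1)).sub (hL k)
  have hsub := D.cell_subset hn (by omega : k ≤ k + 1) x
  have hpair : ∀ g : (Fin n → ℝ) → ℝ, IntegrableOn g (D.cell k x) μ →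
      ∫ y, w y * g y ∂μ = D.expect μ (k + 1) g x - D.expect μ k g x := by
    intro g hg
    have hind : ∀ l, (fun y => (D.cell l x).indicator (fun _ => (μ.real (D.cell l x))⁻¹) y * g y)
        = (D.cell l x).indicator fun y => (μ.real (D.cell l x))⁻¹ * g y := fun l => by
      funext y
      by_cases hy : y ∈ D.cell l x <;> simp [hy]
    have hi : ∀ l, IntegrableOn g (D.cell l x) μ → Integrable (fun y =>
        (D.cell l x).indicator (fun _ => (μ.real (D.cell l x))⁻¹) y * g y) μ := fun l hl => by
      rw [hind, integrable_indicator_iff (hm l x)]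
      exact hl.const_mul _
    simp only [hw, sub_mul]
    rw [integral_sub (hi _ (hg.mono_set hsub)) (hi _ hg)]
    simp only [hind, integral_indicator (hm _ x), integral_const_mul, DyadicSystem.expect,
      setAverage_eq, smul_eq_mul]
  have hcw : ∀ p, h.coef w p = if p.1 = D.cellCube k x then h.haar p x else 0 := by
    intro p
    rw [coef, hpair _ (h.integrable_haar hn hμ p).integrableOn, h.expect_haar hn hμ,
      h.expect_haar hn hμ]
    by_cases hp : p.1 = D.cellCube k x
    · have hl : D.level p.1 = k := by rw [hp, D.level_cellCube hn]
      simp only [hl]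
      simp [hp]
    · rw [if_neg hp]
      split_ifs with h1 h2 h2
      · simp
      · have hl : D.level p.1 = k := by omega
        have : h.haar p x = 0 := h.haar_eq_zero fun hx => hp <| by
          rw [← hl, D.cellCube_level hx]
        simp [this]
      · omega
      · simp
  have hsL : MemLp (fun y => ∑ j, h.haar (D.cellCube k x, j) x * h.haar (D.cellCube k x, j) y)
      2 μ :=
    memLp_finsetSum _ fun j _ => (h.memLp (D.cellCube k x) j).const_mul _
  have hae : w =ᵐ[μ] fun y => ∑ j, h.haar (D.cellCube k x, j) x * h.haar (D.cellCube k x, j) y := by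
    have : hwL.toLp w = hsL.toLp _ := by
      refine h.ext_coef fun p => ?_
      rw [h.coef_congr' hwL.coeFn_toLp, h.coef_congr' hsL.coeFn_toLp, hcw]
      simp only [coef, Finset.sum_mul]
      rw [integral_finsetSum]
      · simp only [mul_assoc, integral_const_mul]
        change _ = ∑ j, h.haar (D.cellCube k x, j) x * h.coef (h.haar (D.cellCube k x, j)) p
        simp only [h.coef_haar]
        split_ifs with hp
        · rw [Finset.sum_eq_single p.2]
          · simp [← hp]
          · intro j _ hj
            rw [if_neg (fun h' => hj (by rw [h'])), mul_zero]
          · simp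
        · symm
          refine Finset.sum_eq_zero fun j _ => ?_
          rw [if_neg (fun h' => hp (by rw [h'])), mul_zero]
      · intro j _
        simp only [mul_assoc]
        exact (h.integrable_mul_haar hn (h.integrable_haar hn hμ _).integrableOn).const_mul _
    exact hwL.coeFn_toLp.symm.trans (this ▸ hsL.coeFn_toLp)
  rw [← hpair f hf, integral_congr_ae (hae.mono fun y hy =>
    show w y * f y = ∑ j, h.haar (D.cellCube k x, j) x *
      (f y * h.haar (D.cellCube k x, j) y) by
      simp only [hy, Finset.sum_mul]
      exact Finset.sum_congr rfl fun j _ => by ring), integral_finsetSum]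
  · exact Finset.sum_congr rfl fun j _ => by rw [integral_const_mul, coef, mul_comm]
  · exact fun j _ => (h.integrable_mul_haar hn (p := (D.cellCube k x, j)) hf).const_mul _

/-- A function whose Haar coefficients in the cube `Q` vanish is constant on `Q`. -/
theorem ae_eq_average_of_coef_eq_zero (hn : 1 ≤ n) (hμ : ∀ Q ∈ D.cubes, 0 < μ Q ∧ μ Q < ∞)
    (h : HaarSystem D μ) {k : ℤ} {Q : Set (Fin n → ℝ)}
    (hQ : Q ∈ D.gen k) {f : (Fin n → ℝ) → ℝ} (hf : IntegrableOn f Q μ)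
    (h0 : ∀ p : D.cubes × Fin (2 ^ n - 1), p.1.1 ⊆ Q → h.coef f p = 0) :
    ∀ᵐ x ∂μ.restrict Q, f x = ⨍ y in Q, f y ∂μ := by
  have hE : ∀ x ∈ Q, ∀ m : ℕ, D.expect μ (k + m) f x = ⨍ y in Q, f y ∂μ := by
    intro x hx m
    induction m with
    | zero => simpa using D.expect_eq_of_mem μ hQ f hx
    | succ m ih =>
      have hs : D.cell (k + m) x ⊆ Q := D.cell_subset_of_mem_gen hn (by omega) hQ hx
      have h1 := h.mdiff_eq hn hμ (k + m) x (hf.mono_set hs)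
      rw [Finset.sum_eq_zero fun j _ => by rw [h0 (D.cellCube (k + m) x, j) hs, zero_mul]] at h1
      push_cast
      rw [← add_assoc]
      linarith
  filter_upwards [D.ae_tendsto_expect hn hμ hQ hf,
    ae_restrict_mem (D.measurableSet_of_gen hQ)] with x hx hxQ
  refine tendsto_nhds_unique hx ?_
  simp only [hE x hxQ]
  exact tendsto_const_nhds

/-- The Haar coefficients of `f - ⟨f⟩_Q` on `Q`. -/
theorem coef_indicator_sub (hn : 1 ≤ n) (hμ : ∀ Q ∈ D.cubes, 0 < μ Q ∧ μ Q < ∞)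
    (h : HaarSystem D μ) {k : ℤ} {Q : Set (Fin n → ℝ)}
    (hQ : Q ∈ D.gen k) {f : (Fin n → ℝ) → ℝ} (hf : IntegrableOn f Q μ)
    (p : D.cubes × Fin (2 ^ n - 1)) [Decidable (p.1.1 ⊆ Q)] :
    h.coef (Q.indicator fun x => f x - ⨍ y in Q, f y ∂μ) p =
      if p.1.1 ⊆ Q then h.coef f p else 0 := by
  have hQm := D.measurableSet_of_gen hQ
  have hc : IntegrableOn (fun _ : Fin n → ℝ => ⨍ y in Q, f y ∂μ) Q μ :=
    integrableOn_const (hμ Q ⟨k, hQ⟩).2.ne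
  split_ifs with hp
  · rw [h.coef_congr (g := f - fun _ => ⨍ y in Q, f y ∂μ),
      h.coef_sub hn (hf.mono_set hp) (hc.mono_set hp), h.coef_const, sub_zero]
    filter_upwards [ae_restrict_mem (D.measurableSet_of_gen (D.mem_gen_level p.1))] with x hx
    simp [hp hx]
  · rcases le_or_gt k (D.level p.1) with hk | hk
    · have hd := (D.subset_or_disjoint hn hk hQ (D.mem_gen_level p.1)).resolve_left hp
      rw [coef]
      refine integral_eq_zero_of_ae (Eventually.of_forall fun x => ?_)
      by_cases hx : x ∈ Q
      · simp [h.haar_eq_zero fun hx' => Set.disjoint_left.1 hd hx' hx]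
      · simp [hx]
    · obtain ⟨x₀, hx₀⟩ := D.nonempty_of_gen hQ
      have h1 : (fun x => Q.indicator (fun x => f x - ⨍ y in Q, f y ∂μ) x * h.haar p x) =
          Q.indicator fun x => (f x - ⨍ y in Q, f y ∂μ) * h.haar p x₀ := by
        funext x
        by_cases hx : x ∈ Q
        · have := (h.adapted_haar hn p).mono hn (by omega : D.level p.1 + 1 ≤ k) x₀ x
            (by rwa [D.cell_eq hQ hx₀])
          simp [hx, this]
        · simp [hx]
      rw [coef, h1, integral_indicator hQm, integral_mul_const, integral_sub hf hc]
      have h2 := D.setIntegral_eq_expect_mul hμ k f x₀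
      rw [D.expect_eq_of_mem μ hQ f hx₀, D.cell_eq hQ hx₀] at h2
      rw [h2, setIntegral_const, smul_eq_mul]
      ring

theorem tsum_coef_sq_below (hn : 1 ≤ n) (hμ : ∀ Q ∈ D.cubes, 0 < μ Q ∧ μ Q < ∞)
    (h : HaarSystem D μ) {k : ℤ} {Q : Set (Fin n → ℝ)}
    (hQ : Q ∈ D.gen k) {f : (Fin n → ℝ) → ℝ} (hf : IntegrableOn f Q μ)
    (hv : MemLp (Q.indicator fun x => f x - ⨍ y in Q, f y ∂μ) 2 μ) :
    ∑' p, (below D Q).indicator (fun p => ‖h.coef f p‖ₑ ^ 2) p =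
      ∫⁻ x in Q, ‖f x - ⨍ y in Q, f y ∂μ‖ₑ ^ 2 ∂μ := by
  classical
  have h1 := h.tsum_coef_sq hv
  simp only [h.coef_indicator_sub hn hμ hQ hf] at h1
  rw [← lintegral_indicator (D.measurableSet_of_gen hQ)]
  calc _ = ∑' p : D.cubes × Fin (2 ^ n - 1),
        ‖if p.1.1 ⊆ Q then h.coef f p else 0‖ₑ ^ 2 := by
        refine tsum_congr fun p => ?_
        by_cases hp : p.1.1 ⊆ Q <;> simp [below, hp]
    _ = _ := h1
    _ = _ := by
        refine lintegral_congr fun x => ?_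
        by_cases hx : x ∈ Q <;> simp [hx]

end HaarSystem

namespace DyadicSystem

open Filter Topology

variable {n : ℕ}

/-- The running maximum of a sequence, started at `0`. -/
def runMax (X : ℕ → ℝ) : ℕ → ℝ
  | 0 => 0
  | m + 1 => max (runMax X m) (X (m + 1))

theorem runMax_zero (X : ℕ → ℝ) : runMax X 0 = 0 := rfl

theorem runMax_succ (X : ℕ → ℝ) (m : ℕ) :
    runMax X (m + 1) = max (runMax X m) (X (m + 1)) := rfl

theorem runMax_nonneg (X : ℕ → ℝ) (m : ℕ) : 0 ≤ runMax X m := by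
  induction m with
  | zero => exact le_rfl
  | succ m ih => exact ih.trans (le_max_left _ _)

theorem runMax_le_succ (X : ℕ → ℝ) (m : ℕ) : runMax X m ≤ runMax X (m + 1) := le_max_left _ _

theorem le_runMax (X : ℕ → ℝ) (h0 : X 0 = 0) (m : ℕ) : X m ≤ runMax X m := by
  cases m with
  | zero => exact h0.le
  | succ m => exact le_max_right _ _

theorem sq_runMax_le (X : ℕ → ℝ) (h0 : X 0 = 0) {b : ℝ} (hX : ∀ m, |X (m + 1) - X m| ≤ b)
    (y : ℝ) (N : ℕ) :
    runMax X N ^ 2 ≤ 4 * b * runMax X N +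
      12 * ∑ m ∈ Finset.range N, (runMax X (m + 1) - runMax X m) * |y - X m| := by
  set S := ∑ m ∈ Finset.range N, (runMax X (m + 1) - runMax X m) * |y - X m| with hS
  have tel : ∀ G : ℝ → ℝ, (∀ m, G (runMax X (m + 1)) - G (runMax X m) ≤
      (runMax X (m + 1) - runMax X m) * |y - X m|) → G (runMax X N) - G 0 ≤ S := fun G hG => by
    have h1 := Finset.sum_range_sub (fun m => G (runMax X m)) N
    rw [show G 0 = G (runMax X 0) from rfl, ← h1]
    exact Finset.sum_le_sum fun m _ => hG m
  have hΔ : ∀ m, 0 ≤ runMax X (m + 1) - runMax X m := fun m => sub_nonneg.2 (runMax_le_succ X m)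
  have h1 : y * runMax X N - runMax X N ^ 2 / 2 ≤ S := by
    have := tel (fun a => y * a - a ^ 2 / 2) fun m => by
      have h2 : y - runMax X m ≤ |y - X m| :=
        le_trans (by linarith [le_runMax X h0 m]) (le_abs_self _)
      nlinarith [mul_le_mul_of_nonneg_left h2 (hΔ m), sq_nonneg (runMax X (m + 1) - runMax X m)]
    simpa using this
  have h2 : runMax X N ^ 2 / 2 - (b + y) * runMax X N ≤ S := by
    have := tel (fun a => a ^ 2 / 2 - (b + y) * a) fun m => by
      rcases le_or_gt (X (m + 1)) (runMax X m) with hm | hm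
      · have : runMax X (m + 1) = runMax X m := max_eq_left hm
        simp [this]
      · have hm' : runMax X (m + 1) = X (m + 1) := max_eq_right hm.le
        have h2 : runMax X (m + 1) - b - y ≤ |y - X m| := by
          rw [hm']
          refine le_trans ?_ (neg_le_abs _)
          linarith [(abs_le.1 (hX m)).2]
        nlinarith [mul_le_mul_of_nonneg_left h2 (hΔ m),
          sq_nonneg (runMax X (m + 1) - runMax X m)]
    simpa using this
  have h3 : max y 0 ^ 2 / 2 - max (y - runMax X N) 0 ^ 2 / 2 ≤ S := by
    have := tel (fun a => - (max (y - a) 0 ^ 2 / 2)) fun m => by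
      have h2 : max (y - runMax X m) 0 ≤ |y - X m| :=
        max_le (le_trans (by linarith [le_runMax X h0 m]) (le_abs_self _)) (abs_nonneg _)
      refine le_trans ?_ (mul_le_mul_of_nonneg_left h2 (hΔ m))
      have h4 := hΔ m
      rcases le_total (y - runMax X m) 0 with ha | ha <;>
      rcases le_total (y - runMax X (m + 1)) 0 with hb | hb
      · simp [max_eq_right ha, max_eq_right hb]
      · rw [max_eq_right ha, max_eq_left hb]
        nlinarith
      · rw [max_eq_left ha, max_eq_right hb]
        nlinarith
      · rw [max_eq_left ha, max_eq_left hb]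
        nlinarith
    simp only [sub_zero] at this
    linarith
  have hM := runMax_nonneg X N
  have hb : 0 ≤ b := (abs_nonneg _).trans (hX 0)
  rcases le_total (y - runMax X N) 0 with hy | hy
  · rw [max_eq_right hy] at h3
    rcases le_total y 0 with hy0 | hy0
    · nlinarith [mul_nonneg hb hM]
    · rw [max_eq_left hy0] at h3
      nlinarith [sq_nonneg (runMax X N / 2 - y)]
  · nlinarith [mul_nonneg hb hM]

/-- The functions `f` with `⟨|f - ⟨f⟩_P|⟩_Q ≤ b` for all cubes `Q` with parent `P`. -/
structure MeanOscLE (D : DyadicSystem n) (μ : Measure (Fin n → ℝ)) (f : (Fin n → ℝ) → ℝ)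
    (b : ℝ) : Prop where
  integrableOn : ∀ Q ∈ D.cubes, IntegrableOn f Q μ
  osc_le : ∀ k x, ∫ y in D.cell (k + 1) x, |f y - D.expect μ k f y| ∂μ ≤
    b * μ.real (D.cell (k + 1) x)

section

variable {D : DyadicSystem n} {μ : Measure (Fin n → ℝ)} {f : (Fin n → ℝ) → ℝ} {b : ℝ}

theorem MeanOscLE.neg (hf : D.MeanOscLE μ f b) : D.MeanOscLE μ (-f) b where
  integrableOn Q hQ := (hf.integrableOn Q hQ).neg
  osc_le k x := by
    have h1 : D.expect μ k (-f) = - D.expect μ k f := by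
      have := D.expect_smul μ (-1) f k
      simpa using this
    refine le_of_eq_of_le ?_ (hf.osc_le k x)
    simp only [h1, Pi.neg_apply]
    congr 1
    funext y
    rw [← abs_neg]
    congr 1
    ring

theorem MeanOscLE.abs_mdiff_le (hn : 1 ≤ n) (hμ : ∀ Q ∈ D.cubes, 0 < μ Q ∧ μ Q < ∞)
    (hf : D.MeanOscLE μ f b) (k : ℤ) (x : Fin n → ℝ) :
    |D.expect μ (k + 1) f x - D.expect μ k f x| ≤ b := by
  have hc := hμ _ (D.cell_mem_cubes (k + 1) x)
  have hpos : 0 < μ.real (D.cell (k + 1) x) := ENNReal.toReal_pos hc.1.ne' hc.2.ne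
  have h1 : (D.expect μ (k + 1) f x - D.expect μ k f x) * μ.real (D.cell (k + 1) x) =
      ∫ y in D.cell (k + 1) x, f y - D.expect μ k f y ∂μ := by
    rw [integral_sub (hf.integrableOn _ (D.cell_mem_cubes _ x))
      ((D.adapted_expect μ k f).integrableOn hn (D.cell_mem _ x) hc.2),
      D.setIntegral_eq_expect_mul hμ, D.setIntegral_eq_expect_mul hμ,
      D.expect_of_adapted hμ ((D.adapted_expect μ k f).mono hn (by omega : k ≤ k + 1))]
    ring
  have h2 := (abs_integral_le_integral_abs (f := fun y => f y - D.expect μ k f y)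
    (μ := μ.restrict (D.cell (k + 1) x))).trans (hf.osc_le k x)
  rw [← h1, abs_mul, abs_of_pos hpos] at h2
  exact le_of_mul_le_mul_right h2 hpos

/-- The oscillation bound against a nonnegative function that is constant on the cubes of
generation `k + 1`. -/
theorem MeanOscLE.setIntegral_mul_le (hn : 1 ≤ n) (hμ : ∀ Q ∈ D.cubes, 0 < μ Q ∧ μ Q < ∞)
    (hf : D.MeanOscLE μ f b) {k l : ℤ} (hlk : l ≤ k + 1)
    {Q : Set (Fin n → ℝ)} (hQ : Q ∈ D.gen l) {θ : (Fin n → ℝ) → ℝ} (hθ : D.Adapted (k + 1) θ)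
    (hθ0 : ∀ x, 0 ≤ θ x) :
    ∫ x in Q, θ x * |f x - D.expect μ k f x| ∂μ ≤ b * ∫ x in Q, θ x ∂μ := by
  set G : (Fin n → ℝ) → ℝ := fun y => |f y - D.expect μ k f y| with hG
  have hGi : IntegrableOn G Q μ := by
    exact ((hf.integrableOn Q ⟨l, hQ⟩).sub ((D.adapted_expect μ k f).integrableOn hn hQ
      (hμ Q ⟨l, hQ⟩).2)).abs
  rw [← D.setIntegral_expect hn hμ hlk hQ (hθ.integrableOn_mul hn hQ hGi), ← integral_const_mul]
  refine setIntegral_mono_on ((D.adapted_expect μ _ _).integrableOn hn hQ (hμ Q ⟨l, hQ⟩).2)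
    ((hθ.integrableOn hn hQ (hμ Q ⟨l, hQ⟩).2).const_mul _) (D.measurableSet_of_gen hQ)
    fun x hx => ?_
  rw [D.expect_adapted_mul μ hθ, mul_comm]
  refine mul_le_mul_of_nonneg_right ?_ (hθ0 x)
  have hc := hμ _ (D.cell_mem_cubes (k + 1) x)
  have hpos : 0 < μ.real (D.cell (k + 1) x) := ENNReal.toReal_pos hc.1.ne' hc.2.ne
  have h2 := hf.osc_le k x
  rw [D.setIntegral_eq_expect_mul hμ] at h2
  exact le_of_mul_le_mul_right h2 hpos

theorem adapted_runMax (hn : 1 ≤ n)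
    (g : (Fin n → ℝ) → ℝ) (k : ℤ) (N : ℕ) : D.Adapted (k + N) fun x =>
    runMax (fun m => D.expect μ (k + m) g x - D.expect μ k g x) N := by
  intro x y hy
  have h1 : ∀ i : ℕ, i ≤ N →
      runMax (fun m => D.expect μ (k + m) g y - D.expect μ k g y) i =
      runMax (fun m => D.expect μ (k + m) g x - D.expect μ k g x) i := by
    intro i
    induction i with
    | zero =>
      intro _
      rw [runMax_zero, runMax_zero]
    | succ i ih =>
      intro hi
      rw [runMax_succ, runMax_succ, ih (by omega),
        (D.adapted_expect μ (k + (i + 1 : ℕ)) g).mono hn (by omega) x y hy,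
        (D.adapted_expect μ k g).mono hn (by omega) x y hy]
  exact h1 N le_rfl

theorem MeanOscLE.nonneg (hn : 1 ≤ n) (hμ : ∀ Q ∈ D.cubes, 0 < μ Q ∧ μ Q < ∞)
    (hf : D.MeanOscLE μ f b) : 0 ≤ b :=
  (abs_nonneg _).trans (hf.abs_mdiff_le hn hμ 0 0)

theorem MeanOscLE.integral_sq_runMax_le (hn : 1 ≤ n) (hμ : ∀ Q ∈ D.cubes, 0 < μ Q ∧ μ Q < ∞)
    (hf : D.MeanOscLE μ f b) {k : ℤ} {Q : Set (Fin n → ℝ)}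
    (hQ : Q ∈ D.gen k) (N : ℕ) :
    ∫ x in Q, runMax (fun m => D.expect μ (k + m) f x - D.expect μ k f x) N ^ 2 ∂μ ≤
      256 * b ^ 2 * μ.real Q := by
  have hμQ := (hμ Q ⟨k, hQ⟩).2
  set X : (Fin n → ℝ) → ℕ → ℝ := fun x m => D.expect μ (k + m) f x - D.expect μ k f x with hX
  set M : ℕ → (Fin n → ℝ) → ℝ := fun m x => runMax (X x) m with hM
  have hMa : ∀ m : ℕ, D.Adapted (k + m) (M m) := adapted_runMax hn f k
  have hint : ∀ m, IntegrableOn (M m) Q μ := fun m => (hMa m).integrableOn hn hQ hμQ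
  have hint2 : IntegrableOn (fun x => M N x ^ 2) Q μ :=
    ((hMa N).comp (fun t => t ^ 2)).integrableOn hn hQ hμQ
  have h0 : ∀ x, X x 0 = 0 := fun x => by simp [hX]
  have hjump : ∀ x m, |X x (m + 1) - X x m| ≤ b := fun x m => by
    have := hf.abs_mdiff_le hn hμ (k + m) x
    simp only [hX, Nat.cast_add, Nat.cast_one, ← add_assoc]
    simpa using this
  have hb := hf.nonneg hn hμ
  have hda : ∀ m : ℕ, D.Adapted (k + m + 1) fun x => M (m + 1) x - M m x := fun m x y hy => by
    have h1 := (hMa m).mono hn (by omega : k + (m : ℤ) ≤ k + m + 1) x y hy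
    have h2 := hMa (m + 1) x y (by push_cast; rwa [← add_assoc])
    simp only [h1, h2]
  have hSi : ∀ m : ℕ, IntegrableOn (fun x => (M (m + 1) x - M m x) *
      |f x - D.expect μ (k + m) f x|) Q μ := fun m =>
    (hda m).integrableOn_mul hn hQ ((hf.integrableOn Q ⟨k, hQ⟩).sub
      ((D.adapted_expect μ (k + m) f).integrableOn hn hQ hμQ)).abs
  have hS : ∫ x in Q, ∑ m ∈ Finset.range N, (M (m + 1) x - M m x) *
      |f x - D.expect μ (k + m) f x| ∂μ ≤ b * ∫ x in Q, M N x ∂μ := by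
    rw [integral_finsetSum _ fun m _ => hSi m]
    calc _ ≤ ∑ m ∈ Finset.range N, b * ∫ x in Q, (M (m + 1) x - M m x) ∂μ :=
          Finset.sum_le_sum fun m _ => hf.setIntegral_mul_le hn hμ (by omega) hQ (hda m)
            fun x => sub_nonneg.2 (runMax_le_succ _ _)
      _ = b * ∫ x in Q, M N x ∂μ := by
          rw [← Finset.mul_sum]
          congr 1
          rw [Finset.sum_congr rfl fun m _ => integral_sub (hint (m + 1)) (hint m),
            Finset.sum_range_sub fun m => ∫ x in Q, M m x ∂μ]
          simp [hM, runMax_zero]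
  have hpt : ∀ x, M N x ^ 2 ≤ 4 * b * M N x + 12 * ∑ m ∈ Finset.range N,
      (M (m + 1) x - M m x) * |f x - D.expect μ (k + m) f x| := fun x => by
    have := sq_runMax_le (X x) (h0 x) (hjump x) (f x - D.expect μ k f x) N
    simpa only [hX, sub_sub_sub_cancel_right] using this
  have hSi' := integrable_finsetSum (Finset.range N) fun m _ => hSi m
  have h1 : ∫ x in Q, M N x ^ 2 ∂μ ≤
      4 * b * ∫ x in Q, M N x ∂μ + 12 * (b * ∫ x in Q, M N x ∂μ) := by
    calc _ ≤ ∫ x in Q, (4 * b * M N x + 12 * ∑ m ∈ Finset.range N,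
          (M (m + 1) x - M m x) * |f x - D.expect μ (k + m) f x|) ∂μ :=
          integral_mono hint2 (((hint N).const_mul _).add (hSi'.const_mul _)) hpt
      _ ≤ _ := by
          rw [integral_add ((hint N).const_mul _) (hSi'.const_mul _), integral_const_mul,
            integral_const_mul]
          gcongr
  have h2 : 16 * b * ∫ x in Q, M N x ∂μ ≤ (1 / 2) * ∫ x in Q, M N x ^ 2 ∂μ +
      128 * b ^ 2 * μ.real Q := by
    have h3 : ∫ x in Q, 16 * b * M N x ∂μ ≤ ∫ x in Q, ((1 / 2) * M N x ^ 2 + 128 * b ^ 2) ∂μ :=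
      integral_mono ((hint N).const_mul _) ((hint2.const_mul _).add (integrableOn_const hμQ.ne))
        fun x => by simp only; nlinarith [sq_nonneg (M N x - 16 * b)]
    rw [integral_const_mul, integral_add (hint2.const_mul _) (integrableOn_const hμQ.ne),
      integral_const_mul, setIntegral_const, smul_eq_mul] at h3
    linarith
  change ∫ x in Q, M N x ^ 2 ∂μ ≤ _
  linarith

/-- The `L²` John–Nirenberg inequality. -/
theorem MeanOscLE.lintegral_sq_le (hn : 1 ≤ n) (hμ : ∀ Q ∈ D.cubes, 0 < μ Q ∧ μ Q < ∞)
    (hf : D.MeanOscLE μ f b) {k : ℤ} {Q : Set (Fin n → ℝ)}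
    (hQ : Q ∈ D.gen k) :
    ∫⁻ x in Q, ‖f x - ⨍ y in Q, f y ∂μ‖ₑ ^ 2 ∂μ ≤ ENNReal.ofReal (512 * b ^ 2) * μ Q := by
  have hμQ := (hμ Q ⟨k, hQ⟩).2
  have hQm := D.measurableSet_of_gen hQ
  have hN : ∀ N : ℕ, ∫⁻ x in Q, ‖D.expect μ (k + N) f x - ⨍ y in Q, f y ∂μ‖ₑ ^ 2 ∂μ ≤
      ENNReal.ofReal (512 * b ^ 2) * μ Q := by
    intro N
    have hneg : ∀ l, D.expect μ l (-f) = - D.expect μ l f := fun l => by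
      simpa using D.expect_smul μ (-1) f l
    have ha : D.Adapted (k + N) fun x => (D.expect μ (k + N) f x - D.expect μ k f x) ^ 2 :=
      fun x y hy => by
        simp only [D.adapted_expect μ (k + N) f x y hy,
          (D.adapted_expect μ k f).mono hn (by omega : k ≤ k + N) x y hy]
    have hai := ha.integrableOn hn hQ hμQ
    have hmx : ∀ g : (Fin n → ℝ) → ℝ, IntegrableOn (fun x =>
        runMax (fun m => D.expect μ (k + m) g x - D.expect μ k g x) N ^ 2) Q μ := by
      intro g
      exact ((adapted_runMax hn g k N).comp fun t => t ^ 2).integrableOn hn hQ hμQ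
    have hpt : ∀ x, (D.expect μ (k + N) f x - D.expect μ k f x) ^ 2 ≤
        runMax (fun m => D.expect μ (k + m) f x - D.expect μ k f x) N ^ 2 +
        runMax (fun m => D.expect μ (k + m) (-f) x - D.expect μ k (-f) x) N ^ 2 := by
      intro x
      have h1 := le_runMax (fun m => D.expect μ (k + m) f x - D.expect μ k f x) (by simp) N
      have h2 := le_runMax (fun m => D.expect μ (k + m) (-f) x - D.expect μ k (-f) x) (by simp) N
      have h3 := runMax_nonneg (fun m => D.expect μ (k + m) f x - D.expect μ k f x) N
      have h4 := runMax_nonneg (fun m => D.expect μ (k + m) (-f) x - D.expect μ k (-f) x) N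
      simp only [hneg, Pi.neg_apply] at h1 h2 h4 ⊢
      rcases le_total 0 (D.expect μ (k + N) f x - D.expect μ k f x) with h | h <;> nlinarith
    have hle : ∫ x in Q, (D.expect μ (k + N) f x - D.expect μ k f x) ^ 2 ∂μ ≤
        512 * b ^ 2 * μ.real Q := by
      have h1 := integral_mono hai ((hmx f).add (hmx (-f))) hpt
      simp only [Pi.add_apply] at h1
      rw [integral_add (hmx f) (hmx (-f))] at h1
      have := hf.integral_sq_runMax_le hn hμ hQ N
      have := hf.neg.integral_sq_runMax_le hn hμ hQ N
      linarith
    calc _ = ∫⁻ x in Q, ENNReal.ofReal ((D.expect μ (k + N) f x - D.expect μ k f x) ^ 2) ∂μ := by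
          refine setLIntegral_congr_fun hQm fun x hx => ?_
          rw [← D.expect_eq_of_mem μ hQ f hx, ← ofReal_norm,
            ← ENNReal.ofReal_pow (norm_nonneg _), Real.norm_eq_abs, sq_abs]
      _ = ENNReal.ofReal (∫ x in Q, (D.expect μ (k + N) f x - D.expect μ k f x) ^ 2 ∂μ) :=
          (ofReal_integral_eq_lintegral_ofReal hai
            (Eventually.of_forall fun x => sq_nonneg _)).symm
      _ ≤ ENNReal.ofReal (512 * b ^ 2 * μ.real Q) := ENNReal.ofReal_le_ofReal hle
      _ = _ := by
          rw [ENNReal.ofReal_mul (by positivity), measureReal_def, ENNReal.ofReal_toReal hμQ.ne]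
  calc _ = ∫⁻ x in Q, liminf (fun N : ℕ =>
        ‖D.expect μ (k + N) f x - ⨍ y in Q, f y ∂μ‖ₑ ^ 2) atTop ∂μ := by
        refine lintegral_congr_ae ?_
        filter_upwards [D.ae_tendsto_expect hn hμ hQ (hf.integrableOn Q ⟨k, hQ⟩)] with x hx
        have h1 : Tendsto (fun N : ℕ => ‖D.expect μ (k + N) f x - ⨍ y in Q, f y ∂μ‖ₑ ^ 2) atTop
            (𝓝 (‖f x - ⨍ y in Q, f y ∂μ‖ₑ ^ 2)) :=
          (ENNReal.continuous_pow 2).continuousAt.tendsto.comp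
            (continuous_enorm.continuousAt.tendsto.comp (hx.sub_const _))
        exact h1.liminf_eq.symm
    _ ≤ liminf (fun N : ℕ => ∫⁻ x in Q,
        ‖D.expect μ (k + N) f x - ⨍ y in Q, f y ∂μ‖ₑ ^ 2 ∂μ) atTop :=
        lintegral_liminf_le fun N => (((D.measurable_expect μ _ f).sub_const _).enorm.pow_const 2)
    _ ≤ liminf (fun _ : ℕ => ENNReal.ofReal (512 * b ^ 2) * μ Q) atTop :=
        liminf_le_liminf (Eventually.of_forall hN)
    _ = _ := by simp

theorem MeanOscLE.memLp_indicator_sub (hn : 1 ≤ n) (hμ : ∀ Q ∈ D.cubes, 0 < μ Q ∧ μ Q < ∞)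
    (hf : D.MeanOscLE μ f b) {k : ℤ} {Q : Set (Fin n → ℝ)}
    (hQ : Q ∈ D.gen k) : MemLp (Q.indicator fun x => f x - ⨍ y in Q, f y ∂μ) 2 μ := by
  have hQm := D.measurableSet_of_gen hQ
  have hμQ := (hμ Q ⟨k, hQ⟩).2
  rw [memLp_indicator_iff_restrict hQm]
  refine ⟨((hf.integrableOn Q ⟨k, hQ⟩).aestronglyMeasurable).sub aestronglyMeasurable_const, ?_⟩
  rw [eLpNorm_lt_top_iff_lintegral_rpow_enorm_lt_top (by norm_num) (by norm_num)]
  simp only [ENNReal.toReal_ofNat, ENNReal.rpow_ofNat]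
  exact (hf.lintegral_sq_le hn hμ hQ).trans_lt (ENNReal.mul_lt_top ENNReal.ofReal_lt_top hμQ)

theorem MeanOscLE.memLp_indicator (hn : 1 ≤ n) (hμ : ∀ Q ∈ D.cubes, 0 < μ Q ∧ μ Q < ∞)
    (hf : D.MeanOscLE μ f b) {Q : Set (Fin n → ℝ)}
    (hQ : Q ∈ D.cubes) : MemLp (Q.indicator f) 2 μ := by
  obtain ⟨k, hQ⟩ := hQ
  have h1 := (hf.memLp_indicator_sub hn hμ hQ).add (memLp_indicator_const 2
    (D.measurableSet_of_gen hQ) (⨍ y in Q, f y ∂μ) (Or.inr (hμ Q ⟨k, hQ⟩).2.ne))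
  refine h1.ae_eq (Eventually.of_forall fun x => ?_)
  by_cases hx : x ∈ Q <;> simp [hx]

end

end DyadicSystem

namespace HaarSystem

open Filter Topology

variable {n : ℕ} {D : DyadicSystem n} {μ : Measure (Fin n → ℝ)}

theorem mass_nonneg (h : HaarSystem D μ) (p : D.cubes × Fin (2 ^ n - 1)) : 0 ≤ h.mass p :=
  integral_nonneg fun _ => abs_nonneg _

theorem memLp_haar (h : HaarSystem D μ) (p : D.cubes × Fin (2 ^ n - 1)) : MemLp (h.haar p) 2 μ :=
  h.memLp p.1 p.2

theorem lintegral_haar_sq (h : HaarSystem D μ) (p : D.cubes × Fin (2 ^ n - 1)) :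
    ∫⁻ x, ‖h.haar p x‖ₑ ^ 2 ∂μ = 1 := by
  classical
  rw [← h.tsum_coef_sq (h.memLp_haar p), tsum_eq_single p]
  · simp [h.coef_haar]
  · intro q hq
    simp [h.coef_haar, hq]

theorem lintegral_enorm_haar (h : HaarSystem D μ) (hn : 1 ≤ n)
    (hμ : ∀ Q ∈ D.cubes, 0 < μ Q ∧ μ Q < ∞) (p : D.cubes × Fin (2 ^ n - 1)) :
    ∫⁻ x, ‖h.haar p x‖ₑ ∂μ = ENNReal.ofReal (h.mass p) := by
  rw [mass, ← ofReal_integral_norm_eq_lintegral_enorm (h.integrable_haar hn hμ p)]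
  rfl

theorem enorm_haar_le (h : HaarSystem D μ) (hn : 1 ≤ n)
    (hμ : ∀ Q ∈ D.cubes, 0 < μ Q ∧ μ Q < ∞) (p : D.cubes × Fin (2 ^ n - 1)) (x : Fin n → ℝ) :
    ‖h.haar p x‖ₑ ≤ eLpNorm (h.haar p) ∞ μ := by
  by_contra hlt
  have h1 : ∀ᵐ y ∂μ, ‖h.haar p y‖ₑ ≤ eLpNorm (h.haar p) ∞ μ := by
    rw [eLpNorm_exponent_top]
    exact ae_le_eLpNormEssSup
  have h2 : D.cell (D.level p.1 + 1) x ⊆ {y | ¬ ‖h.haar p y‖ₑ ≤ eLpNorm (h.haar p) ∞ μ} :=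
    fun y hy => by
      rw [mem_ofPred_eq, h.adapted_haar hn p x y hy]
      exact hlt
  have h3 := measure_mono_null h2 h1
  exact (hμ _ (D.cell_mem_cubes _ x)).1.ne' h3

theorem one_le_eLpNorm_mul (h : HaarSystem D μ) (p : D.cubes × Fin (2 ^ n - 1)) :
    1 ≤ eLpNorm (h.haar p) 1 μ * eLpNorm (h.haar p) ∞ μ := by
  refine (h.lintegral_haar_sq p).ge.trans ?_
  rw [eLpNorm_one_eq_lintegral_enorm, ← lintegral_mul_const'' _ (h.memLp_haar p).1.enorm]
  refine lintegral_mono_ae ?_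
  rw [eLpNorm_exponent_top]
  filter_upwards [ae_le_eLpNormEssSup (f := h.haar p) (μ := μ)] with x hx
  rw [sq]
  gcongr

/-- The comparison between the norms of the Haar functions that holds for balanced measures. -/
structure MassBound (h : HaarSystem D μ) (C : ℝ≥0) : Prop where
  haar_mul_mass_le : ∀ p x, |h.haar p x| * h.mass p ≤ C
  mass_le_child : ∀ p q : D.cubes × Fin (2 ^ n - 1), q.1.1 ∈ D.desc 1 p.1.1 →
    h.mass p ≤ C * h.mass q
  mass_child_le : ∀ p q : D.cubes × Fin (2 ^ n - 1), q.1.1 ∈ D.desc 1 p.1.1 →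
    h.mass q ≤ C * h.mass p

theorem Balanced.exists_massBound {h : HaarSystem D μ} (hbal : h.Balanced) (hn : 1 ≤ n)
    (hμ : ∀ Q ∈ D.cubes, 0 < μ Q ∧ μ Q < ∞) : ∃ C : ℝ≥0, h.MassBound C := by
  obtain ⟨C, hC⟩ := hbal
  have hC' : ∀ p q : D.cubes × Fin (2 ^ n - 1), q.1.1 ∈ D.desc 1 p.1.1 →
      eLpNorm (h.haar p) 1 μ * eLpNorm (h.haar q) ∞ μ ≤ C ∧
      eLpNorm (h.haar p) ∞ μ * eLpNorm (h.haar q) 1 μ ≤ C := fun p q hpq =>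
    ⟨le_self_add.trans (hC p.1 q.1 hpq p.2 q.2), le_add_self.trans (hC p.1 q.1 hpq p.2 q.2)⟩
  have hmass : ∀ p, eLpNorm (h.haar p) 1 μ = ENNReal.ofReal (h.mass p) := fun p => by
    rw [eLpNorm_one_eq_lintegral_enorm, h.lintegral_enorm_haar hn hμ]
  have key : ∀ p q, eLpNorm (h.haar p) 1 μ ≤ C * eLpNorm (h.haar q) 1 μ →
      h.mass p ≤ C * h.mass q := fun p q hpq => by
    rw [hmass, hmass, ← ENNReal.ofReal_coe_nnreal, ← ENNReal.ofReal_mul C.coe_nonneg,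
      ENNReal.ofReal_le_ofReal_iff (mul_nonneg C.coe_nonneg (h.mass_nonneg q))] at hpq
    exact hpq
  have hC1 : ∀ p q : D.cubes × Fin (2 ^ n - 1), q.1.1 ∈ D.desc 1 p.1.1 →
      h.mass p ≤ C * h.mass q ∧ h.mass q ≤ C * h.mass p := by
    intro p q hpq
    obtain ⟨h1, h2⟩ := hC' p q hpq
    constructor
    · refine key p q ?_
      calc eLpNorm (h.haar p) 1 μ = eLpNorm (h.haar p) 1 μ * 1 := (mul_one _).symm
        _ ≤ eLpNorm (h.haar p) 1 μ * (eLpNorm (h.haar q) 1 μ * eLpNorm (h.haar q) ∞ μ) := by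
            gcongr
            exact h.one_le_eLpNorm_mul q
        _ = eLpNorm (h.haar p) 1 μ * eLpNorm (h.haar q) ∞ μ * eLpNorm (h.haar q) 1 μ := by ring
        _ ≤ _ := by gcongr
    · refine key q p ?_
      calc eLpNorm (h.haar q) 1 μ = eLpNorm (h.haar q) 1 μ * 1 := (mul_one _).symm
        _ ≤ eLpNorm (h.haar q) 1 μ * (eLpNorm (h.haar p) 1 μ * eLpNorm (h.haar p) ∞ μ) := by
            gcongr
            exact h.one_le_eLpNorm_mul p
        _ = eLpNorm (h.haar p) ∞ μ * eLpNorm (h.haar q) 1 μ * eLpNorm (h.haar p) 1 μ := by ring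
        _ ≤ _ := by gcongr
  have hle : ∀ a : ℝ, 0 ≤ a → C * a ≤ (max C (C * C) : ℝ≥0) * a := fun a ha => by
    gcongr
    exact_mod_cast le_max_left _ _
  refine ⟨max C (C * C), fun p x => ?_,
    fun p q hpq => ((hC1 p q hpq).1).trans (hle _ (h.mass_nonneg q)),
    fun p q hpq => ((hC1 p q hpq).2).trans (hle _ (h.mass_nonneg p))⟩
  obtain ⟨y, hy⟩ := D.nonempty_of_gen (D.mem_gen_level p.1)
  obtain ⟨q, hq⟩ : ∃ q : D.cubes × Fin (2 ^ n - 1), q.1.1 ∈ D.desc 1 p.1.1 := by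
    refine ⟨(D.cellCube (D.level p.1 + 1) y, p.2), ?_⟩
    have := D.cell_mem_desc hn (D.level p.1) 1 y
    rwa [D.cell_eq (D.mem_gen_level p.1) hy] at this
  obtain ⟨h1, h2⟩ := hC' p q hq
  have h3 : ‖h.haar p x‖ₑ * eLpNorm (h.haar p) 1 μ ≤ (C * C : ℝ≥0) := by
    calc _ ≤ eLpNorm (h.haar p) ∞ μ * eLpNorm (h.haar p) 1 μ * 1 := by
          rw [mul_one]
          gcongr
          exact h.enorm_haar_le hn hμ p x
      _ ≤ eLpNorm (h.haar p) ∞ μ * eLpNorm (h.haar p) 1 μ *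
          (eLpNorm (h.haar q) 1 μ * eLpNorm (h.haar q) ∞ μ) := by
          gcongr
          exact h.one_le_eLpNorm_mul q
      _ = (eLpNorm (h.haar p) 1 μ * eLpNorm (h.haar q) ∞ μ) *
          (eLpNorm (h.haar p) ∞ μ * eLpNorm (h.haar q) 1 μ) := by ring
      _ ≤ _ := by
          push_cast
          gcongr
  rw [hmass, ← ofReal_norm, ← ENNReal.ofReal_mul (norm_nonneg _),
    ← ENNReal.ofReal_coe_nnreal, ENNReal.ofReal_le_ofReal_iff (by positivity)] at h3
  exact h3.trans (by exact_mod_cast le_max_right _ _)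

theorem MassBound.mass_le_desc {h : HaarSystem D μ} {C : ℝ≥0} (hC : h.MassBound C) (hn : 1 ≤ n)
    (r : ℕ) : ∀ p q : D.cubes × Fin (2 ^ n - 1), q.1.1 ∈ D.desc r p.1.1 →
      h.mass p ≤ C ^ (r + 2) * h.mass q ∧ h.mass q ≤ C ^ (r + 2) * h.mass p := by
  induction r with
  | zero =>
    have key : ∀ p q : D.cubes × Fin (2 ^ n - 1), q.1 = p.1 → h.mass p ≤ C ^ 2 * h.mass q := by
      intro p q hpq
      obtain ⟨y, hy⟩ := D.nonempty_of_gen (D.mem_gen_level p.1)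
      have h1 := D.cell_mem_desc hn (D.level p.1) 1 y
      rw [D.cell_eq (D.mem_gen_level p.1) hy] at h1
      have h2 := hC.mass_le_child p (D.cellCube (D.level p.1 + 1) y, p.2) h1
      have h3 := hC.mass_child_le q (D.cellCube (D.level p.1 + 1) y, p.2) (hpq ▸ h1)
      calc _ ≤ _ := h2
        _ ≤ C * (C * h.mass q) := by gcongr
        _ = _ := by ring
    intro p q hpq
    obtain ⟨k, hp, hq, hs⟩ := hpq
    obtain ⟨x, hx⟩ := D.nonempty_of_gen hq
    have : q.1 = p.1 := Subtype.ext ((D.partition k x).unique ⟨by simpa using hq, hx⟩ ⟨hp, hs hx⟩)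
    exact ⟨key p q this, key q p this.symm⟩
  | succ r ih =>
    intro p q hpq
    obtain ⟨k, hp, hq, hs⟩ := hpq
    obtain ⟨x, hx⟩ := D.nonempty_of_gen hq
    set q' : D.cubes × Fin (2 ^ n - 1) := (D.cellCube (k + r) x, q.2)
    have h1 : q'.1.1 ∈ D.desc r p.1.1 := by
      have := D.cell_mem_desc hn k r x
      rwa [D.cell_eq hp (hs hx)] at this
    have h2 : q.1.1 ∈ D.desc 1 q'.1.1 := by
      have := D.cell_mem_desc hn (k + r) 1 x
      have hk : k + r + (1 : ℕ) = k + (r + 1 : ℕ) := by push_cast; ring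
      rwa [hk, D.cell_eq hq hx] at this
    obtain ⟨h3, h4⟩ := ih p q' h1
    constructor
    · calc _ ≤ _ := h3
        _ ≤ C ^ (r + 2) * (C * h.mass q) := by
            gcongr
            exact hC.mass_le_child q' q h2
        _ = _ := by ring
    · calc _ ≤ _ := hC.mass_child_le q' q h2
        _ ≤ C * (C ^ (r + 2) * h.mass p) := by gcongr
        _ = _ := by ring

theorem mass_sq_le (h : HaarSystem D μ) (hn : 1 ≤ n) (hμ : ∀ Q ∈ D.cubes, 0 < μ Q ∧ μ Q < ∞)
    (p : D.cubes × Fin (2 ^ n - 1)) : ENNReal.ofReal (h.mass p) ^ 2 ≤ μ p.1.1 := by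
  have hm := D.measurableSet_of_gen (D.mem_gen_level p.1)
  have h1 := ENNReal.lintegral_mul_le_Lp_mul_Lq μ Real.HolderConjugate.two_two
    (f := fun x => ‖h.haar p x‖ₑ) (g := p.1.1.indicator 1)
    (h.measurable_haar hn p).enorm.aemeasurable
    ((measurable_one.indicator hm).aemeasurable)
  have h2 : ∀ x, ‖h.haar p x‖ₑ * p.1.1.indicator 1 x = ‖h.haar p x‖ₑ := by
    intro x
    by_cases hx : x ∈ p.1.1
    · simp [hx]
    · simp [hx, h.haar_eq_zero hx]
  have h3 : ∀ x, (p.1.1.indicator (1 : (Fin n → ℝ) → ℝ≥0∞) x) ^ (2 : ℝ) = p.1.1.indicator 1 x := by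
    intro x
    by_cases hx : x ∈ p.1.1 <;> simp [hx]
  simp only [Pi.mul_apply, h2, h3, lintegral_indicator_one hm, h.lintegral_enorm_haar hn hμ] at h1
  simp only [ENNReal.rpow_ofNat, h.lintegral_haar_sq, ENNReal.one_rpow, one_mul] at h1
  calc _ ≤ (μ p.1.1 ^ (1 / 2 : ℝ)) ^ 2 := by gcongr
    _ = _ := by
      rw [← ENNReal.rpow_natCast, ← ENNReal.rpow_mul]
      norm_num

/-- The part of the Haar series with coefficients `a` that belongs to the cube `Q`. -/
noncomputable def blk (h : HaarSystem D μ) (a : D.cubes × Fin (2 ^ n - 1) → ℝ) (Q : D.cubes)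
    (x : Fin n → ℝ) : ℝ := ∑ j, a (Q, j) * h.haar (Q, j) x

/-- The Hardy norm of a sequence of Haar coefficients. -/
noncomputable def hardy (h : HaarSystem D μ) (a : D.cubes × Fin (2 ^ n - 1) → ℝ) : ℝ≥0∞ :=
  ∫⁻ x, (∑' Q, ‖h.blk a Q x‖ₑ ^ 2) ^ (1 / 2 : ℝ) ∂μ

/-- The restriction of a sequence of coefficients to a set of cubes. -/
noncomputable def restr (G : Set D.cubes) (a : D.cubes × Fin (2 ^ n - 1) → ℝ) :
    D.cubes × Fin (2 ^ n - 1) → ℝ := (Prod.fst ⁻¹' G).indicator a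

theorem blk_restr_of_mem (h : HaarSystem D μ) {G : Set D.cubes}
    (a : D.cubes × Fin (2 ^ n - 1) → ℝ) {Q : D.cubes} (hQ : Q ∈ G) :
    h.blk (restr G a) Q = h.blk a Q := by
  funext x
  simp [blk, restr, indicator, hQ]

theorem blk_restr_of_notMem (h : HaarSystem D μ) {G : Set D.cubes}
    (a : D.cubes × Fin (2 ^ n - 1) → ℝ) {Q : D.cubes} (hQ : Q ∉ G) :
    h.blk (restr G a) Q = 0 := by
  funext x
  simp [blk, restr, indicator, hQ]

theorem blk_eq_zero (h : HaarSystem D μ) (a : D.cubes × Fin (2 ^ n - 1) → ℝ) {Q : D.cubes}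
    {x : Fin n → ℝ} (hx : x ∉ Q.1) : h.blk a Q x = 0 :=
  Finset.sum_eq_zero fun j _ => by rw [h.haar_eq_zero (p := (Q, j)) hx, mul_zero]

theorem adapted_blk (h : HaarSystem D μ) (hn : 1 ≤ n) (a : D.cubes × Fin (2 ^ n - 1) → ℝ)
    (Q : D.cubes) : D.Adapted (D.level Q + 1) (h.blk a Q) := fun x y hy =>
  Finset.sum_congr rfl fun j _ => by rw [h.adapted_haar hn (Q, j) x y hy]

theorem adapted_blk_cellCube (h : HaarSystem D μ) (hn : 1 ≤ n)
    (a : D.cubes × Fin (2 ^ n - 1) → ℝ) (k : ℤ) :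
    D.Adapted (k + 1) fun x => h.blk a (D.cellCube k x) x := fun x y hy => by
  have h1 : D.cellCube k y = D.cellCube k x :=
    D.cellCube_eq_of_mem (D.cell_subset hn (by omega) x hy)
  simp only [h1]
  exact h.adapted_blk hn a (D.cellCube k x) x y (by rwa [D.level_cellCube hn])

theorem measurable_blk (h : HaarSystem D μ) (hn : 1 ≤ n) (a : D.cubes × Fin (2 ^ n - 1) → ℝ)
    (Q : D.cubes) : Measurable (h.blk a Q) :=
  (h.adapted_blk hn a Q).measurable

theorem integrable_blk (h : HaarSystem D μ) (hn : 1 ≤ n)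
    (hμ : ∀ Q ∈ D.cubes, 0 < μ Q ∧ μ Q < ∞) (a : D.cubes × Fin (2 ^ n - 1) → ℝ)
    (Q : D.cubes) : Integrable (h.blk a Q) μ :=
  integrable_finsetSum _ fun j _ => (h.integrable_haar hn hμ (Q, j)).const_mul _

theorem memLp_blk (h : HaarSystem D μ) (a : D.cubes × Fin (2 ^ n - 1) → ℝ) (Q : D.cubes) :
    MemLp (h.blk a Q) 2 μ :=
  memLp_finsetSum _ fun j _ => (h.memLp_haar (Q, j)).const_mul _

theorem measurable_tsum_blk (h : HaarSystem D μ) (hn : 1 ≤ n)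
    (a : D.cubes × Fin (2 ^ n - 1) → ℝ) :
    Measurable fun x => (∑' Q, ‖h.blk a Q x‖ₑ ^ 2) ^ (1 / 2 : ℝ) :=
  (Measurable.tsum fun Q => (h.measurable_blk hn a Q).enorm.pow_const 2).pow_const _

theorem hardy_restr_le (h : HaarSystem D μ) (G : Set D.cubes)
    (a : D.cubes × Fin (2 ^ n - 1) → ℝ) : h.hardy (restr G a) ≤ h.hardy a := by
  refine lintegral_mono fun x => ENNReal.rpow_le_rpow (ENNReal.tsum_le_tsum fun Q => ?_)
    (by norm_num)
  by_cases hQ : Q ∈ G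
  · rw [h.blk_restr_of_mem a hQ]
  · simp [h.blk_restr_of_notMem a hQ]

theorem coef_blk (h : HaarSystem D μ) (hn : 1 ≤ n) (hμ : ∀ Q ∈ D.cubes, 0 < μ Q ∧ μ Q < ∞)
    [DecidableEq D.cubes] (a : D.cubes × Fin (2 ^ n - 1) → ℝ) (Q : D.cubes)
    (p : D.cubes × Fin (2 ^ n - 1)) : h.coef (h.blk a Q) p = if p.1 = Q then a p else 0 := by
  have h1 : h.coef (h.blk a Q) p = ∑ j, a (Q, j) * h.coef (h.haar (Q, j)) p := by
    simp only [coef, blk, Finset.sum_mul]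
    rw [integral_finsetSum]
    · simp only [mul_assoc, integral_const_mul]
    · intro j _
      simp only [mul_assoc]
      exact (h.integrable_mul_haar hn (h.integrable_haar hn hμ _).integrableOn).const_mul _
  rw [h1]
  simp only [h.coef_haar]
  split_ifs with hp
  · subst hp
    rw [Finset.sum_eq_single p.2] <;> simp +contextual [Prod.ext_iff, eq_comm]
  · exact Finset.sum_eq_zero fun j _ => by
      rw [if_neg (fun h' => hp (by rw [h'])), mul_zero]

theorem integral_mul_blk (h : HaarSystem D μ) (hn : 1 ≤ n)
    (a : D.cubes × Fin (2 ^ n - 1) → ℝ) (Q : D.cubes) {u : (Fin n → ℝ) → ℝ}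
    (hu : IntegrableOn u Q.1 μ) :
    Integrable (fun x => u x * h.blk a Q x) μ ∧
      ∫ x, u x * h.blk a Q x ∂μ = ∑ j, a (Q, j) * h.coef u (Q, j) := by
  have hi : ∀ j, Integrable (fun x => a (Q, j) * (u x * h.haar (Q, j) x)) μ := fun j =>
    (h.integrable_mul_haar hn (p := (Q, j)) hu).const_mul _
  have he : (fun x => u x * h.blk a Q x) = fun x => ∑ j, a (Q, j) * (u x * h.haar (Q, j) x) := by
    funext x
    rw [blk, Finset.mul_sum]
    exact Finset.sum_congr rfl fun j _ => by ring
  rw [he]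
  refine ⟨integrable_finsetSum _ fun j _ => hi j, ?_⟩
  rw [integral_finsetSum _ fun j _ => hi j]
  exact Finset.sum_congr rfl fun j _ => by rw [integral_const_mul, coef]

theorem lintegral_blk_sq (h : HaarSystem D μ) (hn : 1 ≤ n)
    (hμ : ∀ Q ∈ D.cubes, 0 < μ Q ∧ μ Q < ∞) (a : D.cubes × Fin (2 ^ n - 1) → ℝ) (Q : D.cubes) :
    ∫⁻ x, ‖h.blk a Q x‖ₑ ^ 2 ∂μ = ∑ j, ‖a (Q, j)‖ₑ ^ 2 := by
  classical
  rw [← h.tsum_coef_sq (h.memLp_blk a Q), ENNReal.tsum_prod', tsum_eq_single Q]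
  · simp [h.coef_blk hn hμ]
  · intro R hR
    simp [h.coef_blk hn hμ, hR]

theorem tsum_cubes (hn : 1 ≤ n) (x : Fin n → ℝ) {F : D.cubes → ℝ≥0∞}
    (hF : ∀ Q : D.cubes, x ∉ Q.1 → F Q = 0) :
    ∑' Q, F Q = ∑' k : ℤ, F (D.cellCube k x) := by
  refine ((D.cellCube_injective hn x).tsum_eq fun Q hQ => ?_).symm
  by_cases hx : x ∈ Q.1
  · exact ⟨D.level Q, D.cellCube_level hx⟩
  · exact absurd (hF Q hx) hQ

theorem tsum_cubes_nat (hn : 1 ≤ n) (x : Fin n → ℝ) (k : ℤ) {F : D.cubes → ℝ≥0∞}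
    (hF : ∀ Q : D.cubes, x ∉ Q.1 → F Q = 0) (hF' : ∀ Q, D.level Q < k → F Q = 0) :
    ∑' Q, F Q = ∑' m : ℕ, F (D.cellCube (k + m) x) := by
  have hinj : Function.Injective fun m : ℕ => D.cellCube (k + m) x := fun i j hij => by
    have := D.cellCube_injective hn x hij
    omega
  refine (hinj.tsum_eq fun Q hQ => ?_).symm
  by_cases hx : x ∈ Q.1
  · have hk : k ≤ D.level Q := le_of_not_gt fun hk => hQ (hF' Q hk)
    refine ⟨(D.level Q - k).toNat, ?_⟩
    simp only
    rw [show k + ((D.level Q - k).toNat : ℤ) = D.level Q by omega, D.cellCube_level hx]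
  · exact absurd (hF Q hx) hQ

/-- The Hardy norm of a function is the Hardy norm of its Haar coefficients. -/
theorem h1Norm_eq_hardy (h : HaarSystem D μ) (hn : 1 ≤ n)
    (hμ : ∀ Q ∈ D.cubes, 0 < μ Q ∧ μ Q < ∞) {f : (Fin n → ℝ) → ℝ}
    (hf : ∀ Q ∈ D.cubes, IntegrableOn f Q μ) : D.h1Norm μ f = h.hardy (h.coef f) := by
  refine lintegral_congr fun x => ?_
  rw [DyadicSystem.squareFn, tsum_cubes hn x fun Q hQ => by rw [h.blk_eq_zero _ hQ]; simp]
  congr 1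
  rw [← (Equiv.addRight (1 : ℤ)).tsum_eq]
  refine tsum_congr fun k => ?_
  simp only [Equiv.coe_addRight, DyadicSystem.mdiff, add_sub_cancel_right, ENNReal.rpow_ofNat]
  rw [h.mdiff_eq hn hμ k x (hf _ (D.cell_mem_cubes k x))]
  rfl

end HaarSystem

namespace DyadicSystem

variable {n : ℕ}

/-- Integration over the cubes of a generation. -/
theorem lintegral_eq_tsum_gen (D : DyadicSystem n) (μ : Measure (Fin n → ℝ)) (k : ℤ)
    (F : (Fin n → ℝ) → ℝ≥0∞) : ∫⁻ x, F x ∂μ = ∑' Q : D.gen k, ∫⁻ x in Q.1, F x ∂μ := by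
  have hU : ⋃ Q ∈ D.gen k, Q = (univ : Set (Fin n → ℝ)) :=
    eq_univ_of_forall fun x => mem_biUnion (D.cell_mem k x) (D.mem_cell k x)
  rw [← setLIntegral_univ, ← hU, lintegral_biUnion (D.countable_gen k)
    (fun Q hQ => D.measurableSet_of_gen hQ)]
  intro Q hQ R hR hne
  exact Set.disjoint_left.2 fun x hx hx' => hne ((D.partition k x).unique ⟨hQ, hx⟩ ⟨hR, hx'⟩)

theorem Adapted.lintegral_mul_le {D : DyadicSystem n} {μ : Measure (Fin n → ℝ)} {k : ℤ}
    {θ : (Fin n → ℝ) → ℝ≥0∞} (hθ : D.Adapted k θ) {F : (Fin n → ℝ) → ℝ≥0∞} (hF : Measurable F)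
    {B : ℝ≥0∞} (hB : ∀ Q ∈ D.gen k, ∫⁻ x in Q, F x ∂μ ≤ B * μ Q) :
    ∫⁻ x, θ x * F x ∂μ ≤ B * ∫⁻ x, θ x ∂μ := by
  rw [D.lintegral_eq_tsum_gen μ k, D.lintegral_eq_tsum_gen μ k, ← ENNReal.tsum_mul_left]
  refine ENNReal.tsum_le_tsum fun Q => ?_
  obtain ⟨x, hx⟩ := D.nonempty_of_gen Q.2
  have hc : ∀ y ∈ Q.1, θ y = θ x := fun y hy => hθ x y (by rwa [D.cell_eq Q.2 hx])
  have hm := D.measurableSet_of_gen Q.2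
  rw [setLIntegral_congr_fun hm (g := fun y => θ x * F y) fun y hy => by simp only [hc y hy],
    setLIntegral_congr_fun hm (g := fun _ => θ x) hc, lintegral_const_mul _ hF,
    setLIntegral_const]
  calc θ x * ∫⁻ y in Q.1, F y ∂μ ≤ θ x * (B * μ Q.1) := by gcongr; exact hB Q.1 Q.2
    _ = _ := by ring

/-- The square root of the partial sums of the squares. -/
noncomputable def partialSq (φ : ℕ → ℝ≥0) (m : ℕ) : ℝ≥0 :=
  NNReal.sqrt (∑ i ∈ Finset.range m, φ i ^ 2)

theorem partialSq_mono (φ : ℕ → ℝ≥0) (m : ℕ) : partialSq φ m ≤ partialSq φ (m + 1) := by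
  rw [partialSq, partialSq, NNReal.sqrt_le_sqrt, Finset.sum_range_succ]
  exact le_self_add

theorem sum_partialSq (φ : ℕ → ℝ≥0) (m : ℕ) :
    ∑ i ∈ Finset.range m, (partialSq φ (i + 1) - partialSq φ i) = partialSq φ m := by
  induction m with
  | zero => simp [partialSq]
  | succ m ih => rw [Finset.sum_range_succ, ih, add_tsub_cancel_of_le (partialSq_mono φ m)]

theorem two_mul_le_partialSq (φ : ℕ → ℝ≥0) (m : ℕ) (B ψ : ℝ≥0) :
    2 * B * (φ m * ψ) ≤
      2 * B ^ 2 * (partialSq φ (m + 1) - partialSq φ m) + partialSq φ (m + 1) * ψ ^ 2 := by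
  have hs : partialSq φ (m + 1) ^ 2 = partialSq φ m ^ 2 + φ m ^ 2 := by
    simp only [partialSq, NNReal.sq_sqrt, Finset.sum_range_succ]
  have hm := partialSq_mono φ m
  rw [← NNReal.coe_le_coe]
  push_cast [NNReal.coe_sub hm]
  have hs' : (partialSq φ (m + 1) : ℝ) ^ 2 = (partialSq φ m : ℝ) ^ 2 + (φ m : ℝ) ^ 2 := by
    exact_mod_cast hs
  have hm' : (partialSq φ m : ℝ) ≤ partialSq φ (m + 1) := by exact_mod_cast hm
  have h0 : (0 : ℝ) ≤ partialSq φ m := NNReal.coe_nonneg _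
  generalize (partialSq φ (m + 1) : ℝ) = s at *
  generalize (partialSq φ m : ℝ) = t at *
  have hφ : (φ m : ℝ) ^ 2 ≤ 2 * s * (s - t) := by nlinarith
  have hB : (0 : ℝ) ≤ B := B.coe_nonneg
  have hψ : (0 : ℝ) ≤ ψ := ψ.coe_nonneg
  have hX : 0 ≤ 2 * (B : ℝ) ^ 2 * (s - t) + s * (ψ : ℝ) ^ 2 := by
    have : 0 ≤ s - t := sub_nonneg.2 hm'
    have : 0 ≤ s := h0.trans hm'
    positivity
  refine abs_le_of_sq_le_sq' ?_ hX |>.2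
  have h1 : (2 * (B : ℝ) * (φ m * ψ)) ^ 2 ≤ 4 * B ^ 2 * ψ ^ 2 * (2 * s * (s - t)) := by
    have : (2 * (B : ℝ) * (φ m * ψ)) ^ 2 = 4 * B ^ 2 * ψ ^ 2 * φ m ^ 2 := by ring
    rw [this]
    gcongr
  refine h1.trans ?_
  nlinarith [sq_nonneg (2 * (B : ℝ) ^ 2 * (s - t) - s * (ψ : ℝ) ^ 2)]

/-- The Fefferman inequality for adapted sequences. -/
theorem lintegral_tsum_mul_le (D : DyadicSystem n) (μ : Measure (Fin n → ℝ)) (k : ℤ)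
    (hn : 1 ≤ n) {φ ψ : ℕ → (Fin n → ℝ) → ℝ≥0} (hφ : ∀ m : ℕ, D.Adapted (k + m + 1) (φ m))
    (hψ : ∀ m, Measurable (ψ m)) {B : ℝ≥0} (hB : 0 < B)
    (hψB : ∀ i : ℕ, ∀ Q ∈ D.gen (k + i + 1),
      ∫⁻ x in Q, ∑' m, (if i ≤ m then (ψ m x : ℝ≥0∞) ^ 2 else 0) ∂μ ≤ B ^ 2 * μ Q) :
    ∫⁻ x, ∑' m, (φ m x * ψ m x : ℝ≥0∞) ∂μ ≤
      2 * B * ∫⁻ x, (∑' m, (φ m x : ℝ≥0∞) ^ 2) ^ (1 / 2 : ℝ) ∂μ := by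
  set Δ : ℕ → (Fin n → ℝ) → ℝ≥0∞ := fun m x =>
    ((partialSq (fun i => φ i x) (m + 1) - partialSq (fun i => φ i x) m : ℝ≥0) : ℝ≥0∞) with hΔ
  have hS : ∀ m x, ∑ i ∈ Finset.range m, Δ i x = (partialSq (fun i => φ i x) m : ℝ≥0∞) :=
    fun m x => by
      rw [← sum_partialSq, ENNReal.ofNNReal_finsetSum]
  have hΔa : ∀ m : ℕ, D.Adapted (k + m + 1) (Δ m) := by
    intro m x y hy
    have h1 : ∀ l, l ≤ m + 1 →
        partialSq (fun i => φ i y) l = partialSq (fun i => φ i x) l := fun l hl => by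
      simp only [partialSq]
      congr 1
      refine Finset.sum_congr rfl fun i hi => ?_
      rw [(hφ i).mono hn (by have := Finset.mem_range.1 hi; omega :
        k + (i : ℤ) + 1 ≤ k + m + 1) x y hy]
    simp only [hΔ, h1 (m + 1) le_rfl, h1 m (Nat.le_succ m)]
  have hΔs : ∀ x, ∑' m, Δ m x ≤ (∑' m, (φ m x : ℝ≥0∞) ^ 2) ^ (1 / 2 : ℝ) := fun x => by
    refine ENNReal.tsum_le_of_sum_range_le fun N => ?_
    rw [hS]
    have h2 : (partialSq (fun i => φ i x) N : ℝ≥0∞) =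
        ((∑ i ∈ Finset.range N, (φ i x : ℝ≥0∞) ^ 2)) ^ (1 / 2 : ℝ) := by
      rw [partialSq, NNReal.sqrt_eq_rpow, ENNReal.coe_rpow_of_nonneg _ (by norm_num)]
      push_cast
      rfl
    rw [h2]
    exact ENNReal.rpow_le_rpow (ENNReal.sum_le_tsum _) (by norm_num)
  have hpt : ∀ m x, 2 * (B : ℝ≥0∞) * (φ m x * ψ m x) ≤
      2 * (B : ℝ≥0∞) ^ 2 * Δ m x +
        ∑' i, Δ i x * (if i ≤ m then (ψ m x : ℝ≥0∞) ^ 2 else 0) := by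
    intro m x
    have h1 := two_mul_le_partialSq (fun i => φ i x) m B (ψ m x)
    have h2 : ∑' i, Δ i x * (if i ≤ m then (ψ m x : ℝ≥0∞) ^ 2 else 0) =
        (partialSq (fun i => φ i x) (m + 1) : ℝ≥0∞) * (ψ m x : ℝ≥0∞) ^ 2 := by
      rw [tsum_eq_sum (s := Finset.range (m + 1)), ← hS, Finset.sum_mul]
      · refine Finset.sum_congr rfl fun i hi => ?_
        rw [if_pos (by have := Finset.mem_range.1 hi; omega)]
      · intro i hi
        rw [if_neg (by simpa using hi), mul_zero]
    rw [h2]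
    have h3 := ENNReal.coe_le_coe.2 h1
    simpa only [ENNReal.coe_mul, ENNReal.coe_add, ENNReal.coe_pow, ENNReal.coe_ofNat] using h3
  have hmΔ : ∀ m, Measurable (Δ m) := fun m => (hΔa m).measurable
  have hmψ : ∀ i, Measurable fun x => ∑' m, (if i ≤ m then (ψ m x : ℝ≥0∞) ^ 2 else 0) :=
    fun i => Measurable.tsum fun m => by
      split_ifs
      · exact (hψ m).coe_nnreal_ennreal.pow_const 2
      · exact measurable_const
  have hmain : ∫⁻ x, ∑' m, 2 * (B : ℝ≥0∞) * (φ m x * ψ m x : ℝ≥0∞) ∂μ ≤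
      3 * (B : ℝ≥0∞) ^ 2 * ∫⁻ x, (∑' m, (φ m x : ℝ≥0∞) ^ 2) ^ (1 / 2 : ℝ) ∂μ := by
    calc _ ≤ ∫⁻ x, ((∑' m, 2 * (B : ℝ≥0∞) ^ 2 * Δ m x) +
          ∑' i, Δ i x * ∑' m, (if i ≤ m then (ψ m x : ℝ≥0∞) ^ 2 else 0)) ∂μ := by
          refine lintegral_mono fun x => ?_
          refine (ENNReal.tsum_le_tsum fun m => hpt m x).trans ?_
          rw [ENNReal.tsum_add, ENNReal.tsum_comm]
          simp only [ENNReal.tsum_mul_left]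
          exact le_rfl
      _ = 2 * (B : ℝ≥0∞) ^ 2 * ∫⁻ x, ∑' m, Δ m x ∂μ +
          ∑' i, ∫⁻ x, Δ i x * ∑' m, (if i ≤ m then (ψ m x : ℝ≥0∞) ^ 2 else 0) ∂μ := by
          simp only [ENNReal.tsum_mul_left]
          rw [lintegral_add_left ((Measurable.tsum hmΔ).const_mul _),
            lintegral_const_mul _ (Measurable.tsum hmΔ)]
          congr 1
          exact lintegral_tsum fun i => ((hmΔ i).mul (hmψ i)).aemeasurable
      _ ≤ 2 * (B : ℝ≥0∞) ^ 2 * ∫⁻ x, ∑' m, Δ m x ∂μ +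
          ∑' i, (B : ℝ≥0∞) ^ 2 * ∫⁻ x, Δ i x ∂μ := by
          gcongr with i
          exact (hΔa i).lintegral_mul_le (hmψ i) (hψB i)
      _ = 3 * (B : ℝ≥0∞) ^ 2 * ∫⁻ x, ∑' m, Δ m x ∂μ := by
          rw [ENNReal.tsum_mul_left, lintegral_tsum fun i => (hmΔ i).aemeasurable]
          ring
      _ ≤ _ := by
          gcongr with x
          exact hΔs x
  have hmφ : Measurable fun x => ∑' m, (φ m x * ψ m x : ℝ≥0∞) :=
    Measurable.tsum fun m =>
      (hφ m).measurable.coe_nnreal_ennreal.mul (hψ m).coe_nnreal_ennreal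
  simp only [ENNReal.tsum_mul_left] at hmain
  rw [lintegral_const_mul _ hmφ] at hmain
  have hB0 : 2 * (B : ℝ≥0∞) ≠ 0 := by simp [hB.ne']
  have hBt : 2 * (B : ℝ≥0∞) ≠ ∞ := ENNReal.mul_ne_top (by simp) (by simp)
  rw [← ENNReal.mul_le_mul_iff_right hB0 hBt]
  refine hmain.trans ?_
  rw [← mul_assoc]
  gcongr ?_ * _
  calc 3 * (B : ℝ≥0∞) ^ 2 ≤ 4 * (B : ℝ≥0∞) ^ 2 := by gcongr; norm_num
    _ = _ := by ring

end DyadicSystem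

namespace HaarSystem

open Filter Topology

variable {n : ℕ} {D : DyadicSystem n} {μ : Measure (Fin n → ℝ)}

/-- The sequences of Haar coefficients of BMO functions: a Carleson condition and a bound on the
size of the martingale differences. -/
structure Carleson (h : HaarSystem D μ) (b : D.cubes × Fin (2 ^ n - 1) → ℝ) (B : ℝ≥0) : Prop where
  abs_le : ∀ p, |b p| ≤ B * h.mass p
  tsum_le : ∀ Q : D.cubes,
    ∑' p, (below D Q.1).indicator (fun p => ‖b p‖ₑ ^ 2) p ≤ (B : ℝ≥0∞) ^ 2 * μ Q.1

theorem Carleson.abs_blk_le {h : HaarSystem D μ} {b : D.cubes × Fin (2 ^ n - 1) → ℝ} {B C : ℝ≥0}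
    (hb : h.Carleson b B) (hC : h.MassBound C) (Q : D.cubes) (x : Fin n → ℝ) :
    |h.blk b Q x| ≤ B * (2 ^ n * C) := by
  have h1 : ∀ j, |b (Q, j) * h.haar (Q, j) x| ≤ B * C := fun j => by
    rw [abs_mul]
    calc _ ≤ B * h.mass (Q, j) * |h.haar (Q, j) x| := by
          gcongr
          exact hb.abs_le _
      _ = B * (|h.haar (Q, j) x| * h.mass (Q, j)) := by ring
      _ ≤ _ := by
          gcongr
          exact hC.haar_mul_mass_le _ _
  calc _ ≤ ∑ j, |b (Q, j) * h.haar (Q, j) x| := Finset.abs_sum_le_sum_abs _ _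
    _ ≤ ∑ _j : Fin (2 ^ n - 1), (B * C : ℝ) := Finset.sum_le_sum fun j _ => h1 j
    _ = ((2 ^ n - 1 : ℕ) : ℝ) * (B * C) := by simp
    _ ≤ 2 ^ n * (B * C) := by
        gcongr
        exact_mod_cast Nat.sub_le _ _
    _ = _ := by ring

theorem tsum_below_eq (h : HaarSystem D μ) (hn : 1 ≤ n)
    (hμ : ∀ Q ∈ D.cubes, 0 < μ Q ∧ μ Q < ∞) (b : D.cubes × Fin (2 ^ n - 1) → ℝ)
    (Q : Set (Fin n → ℝ)) :
    ∑' p, (below D Q).indicator (fun p => ‖b p‖ₑ ^ 2) p =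
      ∫⁻ x, ∑' S, {S : D.cubes | S.1 ⊆ Q}.indicator (fun S => ‖h.blk b S x‖ₑ ^ 2) S ∂μ := by
  rw [lintegral_tsum, ENNReal.tsum_prod']
  · refine tsum_congr fun S => ?_
    by_cases hS : S.1 ⊆ Q
    · simp [below, hS, h.lintegral_blk_sq hn hμ, indicator]
    · simp [below, hS, indicator]
  · intro S
    by_cases hS : S.1 ⊆ Q
    · simp only [indicator, mem_ofPred_eq, hS, if_true]
      exact ((h.measurable_blk hn b S).enorm.pow_const 2).aemeasurable
    · simp only [indicator, mem_ofPred_eq, hS, if_false]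
      exact aemeasurable_const

theorem Carleson.lintegral_tail_le {h : HaarSystem D μ} {b : D.cubes × Fin (2 ^ n - 1) → ℝ}
    {B C : ℝ≥0} (hb : h.Carleson b B) (hC : h.MassBound C) (hn : 1 ≤ n)
    (hμ : ∀ Q ∈ D.cubes, 0 < μ Q ∧ μ Q < ∞) (k : ℤ) (i : ℕ) {Q : Set (Fin n → ℝ)}
    (hQ : Q ∈ D.gen (k + i + 1)) :
    ∫⁻ x in Q, ∑' m : ℕ, (if i ≤ m then
      (‖h.blk b (D.cellCube (k + m) x) x‖₊ : ℝ≥0∞) ^ 2 else 0) ∂μ ≤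
      ((B * (2 ^ n * C + 1) : ℝ≥0) : ℝ≥0∞) ^ 2 * μ Q := by
  have hQm := D.measurableSet_of_gen hQ
  have hpt : ∀ x ∈ Q, ∑' m : ℕ, (if i ≤ m then
      (‖h.blk b (D.cellCube (k + m) x) x‖₊ : ℝ≥0∞) ^ 2 else 0) ≤
      ((B * (2 ^ n * C) : ℝ≥0) : ℝ≥0∞) ^ 2 +
      ∑' S, {S : D.cubes | S.1 ⊆ Q}.indicator (fun S => ‖h.blk b S x‖ₑ ^ 2) S := by
    intro x hx
    have h1 : ∀ m : ℕ, (if i ≤ m then (‖h.blk b (D.cellCube (k + m) x) x‖₊ : ℝ≥0∞) ^ 2 else 0) ≤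
        (if m = i then ((B * (2 ^ n * C) : ℝ≥0) : ℝ≥0∞) ^ 2 else 0) +
        {S : D.cubes | S.1 ⊆ Q}.indicator (fun S => ‖h.blk b S x‖ₑ ^ 2)
          (D.cellCube (k + m) x) := by
      intro m
      rcases lt_trichotomy m i with hm | rfl | hm
      · rw [if_neg (by omega)]
        exact bot_le
      · simp only [le_refl, if_true]
        refine le_trans ?_ le_self_add
        gcongr
        rw [← NNReal.coe_le_coe]
        push_cast
        exact hb.abs_blk_le hC _ x
      · have hs : (D.cellCube (k + m) x).1 ⊆ Q :=
          D.cell_subset_of_mem_gen hn (by omega) hQ hx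
        rw [if_pos (by omega), if_neg (by omega), zero_add, indicator_of_mem hs]
        exact le_rfl
    refine (ENNReal.tsum_le_tsum h1).trans ?_
    rw [ENNReal.tsum_add, tsum_ite_eq]
    gcongr
    have hinj : Function.Injective fun m : ℕ => D.cellCube (k + m) x := fun i j hij => by
      have := D.cellCube_injective hn x hij
      omega
    exact ENNReal.tsum_comp_le_tsum_of_injective hinj _
  calc _ ≤ ∫⁻ x in Q, (((B * (2 ^ n * C) : ℝ≥0) : ℝ≥0∞) ^ 2 +
        ∑' S, {S : D.cubes | S.1 ⊆ Q}.indicator (fun S => ‖h.blk b S x‖ₑ ^ 2) S) ∂μ :=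
        setLIntegral_mono' hQm hpt
    _ ≤ ((B * (2 ^ n * C) : ℝ≥0) : ℝ≥0∞) ^ 2 * μ Q + (B : ℝ≥0∞) ^ 2 * μ Q := by
        rw [lintegral_add_left measurable_const, setLIntegral_const]
        gcongr
        refine (setLIntegral_le_lintegral _ _).trans ?_
        rw [← h.tsum_below_eq hn hμ b Q]
        exact hb.tsum_le ⟨Q, _, hQ⟩
    _ ≤ _ := by
        rw [← add_mul]
        gcongr
        generalize 2 ^ n * C = t
        norm_cast
        calc (B * t) ^ 2 + B ^ 2 = B ^ 2 * (t ^ 2 + 1) := by ring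
          _ ≤ B ^ 2 * (t + 1) ^ 2 := by
              gcongr
              rw [add_sq, one_pow, add_assoc, add_comm (2 * t * 1), ← add_assoc]
              exact le_self_add
          _ = _ := by ring

/-- The `H¹`–BMO duality inequality for sequences of Haar coefficients. -/
theorem Carleson.pairing_le {h : HaarSystem D μ} {b : D.cubes × Fin (2 ^ n - 1) → ℝ}
    {B C : ℝ≥0} (hb : h.Carleson b B) (hB : 0 < B) (hC : h.MassBound C) (hn : 1 ≤ n)
    (hμ : ∀ Q ∈ D.cubes, 0 < μ Q ∧ μ Q < ∞) (a : D.cubes × Fin (2 ^ n - 1) → ℝ)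
    (G : Finset D.cubes) :
    ENNReal.ofReal (∑ Q ∈ G, ∑ j, a (Q, j) * b (Q, j)) ≤
      2 * (B * (2 ^ n * C + 1) : ℝ≥0) * h.hardy (restr G a) := by
  classical
  obtain ⟨k, hk⟩ : ∃ k, ∀ Q ∈ G, k ≤ D.level Q := by
    obtain ⟨k, hk⟩ := (G.image D.level).bddBelow
    exact ⟨k, fun Q hQ => hk (Finset.mem_coe.2 (Finset.mem_image_of_mem _ hQ))⟩
  have hlow : ∀ Q, D.level Q < k → h.blk (restr G a) Q = 0 := fun Q hQ =>
    h.blk_restr_of_notMem a fun hG => by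
      have := hk Q hG
      omega
  have hpair : ∀ Q ∈ G, ENNReal.ofReal (∑ j, a (Q, j) * b (Q, j)) ≤
      ∫⁻ x, ‖h.blk (restr G a) Q x‖ₑ * ‖h.blk b Q x‖ₑ ∂μ := by
    intro Q hQ
    obtain ⟨h1, h2⟩ := h.integral_mul_blk hn a Q (h.integrable_blk hn hμ b Q).integrableOn
    simp only [h.coef_blk hn hμ, if_true] at h2
    rw [← h2, h.blk_restr_of_mem a hQ]
    refine (ENNReal.ofReal_le_ofReal (Real.le_norm_self _)).trans ?_
    rw [ofReal_norm]
    refine (enorm_integral_le_lintegral_enorm _).trans (lintegral_mono fun x => ?_)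
    rw [enorm_mul, mul_comm]
  have hm : ∀ Q, Measurable fun x => ‖h.blk (restr G a) Q x‖ₑ * ‖h.blk b Q x‖ₑ := fun Q =>
    (h.measurable_blk hn _ Q).enorm.mul (h.measurable_blk hn b Q).enorm
  have hK : 0 < B * (2 ^ n * C + 1) := mul_pos hB (by positivity)
  have hF := D.lintegral_tsum_mul_le μ k hn
    (φ := fun m x => ‖h.blk (restr G a) (D.cellCube (k + m) x) x‖₊)
    (ψ := fun m x => ‖h.blk b (D.cellCube (k + m) x) x‖₊)
    (fun m => (h.adapted_blk_cellCube hn _ (k + m)).comp _)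
    (fun m => ((h.adapted_blk_cellCube hn _ (k + m)).comp _).measurable) hK
    (fun i Q hQ => hb.lintegral_tail_le hC hn hμ k i hQ)
  calc _ ≤ ∑ Q ∈ G, ∫⁻ x, ‖h.blk (restr G a) Q x‖ₑ * ‖h.blk b Q x‖ₑ ∂μ := by
        refine le_trans ?_ (Finset.sum_le_sum hpair)
        exact Finset.le_sum_of_subadditive _ ENNReal.ofReal_zero.le
          (fun _ _ => ENNReal.ofReal_add_le) _ _
    _ = ∫⁻ x, ∑ Q ∈ G, ‖h.blk (restr G a) Q x‖ₑ * ‖h.blk b Q x‖ₑ ∂μ :=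
        (lintegral_finsetSum _ fun Q _ => hm Q).symm
    _ ≤ ∫⁻ x, ∑' Q, ‖h.blk (restr G a) Q x‖ₑ * ‖h.blk b Q x‖ₑ ∂μ :=
        lintegral_mono fun x => ENNReal.sum_le_tsum _
    _ = ∫⁻ x, ∑' m : ℕ, (‖h.blk (restr G a) (D.cellCube (k + m) x) x‖₊ *
          ‖h.blk b (D.cellCube (k + m) x) x‖₊ : ℝ≥0∞) ∂μ := by
        refine lintegral_congr fun x => ?_
        exact tsum_cubes_nat hn x k (fun Q hQ => by simp [h.blk_eq_zero _ hQ])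
          fun Q hQ => by simp [hlow Q hQ]
    _ ≤ _ := hF
    _ = _ := by
        congr 1
        refine lintegral_congr fun x => ?_
        rw [tsum_cubes_nat hn x k (fun Q hQ => by simp [h.blk_eq_zero _ hQ])
          fun Q hQ => by simp [hlow Q hQ]]
        rfl

theorem integrableOn_of_abs_le_one (hμ : ∀ Q ∈ D.cubes, 0 < μ Q ∧ μ Q < ∞)
    {v : (Fin n → ℝ) → ℝ} (hv : Measurable v) (hv1 : ∀ x, |v x| ≤ 1) (Q : D.cubes) :
    IntegrableOn v Q.1 μ := by
  have : IsFiniteMeasure (μ.restrict Q.1) := ⟨by simpa using (hμ Q.1 Q.2).2⟩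
  exact Integrable.of_bound hv.aestronglyMeasurable 1 (Eventually.of_forall hv1)

theorem abs_coef_le (h : HaarSystem D μ) (hn : 1 ≤ n) (hμ : ∀ Q ∈ D.cubes, 0 < μ Q ∧ μ Q < ∞)
    {v : (Fin n → ℝ) → ℝ} (hv : Measurable v) (hv1 : ∀ x, |v x| ≤ 1)
    (p : D.cubes × Fin (2 ^ n - 1)) : |h.coef v p| ≤ h.mass p := by
  refine (abs_integral_le_integral_abs (f := fun x => v x * h.haar p x)).trans ?_
  refine integral_mono (h.integrable_mul_haar hn (integrableOn_of_abs_le_one hμ hv hv1 p.1)).abs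
    (h.integrable_haar hn hμ p).abs fun x => ?_
  simp only [abs_mul]
  exact mul_le_of_le_one_left (abs_nonneg _) (hv1 x)

theorem tsum_coef_sq_below_le (h : HaarSystem D μ) (hμ : ∀ Q ∈ D.cubes, 0 < μ Q ∧ μ Q < ∞)
    {v : (Fin n → ℝ) → ℝ} (hv : Measurable v) (hv1 : ∀ x, |v x| ≤ 1) (Q : D.cubes) :
    ∑' p, (below D Q.1).indicator (fun p => ‖h.coef v p‖ₑ ^ 2) p ≤
      ∫⁻ x in Q.1, ‖v x‖ₑ ^ 2 ∂μ := by
  have hQm := D.measurableSet_of_gen (D.mem_gen_level Q)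
  have hL : MemLp (Q.1.indicator v) 2 μ := by
    have : IsFiniteMeasure (μ.restrict Q.1) := ⟨by simpa using (hμ Q.1 Q.2).2⟩
    rw [memLp_indicator_iff_restrict hQm]
    exact MemLp.of_bound hv.aestronglyMeasurable 1 (Eventually.of_forall hv1)
  calc _ ≤ ∑' p, ‖h.coef (Q.1.indicator v) p‖ₑ ^ 2 := by
        refine ENNReal.tsum_le_tsum fun p => ?_
        by_cases hp : p ∈ below D Q.1
        · rw [indicator_of_mem hp, h.coef_congr (f := v) (g := Q.1.indicator v)]
          filter_upwards [ae_restrict_mem (D.measurableSet_of_gen (D.mem_gen_level p.1))]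
            with x hx
          rw [indicator_of_mem (hp hx)]
        · simp [hp]
    _ = _ := by
        rw [h.tsum_coef_sq hL, ← lintegral_indicator hQm]
        refine lintegral_congr fun x => ?_
        by_cases hx : x ∈ Q.1 <;> simp [hx]

/-- The coefficients of a bounded function. -/
theorem carleson_coef (h : HaarSystem D μ) (hn : 1 ≤ n) (hμ : ∀ Q ∈ D.cubes, 0 < μ Q ∧ μ Q < ∞)
    {v : (Fin n → ℝ) → ℝ} (hv : Measurable v) (hv1 : ∀ x, |v x| ≤ 1) :
    h.Carleson (h.coef v) 1 where
  abs_le p := by simpa using h.abs_coef_le hn hμ hv hv1 p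
  tsum_le Q := by
    refine (h.tsum_coef_sq_below_le hμ hv hv1 Q).trans ?_
    rw [ENNReal.coe_one, one_pow, one_mul, ← setLIntegral_one]
    refine lintegral_mono fun x => pow_le_one₀ bot_le ?_
    rw [← ofReal_norm, ENNReal.ofReal_le_one]
    exact hv1 x

/-- The Davis inequality for finite Haar sums. -/
theorem lintegral_sum_blk_le (h : HaarSystem D μ) {C : ℝ≥0} (hC : h.MassBound C) (hn : 1 ≤ n)
    (hμ : ∀ Q ∈ D.cubes, 0 < μ Q ∧ μ Q < ∞) (c : D.cubes × Fin (2 ^ n - 1) → ℝ)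
    (G : Finset D.cubes) :
    ∫⁻ x, ‖∑ Q ∈ G, h.blk c Q x‖ₑ ∂μ ≤
      2 * (2 ^ n * C + 1 : ℝ≥0) * h.hardy (restr G c) := by
  set u : (Fin n → ℝ) → ℝ := fun x => ∑ Q ∈ G, h.blk c Q x with hu
  have hum : Measurable u := Finset.measurable_fun_sum _ fun Q _ => h.measurable_blk hn c Q
  set v : (Fin n → ℝ) → ℝ := fun x => if 0 ≤ u x then 1 else -1 with hv
  have hvm : Measurable v :=
    Measurable.ite (measurableSet_le measurable_const hum) measurable_const measurable_const
  have hv1 : ∀ x, |v x| ≤ 1 := fun x => by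
    simp only [hv]
    split_ifs <;> simp
  have hvu : ∀ x, v x * u x = |u x| := fun x => by
    simp only [hv]
    split_ifs with hx
    · rw [abs_of_nonneg hx, one_mul]
    · rw [abs_of_neg (not_le.1 hx), neg_one_mul]
  have hp := (h.carleson_coef hn hμ hvm hv1).pairing_le one_pos hC hn hμ c G
  rw [one_mul] at hp
  refine le_trans (le_of_eq ?_) hp
  have hb := fun Q => h.integral_mul_blk hn c Q (integrableOn_of_abs_le_one hμ hvm hv1 Q)
  have h1 : ∑ Q ∈ G, ∑ j, c (Q, j) * h.coef v (Q, j) = ∫ x, |u x| ∂μ := by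
    rw [Finset.sum_congr rfl fun Q _ => (hb Q).2.symm,
      ← integral_finsetSum _ fun Q _ => (hb Q).1]
    refine integral_congr_ae (Eventually.of_forall fun x => ?_)
    simp only
    rw [← hvu, hu, Finset.mul_sum]
  rw [h1]
  have hui : Integrable u μ := integrable_finsetSum _ fun Q _ => h.integrable_blk hn hμ c Q
  rw [← ofReal_integral_norm_eq_lintegral_enorm hui]
  rfl

theorem tsum_blk_restr (h : HaarSystem D μ) (c : D.cubes × Fin (2 ^ n - 1) → ℝ)
    (G : Finset D.cubes) (x : Fin n → ℝ) :
    ∑' Q, ‖h.blk (restr G c) Q x‖ₑ ^ 2 = ∑ Q ∈ G, ‖h.blk c Q x‖ₑ ^ 2 := by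
  rw [tsum_eq_sum (s := G)]
  · exact Finset.sum_congr rfl fun Q hQ => by rw [h.blk_restr_of_mem c (Finset.mem_coe.2 hQ)]
  · intro Q hQ
    rw [h.blk_restr_of_notMem c (by simpa using hQ)]
    simp

/-- The Hardy norm of a finite sequence is attained on a sequence in the unit ball of BMO. -/
theorem exists_carleson_pairing (h : HaarSystem D μ) (hn : 1 ≤ n)
    (hμ : ∀ Q ∈ D.cubes, 0 < μ Q ∧ μ Q < ∞) (c : D.cubes × Fin (2 ^ n - 1) → ℝ)
    (G : Finset D.cubes) : ∃ b, h.Carleson b 1 ∧ (∀ p, p.1 ∉ G → b p = 0) ∧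
      h.hardy (restr G c) = ENNReal.ofReal (∑ Q ∈ G, ∑ j, c (Q, j) * b (Q, j)) := by
  classical
  set σ : (Fin n → ℝ) → ℝ := fun x => √(∑ Q ∈ G, h.blk c Q x ^ 2) with hσ
  have hσm : Measurable σ :=
    (Finset.measurable_fun_sum _ fun Q _ => (h.measurable_blk hn c Q).pow_const 2).sqrt
  have hσ2 : ∀ x, σ x ^ 2 = ∑ Q ∈ G, h.blk c Q x ^ 2 := fun x =>
    Real.sq_sqrt (Finset.sum_nonneg fun Q _ => sq_nonneg _)
  have hσ0 : ∀ x, 0 ≤ σ x := fun x => Real.sqrt_nonneg _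
  set u : D.cubes → (Fin n → ℝ) → ℝ := fun Q x => if Q ∈ G then h.blk c Q x / σ x else 0 with hu
  have hum : ∀ Q, Measurable (u Q) := fun Q => by
    simp only [hu]
    split_ifs
    · exact (h.measurable_blk hn c Q).div hσm
    · exact measurable_const
  have hu2 : ∀ x, ∑ Q ∈ G, u Q x ^ 2 ≤ 1 := fun x => by
    rw [Finset.sum_congr rfl fun Q hQ => show u Q x ^ 2 = h.blk c Q x ^ 2 / σ x ^ 2 by
      simp only [hu, hQ, if_true, div_pow], ← Finset.sum_div, hσ2]
    exact div_self_le_one _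
  have hu1 : ∀ Q x, |u Q x| ≤ 1 := fun Q x => by
    by_cases hQ : Q ∈ G
    · rw [← sq_le_one_iff_abs_le_one]
      exact (Finset.single_le_sum (f := fun Q => u Q x ^ 2) (fun _ _ => sq_nonneg _) hQ).trans
        (hu2 x)
    · simp [hu, hQ]
  refine ⟨fun p => h.coef (u p.1) p, ⟨fun p => ?_, fun Q => ?_⟩, fun p hp => ?_, ?_⟩
  · simpa using h.abs_coef_le hn hμ (hum p.1) (hu1 p.1) p
  · rw [ENNReal.tsum_prod', ENNReal.coe_one, one_pow, one_mul]
    calc _ ≤ ∑' S, {S : D.cubes | S.1 ⊆ Q.1}.indicator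
          (fun S => ∫⁻ x in Q.1, ‖u S x‖ₑ ^ 2 ∂μ) S := by
          refine ENNReal.tsum_le_tsum fun S => ?_
          by_cases hS : S.1 ⊆ Q.1
          · rw [indicator_of_mem (show S ∈ {S : D.cubes | S.1 ⊆ Q.1} from hS)]
            refine le_trans ?_ (lintegral_mono_set hS)
            refine le_trans ?_ (h.tsum_coef_sq_below_le hμ (hum S) (hu1 S) S)
            rw [ENNReal.tsum_prod']
            refine le_trans (le_of_eq ?_) (ENNReal.le_tsum S)
            refine tsum_congr fun j => ?_
            rw [indicator_of_mem (show (S, j) ∈ below D Q.1 from hS),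
              indicator_of_mem (show (S, j) ∈ below D S.1 from Subset.refl S.1)]
          · refine le_of_eq_of_le ?_ zero_le
            rw [ENNReal.tsum_eq_zero]
            exact fun j => indicator_of_notMem (show (S, j) ∉ below D Q.1 from hS) _
      _ ≤ ∑' S, ∫⁻ x in Q.1, ‖u S x‖ₑ ^ 2 ∂μ :=
          ENNReal.tsum_le_tsum fun S => indicator_le_self' (fun _ _ => bot_le) _
      _ = ∑ S ∈ G, ∫⁻ x in Q.1, ‖u S x‖ₑ ^ 2 ∂μ := by
          refine tsum_eq_sum fun S hS => ?_
          simp [hu, hS]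
      _ = ∫⁻ x in Q.1, ∑ S ∈ G, ‖u S x‖ₑ ^ 2 ∂μ :=
          (lintegral_finsetSum _ fun S _ => (hum S).enorm.pow_const 2).symm
      _ ≤ ∫⁻ x in Q.1, 1 ∂μ := by
          refine lintegral_mono fun x => ?_
          rw [Finset.sum_congr rfl fun S _ => show ‖u S x‖ₑ ^ 2 = ENNReal.ofReal (u S x ^ 2) by
            rw [← ofReal_norm, ← ENNReal.ofReal_pow (norm_nonneg _), Real.norm_eq_abs, sq_abs],
            ← ENNReal.ofReal_sum_of_nonneg fun _ _ => sq_nonneg _, ENNReal.ofReal_le_one]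
          exact hu2 x
      _ = _ := setLIntegral_one _
  · have : u p.1 = fun _ => 0 := by
      funext x
      simp [hu, hp]
    simp only [this]
    exact h.coef_const 0 p
  · have hb := fun Q => h.integral_mul_blk hn c Q (integrableOn_of_abs_le_one hμ (hum Q) (hu1 Q) Q)
    have hsum : ∀ x, ∑ Q ∈ G, u Q x * h.blk c Q x = σ x := fun x => by
      rw [Finset.sum_congr rfl fun Q hQ => show u Q x * h.blk c Q x = h.blk c Q x ^ 2 / σ x by
        simp only [hu, hQ, if_true]; ring, ← Finset.sum_div, ← hσ2, sq, mul_self_div_self]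
    rw [Finset.sum_congr rfl fun Q _ => (hb Q).2.symm,
      ← integral_finsetSum _ fun Q _ => (hb Q).1]
    have hσi : Integrable (fun x => ∑ Q ∈ G, u Q x * h.blk c Q x) μ :=
      integrable_finsetSum _ fun Q _ => (hb Q).1
    rw [ofReal_integral_eq_lintegral_ofReal hσi
      (Eventually.of_forall fun x => by simp only [hsum]; exact hσ0 x)]
    refine lintegral_congr fun x => ?_
    rw [hsum, h.tsum_blk_restr, Finset.sum_congr rfl fun S _ =>
      show ‖h.blk c S x‖ₑ ^ 2 = ENNReal.ofReal (h.blk c S x ^ 2) by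
        rw [← ofReal_norm, ← ENNReal.ofReal_pow (norm_nonneg _), Real.norm_eq_abs, sq_abs],
      ← ENNReal.ofReal_sum_of_nonneg fun _ _ => sq_nonneg _,
      ENNReal.ofReal_rpow_of_nonneg (Finset.sum_nonneg fun _ _ => sq_nonneg _) (by norm_num),
      ← Real.sqrt_eq_rpow]

/-- The Hardy norm is determined by finite subsequences. -/
theorem hardy_le_of_forall_restr_le (h : HaarSystem D μ) (hn : 1 ≤ n)
    (c : D.cubes × Fin (2 ^ n - 1) → ℝ) {A : ℝ≥0∞}
    (hA : ∀ G : Finset D.cubes, h.hardy (restr G c) ≤ A) : h.hardy c ≤ A := by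
  have h1 : ∀ x, (∑' Q, ‖h.blk c Q x‖ₑ ^ 2) ^ (1 / 2 : ℝ) =
      ⨆ G : Finset D.cubes, (∑' Q, ‖h.blk (restr G c) Q x‖ₑ ^ 2) ^ (1 / 2 : ℝ) := fun x => by
    simp only [h.tsum_blk_restr]
    rw [ENNReal.tsum_eq_iSup_sum]
    exact (ENNReal.orderIsoRpow (1 / 2) (by norm_num)).map_iSup _
  rw [hardy, lintegral_congr h1, lintegral_iSup_directed]
  · exact iSup_le hA
  · exact fun G => (h.measurable_tsum_blk hn _).aemeasurable
  · intro G G'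
    refine ⟨G ∪ G', fun x => ?_, fun x => ?_⟩ <;> simp only [h.tsum_blk_restr] <;>
    refine ENNReal.rpow_le_rpow (Finset.sum_le_sum_of_subset ?_) (by norm_num)
    · exact Finset.subset_union_left
    · exact Finset.subset_union_right

/-- `R` and `S` are descendants, of the `r`-th and the `s`-th generation, of the same cube. -/
def Near (r s : ℕ) (R S : D.cubes) : Prop := ∃ Q : D.cubes, R.1 ∈ D.desc r Q.1 ∧ S.1 ∈ D.desc s Q.1

theorem Near.symm {r s : ℕ} {R S : D.cubes} (hRS : Near r s R S) : Near s r S R := by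
  obtain ⟨Q, h1, h2⟩ := hRS
  exact ⟨Q, h2, h1⟩

theorem near_iff (hn : 1 ≤ n) {r s : ℕ} {R S : D.cubes} {x : Fin n → ℝ} (hx : x ∈ S.1) :
    Near r s R S ↔ R.1 ∈ D.desc r (D.cell (D.level S - s) x) := by
  constructor
  · rintro ⟨Q, h1, k, hQ, hS, hsub⟩
    have hk : D.level S - s = k := by
      rw [D.level_eq hn hS]
      ring
    rwa [hk, D.cell_eq hQ (hsub hx)]
  · intro hR
    refine ⟨D.cellCube (D.level S - s) x, hR, ?_⟩
    have h1 := D.cell_mem_desc hn (D.level S - s) s x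
    rwa [sub_add_cancel, D.cell_eq (D.mem_gen_level S) hx] at h1

theorem finite_near (hn : 1 ≤ n) (r s : ℕ) (S : D.cubes) : {R | Near r s R S}.Finite := by
  obtain ⟨x, hx⟩ := D.nonempty_of_gen (D.mem_gen_level S)
  refine Set.Finite.of_finite_image (f := Subtype.val)
    ((D.finite_desc hn r (D.cell (D.level S - s) x)).subset ?_) Subtype.val_injective.injOn
  rintro _ ⟨R, hR, rfl⟩
  exact (near_iff hn hx).1 hR

/-- The cubes near `S`. -/
noncomputable def near (hn : 1 ≤ n) (r s : ℕ) (S : D.cubes) : Finset D.cubes :=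
  (finite_near hn r s S).toFinset

theorem mem_near (hn : 1 ≤ n) {r s : ℕ} {R S : D.cubes} : R ∈ near hn r s S ↔ Near r s R S := by
  simp [near]

theorem card_near_le (hn : 1 ≤ n) (r s : ℕ) (S : D.cubes) :
    (near hn r s S).card ≤ 2 ^ (n * r) := by
  classical
  obtain ⟨x, hx⟩ := D.nonempty_of_gen (D.mem_gen_level S)
  rw [← Finset.card_image_of_injective _ Subtype.val_injective]
  refine D.card_le_of_subset_desc hn r (D.cell (D.level S - s) x) _ fun R hR => ?_
  obtain ⟨R', hR', rfl⟩ := Finset.mem_image.1 hR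
  exact (near_iff hn hx).1 ((mem_near hn).1 hR')

theorem Near.subset (hn : 1 ≤ n) {r s : ℕ} {R S : D.cubes} (hRS : Near r s R S)
    {k : ℤ} {Q : Set (Fin n → ℝ)} (hQ : Q ∈ D.gen k) (hSQ : S.1 ⊆ Q) (hk : k + s ≤ D.level S) :
    R.1 ⊆ Q := by
  obtain ⟨x, hx⟩ := D.nonempty_of_gen (D.mem_gen_level S)
  obtain ⟨l, -, -, hR⟩ := (near_iff hn hx).1 hRS
  exact hR.trans (D.cell_subset_of_mem_gen hn (by omega) hQ (hSQ hx))

/-- The matrix of `T` in the Haar basis vanishes off the pairs of cubes that are near. -/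
def IsShift (h : HaarSystem D μ) (r s : ℕ) (T : Lp ℝ 2 μ →L[ℝ] Lp ℝ 2 μ) : Prop :=
  ∀ p q : D.cubes × Fin (2 ^ n - 1),
    inner ℝ (h.vec p.1 p.2) (T (h.vec q.1 q.2)) ≠ 0 → Near r s q.1 p.1

theorem IsHaarShift.isShift {h : HaarSystem D μ} {r s : ℕ} {T : Lp ℝ 2 μ →L[ℝ] Lp ℝ 2 μ}
    (hT : h.IsHaarShift r s T) : h.IsShift r s T := by
  classical
  obtain ⟨α, hα⟩ := hT
  intro p q hpq
  by_contra hnear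
  refine hpq ?_
  have ho := orthonormal_iff_ite.1 h.orthonormal
  have h1 := (hα (h.vec q.1 q.2)).mapL (innerSL ℝ (h.vec p.1 p.2))
  refine h1.unique (HasSum.congr_fun hasSum_zero fun t => ?_)
  have hR := ho (t.1.1.2.1, t.2.1) q
  have hS := ho p (t.1.1.2.2, t.2.2)
  change inner ℝ (h.vec t.1.1.2.1 t.2.1) (h.vec q.1 q.2) = _ at hR
  change inner ℝ (h.vec p.1 p.2) (h.vec t.1.1.2.2 t.2.2) = _ at hS
  rw [innerSL_apply_apply, real_inner_smul_right, hR, hS]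
  split_ifs with h2 h3
  · refine absurd ⟨t.1.1.1, ?_⟩ hnear
    rw [← h2, h3]
    exact t.1.2
  · simp
  · simp
  · simp

theorem IsShift.adjoint {h : HaarSystem D μ} {r s : ℕ} {T : Lp ℝ 2 μ →L[ℝ] Lp ℝ 2 μ}
    (hT : h.IsShift r s T) : h.IsShift s r (ContinuousLinearMap.adjoint T) := by
  intro p q hpq
  rw [ContinuousLinearMap.adjoint_inner_right, real_inner_comm] at hpq
  exact (hT q p hpq).symm

/-- The action on sequences of Haar coefficients of an operator on `L²(μ)`. -/
noncomputable def act (h : HaarSystem D μ) (T : Lp ℝ 2 μ →L[ℝ] Lp ℝ 2 μ)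
    (a : D.cubes × Fin (2 ^ n - 1) → ℝ) (p : D.cubes × Fin (2 ^ n - 1)) : ℝ :=
  ∑' q : D.cubes × Fin (2 ^ n - 1), inner ℝ (h.vec p.1 p.2) (T (h.vec q.1 q.2)) * a q

theorem IsShift.act_eq_sum {h : HaarSystem D μ} (hn : 1 ≤ n) {r s : ℕ}
    {T : Lp ℝ 2 μ →L[ℝ] Lp ℝ 2 μ} (hT : h.IsShift r s T) (a : D.cubes × Fin (2 ^ n - 1) → ℝ)
    (p : D.cubes × Fin (2 ^ n - 1)) {G : Finset D.cubes} (hG : near hn r s p.1 ⊆ G) :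
    h.act T a p = ∑ q ∈ G ×ˢ Finset.univ,
      inner ℝ (h.vec p.1 p.2) (T (h.vec q.1 q.2)) * a q := by
  refine tsum_eq_sum fun q hq => ?_
  by_contra h0
  refine hq (Finset.mem_product.2 ⟨hG ((mem_near hn).2 (hT p q fun h' => h0 ?_)),
    Finset.mem_univ _⟩)
  rw [h', zero_mul]

theorem act_eq_sum_of_support (h : HaarSystem D μ) (T : Lp ℝ 2 μ →L[ℝ] Lp ℝ 2 μ)
    {a : D.cubes × Fin (2 ^ n - 1) → ℝ} (p : D.cubes × Fin (2 ^ n - 1)) {G : Finset D.cubes}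
    (hG : ∀ q, q.1 ∉ G → a q = 0) :
    h.act T a p = ∑ q ∈ G ×ˢ Finset.univ,
      inner ℝ (h.vec p.1 p.2) (T (h.vec q.1 q.2)) * a q := by
  refine tsum_eq_sum fun q hq => ?_
  rw [hG q fun h' => hq (Finset.mem_product.2 ⟨h', Finset.mem_univ _⟩), mul_zero]

theorem IsShift.act_congr {h : HaarSystem D μ} {r s : ℕ}
    {T : Lp ℝ 2 μ →L[ℝ] Lp ℝ 2 μ} (hT : h.IsShift r s T) {a b : D.cubes × Fin (2 ^ n - 1) → ℝ}
    {p : D.cubes × Fin (2 ^ n - 1)}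
    (hab : ∀ q : D.cubes × Fin (2 ^ n - 1), Near r s q.1 p.1 → a q = b q) :
    h.act T a p = h.act T b p := by
  refine tsum_congr fun q => ?_
  by_cases h0 : inner ℝ (h.vec p.1 p.2) (T (h.vec q.1 q.2)) = 0
  · simp [h0]
  · rw [hab q (hT p q h0)]

theorem IsShift.act_add {h : HaarSystem D μ} (hn : 1 ≤ n) {r s : ℕ}
    {T : Lp ℝ 2 μ →L[ℝ] Lp ℝ 2 μ} (hT : h.IsShift r s T) (a b : D.cubes × Fin (2 ^ n - 1) → ℝ) :
    h.act T (a + b) = h.act T a + h.act T b := by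
  funext p
  simp only [Pi.add_apply, hT.act_eq_sum hn _ p subset_rfl, mul_add, Finset.sum_add_distrib]

theorem act_smul (h : HaarSystem D μ) (T : Lp ℝ 2 μ →L[ℝ] Lp ℝ 2 μ) (c : ℝ)
    (a : D.cubes × Fin (2 ^ n - 1) → ℝ) : h.act T (c • a) = c • h.act T a := by
  funext p
  simp only [act, Pi.smul_apply, smul_eq_mul, ← tsum_mul_left]
  exact tsum_congr fun q => by ring

theorem coef_apply (h : HaarSystem D μ) (T : Lp ℝ 2 μ →L[ℝ] Lp ℝ 2 μ) (F : Lp ℝ 2 μ) :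
    h.coef (T F) = h.act T (h.coef F) := by
  funext p
  rw [← h.inner_vec, ← ContinuousLinearMap.adjoint_inner_left, ← h.basis.tsum_inner_mul_inner]
  refine tsum_congr fun q => ?_
  rw [ContinuousLinearMap.adjoint_inner_left, h.basis_apply, h.inner_vec q]

theorem norm_vec (h : HaarSystem D μ) (p : D.cubes × Fin (2 ^ n - 1)) : ‖h.vec p.1 p.2‖ = 1 :=
  h.orthonormal.norm_eq_one p

theorem abs_inner_vec_le (h : HaarSystem D μ) (T : Lp ℝ 2 μ →L[ℝ] Lp ℝ 2 μ)
    (p q : D.cubes × Fin (2 ^ n - 1)) :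
    |inner ℝ (h.vec p.1 p.2) (T (h.vec q.1 q.2))| ≤ ‖T‖ := by
  refine (abs_real_inner_le_norm _ _).trans ?_
  rw [h.norm_vec, one_mul]
  simpa [h.norm_vec] using T.le_opNorm (h.vec q.1 q.2)

theorem MassBound.mass_le_of_near {h : HaarSystem D μ} {C : ℝ≥0} (hC : h.MassBound C)
    (hn : 1 ≤ n) {r s : ℕ} {p q : D.cubes × Fin (2 ^ n - 1)} (hpq : Near r s q.1 p.1) :
    h.mass q ≤ C ^ (r + s + 4) * h.mass p := by
  obtain ⟨Q, h1, h2⟩ := hpq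
  calc h.mass q ≤ C ^ (r + 2) * h.mass (Q, q.2) := (hC.mass_le_desc hn r (Q, q.2) q h1).2
    _ ≤ C ^ (r + 2) * (C ^ (s + 2) * h.mass p) := by
        gcongr
        exact (hC.mass_le_desc hn s (Q, q.2) p h2).1
    _ = _ := by ring

/-- The constant in the pointwise bound for the action of a shift. -/
noncomputable def actConst (n : ℕ) (C : ℝ≥0) (r s : ℕ) (T : Lp ℝ 2 μ →L[ℝ] Lp ℝ 2 μ) : ℝ≥0 :=
  2 ^ (n * r) * 2 ^ n * (‖T‖₊ * C ^ (r + s + 4))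

theorem IsShift.abs_act_le {h : HaarSystem D μ} (hn : 1 ≤ n) {r s : ℕ}
    {T : Lp ℝ 2 μ →L[ℝ] Lp ℝ 2 μ} (hT : h.IsShift r s T) {C B : ℝ≥0} (hC : h.MassBound C)
    {b : D.cubes × Fin (2 ^ n - 1) → ℝ} (hb : ∀ p, |b p| ≤ B * h.mass p)
    (p : D.cubes × Fin (2 ^ n - 1)) :
    |h.act T b p| ≤ (actConst n C r s T * B : ℝ≥0) * h.mass p := by
  rw [hT.act_eq_sum hn b p subset_rfl]
  refine (Finset.abs_sum_le_sum_abs _ _).trans ?_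
  have h1 : ∀ q ∈ near hn r s p.1 ×ˢ (Finset.univ : Finset (Fin (2 ^ n - 1))),
      |inner ℝ (h.vec p.1 p.2) (T (h.vec q.1 q.2)) * b q| ≤
        ‖T‖ * (B * (C ^ (r + s + 4) * h.mass p)) := by
    intro q hq
    have hq' := (mem_near hn).1 (Finset.mem_product.1 hq).1
    rw [abs_mul]
    gcongr
    · exact h.abs_inner_vec_le T p q
    · refine (hb q).trans ?_
      gcongr
      exact hC.mass_le_of_near hn hq'
  refine (Finset.sum_le_card_nsmul _ _ _ h1).trans ?_
  have hc : ((near hn r s p.1 ×ˢ (Finset.univ : Finset (Fin (2 ^ n - 1)))).card : ℝ) ≤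
      2 ^ (n * r) * 2 ^ n := by
    rw [Finset.card_product, Finset.card_univ, Fintype.card_fin]
    exact_mod_cast Nat.mul_le_mul (card_near_le hn r s p.1) (Nat.sub_le _ _)
  have hm := h.mass_nonneg p
  rw [nsmul_eq_mul]
  calc _ ≤ (2 ^ (n * r) * 2 ^ n) * (‖T‖ * (B * (C ^ (r + s + 4) * h.mass p))) := by gcongr
    _ = _ := by
      simp only [actConst]
      push_cast
      ring

theorem tsum_coef_sq_eq_enorm (h : HaarSystem D μ) (F : Lp ℝ 2 μ) :
    ∑' p, ‖h.coef F p‖ₑ ^ 2 = ‖F‖ₑ ^ 2 := by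
  rw [h.tsum_coef_sq (Lp.memLp F), Lp.enorm_def,
    eLpNorm_eq_lintegral_rpow_enorm_toReal (by norm_num) (by norm_num)]
  simp only [ENNReal.toReal_ofNat, ENNReal.rpow_ofNat]
  rw [← ENNReal.rpow_natCast _ 2, ← ENNReal.rpow_mul]
  norm_num

/-- The Riesz–Fischer theorem for the Haar basis. -/
theorem exists_coef_eq (h : HaarSystem D μ) {a : D.cubes × Fin (2 ^ n - 1) → ℝ}
    (ha : ∑' p, ‖a p‖ₑ ^ 2 ≠ ∞) : ∃ F : Lp ℝ 2 μ, h.coef F = a := by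
  have hs : Summable fun p => ‖a p‖ ^ 2 := by
    have h1 := ENNReal.summable_toReal ha
    simpa using h1
  have hm : Memℓp a 2 := memℓp_gen (by simpa using hs)
  refine ⟨h.basis.repr.symm ⟨a, hm⟩, funext fun p => ?_⟩
  rw [← h.inner_vec, ← h.basis_apply, ← h.basis.repr_apply_apply,
    LinearIsometryEquiv.apply_symm_apply]

/-- The sum of the measures of the subcubes of `Q` of at most `s` generations. -/
theorem tsum_measure_le (hn : 1 ≤ n) {k : ℤ} {Q : Set (Fin n → ℝ)} (hQ : Q ∈ D.gen k) (s : ℕ) :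
    ∑' S : D.cubes, {S : D.cubes | S.1 ⊆ Q ∧ D.level S < k + s}.indicator (fun S => μ S.1) S ≤
      s * μ Q := by
  set W : Set D.cubes := {S : D.cubes | S.1 ⊆ Q ∧ D.level S < k + s}
  have hm : ∀ S : D.cubes, MeasurableSet S.1 := fun S => D.measurableSet_of_gen (D.mem_gen_level S)
  have h1 : ∀ S : D.cubes, W.indicator (fun S => μ S.1) S =
      ∫⁻ x, W.indicator (fun S => S.1.indicator 1 x) S ∂μ := fun S => by
    by_cases hS : S ∈ W
    · simp only [indicator_of_mem hS]
      exact (lintegral_indicator_one (hm S)).symm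
    · simp [hS]
  rw [tsum_congr h1, ← lintegral_tsum]
  · calc _ ≤ ∫⁻ x, Q.indicator (fun _ => (s : ℝ≥0∞)) x ∂μ := by
          refine lintegral_mono fun x => ?_
          simp only
          rw [tsum_cubes_nat hn x k]
          · by_cases hx : x ∈ Q
            · rw [indicator_of_mem hx, tsum_eq_sum (s := Finset.range s)]
              · refine (Finset.sum_le_card_nsmul _ _ 1 fun m _ => ?_).trans (by simp)
                refine (indicator_le_self' (fun _ _ => bot_le) _).trans ?_
                exact indicator_le_self' (fun _ _ => bot_le) _
              · intro m hm
                refine indicator_of_notMem (fun hW => ?_) _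
                have := hW.2
                rw [D.level_cellCube hn] at this
                simp at hm
                omega
            · refine le_of_eq_of_le (ENNReal.tsum_eq_zero.2 fun m => ?_) zero_le
              exact indicator_of_notMem (fun hW => hx (hW.1 (D.mem_cell _ x))) _
          · intro S hS
            by_cases hW : S ∈ W <;> simp [hW, hS]
          · intro S hS
            refine indicator_of_notMem (fun hW => ?_) _
            have := D.le_of_gen_subset hn hQ (D.mem_gen_level S) hW.1
            omega
      _ = _ := by
          rw [lintegral_indicator_const (D.measurableSet_of_gen hQ)]
  · intro S
    by_cases hS : S ∈ W
    · simp only [indicator_of_mem hS]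
      exact (measurable_one.indicator (hm S)).aemeasurable
    · simp only [indicator_of_notMem hS]
      exact aemeasurable_const

/-- A shift acts boundedly on the sequences of Haar coefficients of BMO functions. -/
theorem IsShift.carleson_act {h : HaarSystem D μ} (hn : 1 ≤ n)
    (hμ : ∀ Q ∈ D.cubes, 0 < μ Q ∧ μ Q < ∞) {r s : ℕ}
    {T : Lp ℝ 2 μ →L[ℝ] Lp ℝ 2 μ} (hT : h.IsShift r s T) {C B : ℝ≥0} (hC : h.MassBound C)
    {b : D.cubes × Fin (2 ^ n - 1) → ℝ} (hb : h.Carleson b B) :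
    h.Carleson (h.act T b) ((‖T‖₊ + (2 ^ n * s + 1) * actConst n C r s T) * B) := by
  set A := actConst n C r s T
  have habs := hT.abs_act_le hn hC hb.abs_le
  constructor
  · intro p
    refine (habs p).trans ?_
    have hle : A * B ≤ (‖T‖₊ + (2 ^ n * s + 1) * A) * B := by
      gcongr
      calc A ≤ (2 ^ n * s + 1) * A := le_mul_of_one_le_left zero_le le_add_self
        _ ≤ _ := le_add_self
    have hm := h.mass_nonneg p
    gcongr
  · intro Q
    have hQ := D.mem_gen_level Q
    have hfin : ∑' p, ‖(below D Q.1).indicator b p‖ₑ ^ 2 ≤ (B : ℝ≥0∞) ^ 2 * μ Q.1 := by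
      refine le_of_eq_of_le (tsum_congr fun p => ?_) (hb.tsum_le Q)
      by_cases hp : p ∈ below D Q.1 <;> simp [hp]
    obtain ⟨F, hF⟩ := h.exists_coef_eq
      (hfin.trans_lt (ENNReal.mul_lt_top (by simp) (hμ Q.1 Q.2).2)).ne
    have hFn : ‖F‖ₑ ^ 2 ≤ (B : ℝ≥0∞) ^ 2 * μ Q.1 := by
      rw [← h.tsum_coef_sq_eq_enorm, hF]
      exact hfin
    have hTF : ∑' p, ‖h.coef (T F) p‖ₑ ^ 2 ≤ (‖T‖₊ : ℝ≥0∞) ^ 2 * ((B : ℝ≥0∞) ^ 2 * μ Q.1) := by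
      rw [h.tsum_coef_sq_eq_enorm]
      calc ‖T F‖ₑ ^ 2 ≤ (‖T‖ₑ * ‖F‖ₑ) ^ 2 := by
            gcongr
            exact T.le_opENorm F
        _ = ‖T‖ₑ ^ 2 * ‖F‖ₑ ^ 2 := mul_pow _ _ _
        _ ≤ _ := by
            gcongr
            exact le_rfl
    set W : Set D.cubes := {S : D.cubes | S.1 ⊆ Q.1 ∧ D.level S < D.level Q + s} with hW
    have hpt : ∀ p, (below D Q.1).indicator (fun p => ‖h.act T b p‖ₑ ^ 2) p ≤
        ‖h.coef (T F) p‖ₑ ^ 2 + ((A * B : ℝ≥0) : ℝ≥0∞) ^ 2 * W.indicator (fun S => μ S.1) p.1 := by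
      intro p
      by_cases hp : p ∈ below D Q.1
      · rw [indicator_of_mem hp]
        by_cases hpW : D.level p.1 < D.level Q + s
        · refine le_trans ?_ le_add_self
          rw [indicator_of_mem (show p.1 ∈ W from ⟨hp, hpW⟩)]
          calc ‖h.act T b p‖ₑ ^ 2 ≤ (((A * B : ℝ≥0) : ℝ≥0∞) * ENNReal.ofReal (h.mass p)) ^ 2 := by
                gcongr
                rw [← ofReal_norm, ← ENNReal.ofReal_coe_nnreal,
                  ← ENNReal.ofReal_mul (NNReal.coe_nonneg _)]
                exact ENNReal.ofReal_le_ofReal (habs p)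
            _ = ((A * B : ℝ≥0) : ℝ≥0∞) ^ 2 * ENNReal.ofReal (h.mass p) ^ 2 := mul_pow _ _ _
            _ ≤ _ := by
                gcongr
                exact h.mass_sq_le hn hμ p
        · refine le_trans (le_of_eq ?_) le_self_add
          rw [h.coef_apply, hF, hT.act_congr fun q hq => ?_]
          rw [indicator_of_mem (show q ∈ below D Q.1 from hq.subset hn hQ hp (not_lt.1 hpW))]
      · simp [hp]
    have hsum : ∑' p : D.cubes × Fin (2 ^ n - 1), W.indicator (fun S => μ S.1) p.1 ≤
        2 ^ n * (s * μ Q.1) := by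
      rw [ENNReal.tsum_prod']
      simp only [tsum_fintype, Finset.sum_const, Finset.card_univ, Fintype.card_fin, nsmul_eq_mul,
        ENNReal.tsum_mul_left]
      gcongr
      · exact_mod_cast Nat.sub_le _ _
      · exact tsum_measure_le hn hQ s
    calc _ ≤ ∑' p : D.cubes × Fin (2 ^ n - 1), (‖h.coef (T F) p‖ₑ ^ 2 +
          ((A * B : ℝ≥0) : ℝ≥0∞) ^ 2 * W.indicator (fun S => μ S.1) p.1) :=
          ENNReal.tsum_le_tsum hpt
      _ ≤ (‖T‖₊ : ℝ≥0∞) ^ 2 * ((B : ℝ≥0∞) ^ 2 * μ Q.1) +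
          ((A * B : ℝ≥0) : ℝ≥0∞) ^ 2 * (2 ^ n * (s * μ Q.1)) := by
          rw [ENNReal.tsum_add, ENNReal.tsum_mul_left]
          gcongr
      _ = ((‖T‖₊ ^ 2 * B ^ 2 + (A * B) ^ 2 * (2 ^ n * s) : ℝ≥0) : ℝ≥0∞) * μ Q.1 := by
          push_cast
          ring
      _ ≤ (((‖T‖₊ + (2 ^ n * s + 1) * A) * B : ℝ≥0) : ℝ≥0∞) ^ 2 * μ Q.1 := by
          gcongr
          rw [← ENNReal.coe_pow, ENNReal.coe_le_coe, ← NNReal.coe_le_coe]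
          push_cast
          have h1 : (0 : ℝ) ≤ A := A.coe_nonneg
          have h3 : (0 : ℝ) ≤ 2 ^ n * s := by positivity
          have h4 : 0 ≤ ‖T‖ := norm_nonneg T
          have h5 : ‖T‖ ^ 2 + (A : ℝ) ^ 2 * (2 ^ n * s) ≤ (‖T‖ + (2 ^ n * s + 1) * A) ^ 2 := by
            generalize (2 : ℝ) ^ n * s = N at *
            have h6 : (A : ℝ) ^ 2 * N ≤ ((N + 1) * A) ^ 2 := by
              nlinarith [mul_nonneg (sq_nonneg (A : ℝ)) h3, mul_nonneg (sq_nonneg (A : ℝ))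
                (sq_nonneg N), sq_nonneg (A : ℝ)]
            nlinarith [mul_nonneg h4 (mul_nonneg (by linarith : 0 ≤ N + 1) h1)]
          calc _ = (‖T‖ ^ 2 + (A : ℝ) ^ 2 * (2 ^ n * s)) * (B : ℝ) ^ 2 := by ring
            _ ≤ (‖T‖ + (2 ^ n * s + 1) * A) ^ 2 * (B : ℝ) ^ 2 := by gcongr
            _ = _ := by ring

/-- A shift acts boundedly on the sequences of Haar coefficients of finite Hardy norm. -/
theorem IsShift.exists_hardy_act_le {h : HaarSystem D μ} (hn : 1 ≤ n)
    (hμ : ∀ Q ∈ D.cubes, 0 < μ Q ∧ μ Q < ∞) {r s : ℕ}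
    {T : Lp ℝ 2 μ →L[ℝ] Lp ℝ 2 μ} (hT : h.IsShift r s T) {C : ℝ≥0} (hC : h.MassBound C) :
    ∃ K : ℝ≥0, ∀ a, h.hardy (h.act T a) ≤ K * h.hardy a := by
  classical
  set T' := ContinuousLinearMap.adjoint T
  set B : ℝ≥0 := (‖T'‖₊ + (2 ^ n * r + 1) * actConst n C s r T') * 1 + 1 with hB
  refine ⟨2 * (B * (2 ^ n * C + 1)), fun a => ?_⟩
  refine h.hardy_le_of_forall_restr_le hn _ fun G => ?_
  obtain ⟨b, hb, hbG, hGb⟩ := h.exists_carleson_pairing hn hμ (h.act T a) G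
  have hb' : h.Carleson (h.act T' b) B := by
    have h1 := hT.adjoint.carleson_act hn hμ hC hb
    refine ⟨fun p => (h1.abs_le p).trans ?_, fun Q => (h1.tsum_le Q).trans ?_⟩
    · have := h.mass_nonneg p
      gcongr
      exact le_self_add
    · gcongr
      exact le_self_add
  set G' := G.biUnion (near hn r s) with hG'
  have hswap : ∑ Q ∈ G, ∑ j, h.act T a (Q, j) * b (Q, j) =
      ∑ R ∈ G', ∑ i, a (R, i) * h.act T' b (R, i) := by
    rw [← Finset.sum_product' (f := fun Q j => h.act T a (Q, j) * b (Q, j)),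
      ← Finset.sum_product' (f := fun R i => a (R, i) * h.act T' b (R, i))]
    have h1 : ∀ p ∈ G ×ˢ (Finset.univ : Finset (Fin (2 ^ n - 1))), h.act T a p * b p =
        ∑ q ∈ G' ×ˢ (Finset.univ : Finset (Fin (2 ^ n - 1))),
          inner ℝ (h.vec p.1 p.2) (T (h.vec q.1 q.2)) * a q * b p := fun p hp => by
      rw [hT.act_eq_sum hn a p (G := G') (Finset.subset_biUnion_of_mem (near hn r s)
        (Finset.mem_product.1 hp).1), Finset.sum_mul]
    have h2 : ∀ q, a q * h.act T' b q = ∑ p ∈ G ×ˢ (Finset.univ : Finset (Fin (2 ^ n - 1))),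
        inner ℝ (h.vec p.1 p.2) (T (h.vec q.1 q.2)) * a q * b p := fun q => by
      rw [h.act_eq_sum_of_support T' q hbG, Finset.mul_sum]
      refine Finset.sum_congr rfl fun p _ => ?_
      rw [ContinuousLinearMap.adjoint_inner_right, real_inner_comm]
      ring
    rw [Finset.sum_congr rfl h1, Finset.sum_comm]
    exact Finset.sum_congr rfl fun q _ => (h2 q).symm
  rw [hGb, hswap]
  have hpos : 0 < B := by
    rw [hB]
    positivity
  refine (hb'.pairing_le hpos hC hn hμ a G').trans ?_
  push_cast
  gcongr
  exact h.hardy_restr_le _ _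

end HaarSystem

namespace DyadicSystem

open Filter Topology

variable {n : ℕ} {D : DyadicSystem n} {μ : Measure (Fin n → ℝ)}

theorem Adapted.le_essSup (hμ : ∀ Q ∈ D.cubes, 0 < μ Q ∧ μ Q < ∞) {k : ℤ}
    {θ : (Fin n → ℝ) → ℝ≥0∞} (hθ : D.Adapted k θ) (x : Fin n → ℝ) : θ x ≤ essSup θ μ := by
  by_contra hlt
  have h2 : D.cell k x ⊆ {y | ¬ θ y ≤ essSup θ μ} := fun y hy => by
    rw [mem_ofPred_eq, hθ x y hy]
    exact hlt
  exact (hμ _ (D.cell_mem_cubes k x)).1.ne' (measure_mono_null h2 (ENNReal.ae_le_essSup θ))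

theorem lintegral_osc_le_bmoNorm (hμ : ∀ Q ∈ D.cubes, 0 < μ Q ∧ μ Q < ∞)
    (f : (Fin n → ℝ) → ℝ) (k : ℤ) (x : Fin n → ℝ) :
    ∫⁻ y in D.cell (k + 1) x, ‖f y - D.expect μ k f y‖ₑ ∂μ ≤
      D.bmoNorm μ f * μ (D.cell (k + 1) x) := by
  have hc := hμ _ (D.cell_mem_cubes (k + 1) x)
  set θ : (Fin n → ℝ) → ℝ≥0∞ := fun x =>
    ⨍⁻ y in D.cell (k + 1) x, ‖f y - D.expect μ (k + 1 - 1) f y‖ₑ ∂μ with hθ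
  have hθa : D.Adapted (k + 1) θ := fun x y hy => by
    simp only [hθ, D.cell_eq_of_mem hy]
  have h1 : θ x ≤ D.bmoNorm μ f := (hθa.le_essSup hμ x).trans
    (le_iSup (fun k : ℤ => essSup (fun x => ⨍⁻ y in D.cell k x,
      ‖f y - D.expect μ (k - 1) f y‖ₑ ∂μ) μ) (k + 1))
  simp only [hθ, setLAverage_eq, add_sub_cancel_right] at h1
  rwa [ENNReal.div_le_iff hc.1.ne' hc.2.ne] at h1

theorem meanOscLE_of_bmoNorm (hn : 1 ≤ n) (hμ : ∀ Q ∈ D.cubes, 0 < μ Q ∧ μ Q < ∞)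
    {f : (Fin n → ℝ) → ℝ} (hf : ∀ Q ∈ D.cubes, IntegrableOn f Q μ) (hb : D.bmoNorm μ f < ∞) :
    D.MeanOscLE μ f (D.bmoNorm μ f).toReal where
  integrableOn := hf
  osc_le k x := by
    have hc := hμ _ (D.cell_mem_cubes (k + 1) x)
    have hi : IntegrableOn (fun y => f y - D.expect μ k f y) (D.cell (k + 1) x) μ :=
      (hf _ (D.cell_mem_cubes _ x)).sub
        ((D.adapted_expect μ k f).integrableOn hn (D.cell_mem _ x) hc.2)
    have h1 := D.lintegral_osc_le_bmoNorm hμ f k x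
    rw [← ofReal_integral_norm_eq_lintegral_enorm hi] at h1
    have h2 := ENNReal.toReal_mono (ENNReal.mul_lt_top hb hc.2).ne h1
    rwa [ENNReal.toReal_ofReal (integral_nonneg fun _ => norm_nonneg _), ENNReal.toReal_mul] at h2

theorem bmoNorm_le {f : (Fin n → ℝ) → ℝ} {b : ℝ≥0∞}
    (hμ : ∀ Q ∈ D.cubes, 0 < μ Q ∧ μ Q < ∞)
    (hf : ∀ k x, ∫⁻ y in D.cell (k + 1) x, ‖f y - D.expect μ k f y‖ₑ ∂μ ≤
      b * μ (D.cell (k + 1) x)) : D.bmoNorm μ f ≤ b := by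
  refine iSup_le fun k => essSup_le_of_ae_le _ (Eventually.of_forall fun x => ?_)
  have hc := hμ _ (D.cell_mem_cubes k x)
  simp only [setLAverage_eq]
  rw [ENNReal.div_le_iff hc.1.ne' hc.2.ne]
  have := hf (k - 1) x
  rwa [sub_add_cancel] at this

end DyadicSystem

namespace HaarSystem

open Filter Topology

variable {n : ℕ} {D : DyadicSystem n} {μ : Measure (Fin n → ℝ)}

theorem carleson_coef_of_meanOscLE (h : HaarSystem D μ) (hn : 1 ≤ n)
    (hμ : ∀ Q ∈ D.cubes, 0 < μ Q ∧ μ Q < ∞) {f : (Fin n → ℝ) → ℝ} {b : ℝ≥0}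
    (hf : D.MeanOscLE μ f b) : h.Carleson (h.coef f) (23 * b) where
  abs_le p := by
    have hp := D.mem_gen_level p.1
    have hpm := D.measurableSet_of_gen hp
    have hfp := hf.integrableOn p.1.1 p.1.2
    have h1 : h.coef f p = ∫ x in p.1.1, (f x - D.expect μ (D.level p.1) f x) * h.haar p x ∂μ := by
      obtain ⟨x₀, hx₀⟩ := D.nonempty_of_gen hp
      rw [← sub_zero (h.coef f p), ← h.coef_const (D.expect μ (D.level p.1) f x₀) p,
        ← h.coef_sub hn hfp (integrableOn_const (hμ _ p.1.2).2.ne), h.coef_eq_setIntegral]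
      refine setIntegral_congr_fun hpm fun x hx => ?_
      simp only [Pi.sub_apply, D.expect_eq_of_mem μ hp f hx₀, D.expect_eq_of_mem μ hp f hx]
    have h2 := hf.setIntegral_mul_le hn hμ (by omega : D.level p.1 ≤ D.level p.1 + 1) hp
      ((h.adapted_haar hn p).comp fun t => |t|) fun x => abs_nonneg _
    have h3 : ∫ x in p.1.1, |h.haar p x| ∂μ = h.mass p :=
      setIntegral_eq_integral_of_forall_compl_eq_zero fun x hx => by
        rw [h.haar_eq_zero hx, abs_zero]
    rw [h3] at h2
    have h4 : |h.coef f p| ≤ b * h.mass p := by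
      rw [h1]
      refine (abs_integral_le_integral_abs (f := fun x =>
        (f x - D.expect μ (D.level p.1) f x) * h.haar p x)).trans (le_trans (le_of_eq ?_) h2)
      refine integral_congr_ae (Eventually.of_forall fun x => ?_)
      simp only [abs_mul, mul_comm]
    refine h4.trans ?_
    have := h.mass_nonneg p
    gcongr
    exact le_mul_of_one_le_left zero_le (by norm_num)
  tsum_le Q := by
    have hQ := D.mem_gen_level Q
    rw [h.tsum_coef_sq_below hn hμ hQ (hf.integrableOn _ Q.2) (hf.memLp_indicator_sub hn hμ hQ)]
    refine (hf.lintegral_sq_le hn hμ hQ).trans ?_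
    gcongr
    rw [← ENNReal.ofReal_coe_nnreal, ← ENNReal.ofReal_pow (NNReal.coe_nonneg _)]
    refine ENNReal.ofReal_le_ofReal ?_
    push_cast
    nlinarith [sq_nonneg (b : ℝ)]

theorem exists_ae_eq_add_const (h : HaarSystem D μ) (hn : 1 ≤ n)
    (hμ : ∀ Q ∈ D.cubes, 0 < μ Q ∧ μ Q < ∞) {Q : Set (Fin n → ℝ)} (hQ : Q ∈ D.cubes)
    {f g : (Fin n → ℝ) → ℝ} (hf : IntegrableOn f Q μ) (hg : IntegrableOn g Q μ)
    (hfg : ∀ p ∈ below D Q, h.coef f p = h.coef g p) :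
    ∃ c : ℝ, ∀ᵐ x ∂μ.restrict Q, f x = g x + c := by
  obtain ⟨k, hQ⟩ := hQ
  have h1 := h.ae_eq_average_of_coef_eq_zero hn hμ hQ (hf.sub hg) fun p hp => by
    rw [h.coef_sub hn (hf.mono_set hp) (hg.mono_set hp), hfg p hp, sub_self]
  refine ⟨⨍ y in Q, (f - g) y ∂μ, h1.mono fun x hx => ?_⟩
  rw [← hx, Pi.sub_apply]
  ring

theorem integrableOn_of_memLp (hμ : ∀ Q ∈ D.cubes, 0 < μ Q ∧ μ Q < ∞)
    {f : (Fin n → ℝ) → ℝ} (hf : MemLp f 2 μ) {Q : Set (Fin n → ℝ)} (hQ : Q ∈ D.cubes) :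
    IntegrableOn f Q μ := by
  have : IsFiniteMeasure (μ.restrict Q) := ⟨by simpa using (hμ Q hQ).2⟩
  exact (hf.mono_measure Measure.restrict_le_self).integrable one_le_two

theorem exists_coef_eq_indicator (h : HaarSystem D μ) {c : D.cubes × Fin (2 ^ n - 1) → ℝ}
    {Q : Set (Fin n → ℝ)} (hc : ∑' p, (below D Q).indicator (fun p => ‖c p‖ₑ ^ 2) p ≠ ∞) :
    ∃ F : Lp ℝ 2 μ, h.coef F = (below D Q).indicator c := by
  refine h.exists_coef_eq ?_
  convert hc using 3 with p
  by_cases hp : p ∈ below D Q <;> simp [hp]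

theorem Carleson.bmoNorm_le {h : HaarSystem D μ} (hn : 1 ≤ n)
    (hμ : ∀ Q ∈ D.cubes, 0 < μ Q ∧ μ Q < ∞) {g : (Fin n → ℝ) → ℝ} {B C : ℝ≥0}
    (hg : ∀ Q ∈ D.cubes, IntegrableOn g Q μ) (hC : h.MassBound C) (hb : h.Carleson (h.coef g) B) :
    D.bmoNorm μ g ≤ (B * (2 ^ n * C + 1) : ℝ≥0) := by
  refine DyadicSystem.bmoNorm_le hμ fun k x => ?_
  set Q := D.cell (k + 1) x with hQdef
  have hQ : Q ∈ D.gen (k + 1) := D.cell_mem _ x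
  have hQm := D.measurableSet_of_gen hQ
  have hμQ := hμ Q ⟨_, hQ⟩
  have hgQ := hg Q ⟨_, hQ⟩
  have hL : MemLp (Q.indicator fun y => g y - ⨍ z in Q, g z ∂μ) 2 μ := by
    obtain ⟨F, hF⟩ := h.exists_coef_eq_indicator (c := h.coef g) (Q := Q)
      ((hb.tsum_le ⟨Q, _, hQ⟩).trans_lt (ENNReal.mul_lt_top (by simp) hμQ.2)).ne
    obtain ⟨c, hc⟩ := h.exists_ae_eq_add_const hn hμ ⟨_, hQ⟩ hgQ
      (integrableOn_of_memLp hμ (Lp.memLp F) ⟨_, hQ⟩) fun p hp => by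
        rw [hF, indicator_of_mem hp]
    have : IsFiniteMeasure (μ.restrict Q) := ⟨by simpa using hμQ.2⟩
    rw [memLp_indicator_iff_restrict hQm]
    have h1 : MemLp (fun y => (F y + c) - ⨍ z in Q, g z ∂μ) 2 (μ.restrict Q) :=
      (((Lp.memLp F).mono_measure Measure.restrict_le_self).add (memLp_const c)).sub (memLp_const _)
    exact h1.ae_eq (hc.mono fun y hy => by simp only [hy])
  have h2 : ∫⁻ y in Q, ‖g y - ⨍ z in Q, g z ∂μ‖ₑ ^ 2 ∂μ ≤ (B : ℝ≥0∞) ^ 2 * μ Q := by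
    rw [← h.tsum_coef_sq_below hn hμ hQ hgQ hL]
    exact hb.tsum_le ⟨Q, _, hQ⟩
  have h3 : ∫⁻ y in Q, ‖g y - ⨍ z in Q, g z ∂μ‖ₑ ∂μ ≤ B * μ Q := by
    have hm : AEMeasurable (fun y => ‖g y - ⨍ z in Q, g z ∂μ‖ₑ) (μ.restrict Q) :=
      (hgQ.aestronglyMeasurable.aemeasurable.sub_const _).enorm
    have h4 := ENNReal.lintegral_mul_le_Lp_mul_Lq (μ.restrict Q) Real.HolderConjugate.two_two hm
      (aemeasurable_const (b := (1 : ℝ≥0∞)))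
    simp only [Pi.mul_apply, mul_one, ENNReal.rpow_ofNat, one_pow, lintegral_one,
      Measure.restrict_apply_univ] at h4
    calc _ ≤ _ := h4
      _ ≤ ((B : ℝ≥0∞) ^ 2 * μ Q) ^ (1 / 2 : ℝ) * μ Q ^ (1 / 2 : ℝ) := by gcongr
      _ = _ := by
          rw [ENNReal.mul_rpow_of_nonneg _ _ (by norm_num), mul_assoc,
            ← ENNReal.rpow_add_of_nonneg _ _ (by norm_num) (by norm_num),
            ← ENNReal.rpow_natCast, ← ENNReal.rpow_mul]
          norm_num
  have hjump : ∀ y ∈ Q, ‖(⨍ z in Q, g z ∂μ) - D.expect μ k g y‖ₑ ≤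
      ((B * (2 ^ n * C) : ℝ≥0) : ℝ≥0∞) := fun y hy => by
    rw [← D.expect_eq_of_mem μ hQ g hy, h.mdiff_eq hn hμ k y (hg _ (D.cell_mem_cubes k y))]
    change (‖h.blk (h.coef g) (D.cellCube k y) y‖₊ : ℝ≥0∞) ≤ _
    rw [ENNReal.coe_le_coe, ← NNReal.coe_le_coe]
    push_cast
    exact hb.abs_blk_le hC _ y
  calc _ ≤ ∫⁻ y in Q, (‖g y - ⨍ z in Q, g z ∂μ‖ₑ + ((B * (2 ^ n * C) : ℝ≥0) : ℝ≥0∞)) ∂μ := by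
        refine setLIntegral_mono' hQm fun y hy => ?_
        refine le_trans ?_ (add_le_add_right (hjump y hy) _)
        refine le_trans (le_of_eq ?_) (enorm_add_le _ _)
        congr 1
        ring
    _ = (∫⁻ y in Q, ‖g y - ⨍ z in Q, g z ∂μ‖ₑ ∂μ) +
        ((B * (2 ^ n * C) : ℝ≥0) : ℝ≥0∞) * μ Q := by
        rw [lintegral_add_right _ measurable_const, setLIntegral_const]
    _ ≤ B * μ Q + ((B * (2 ^ n * C) : ℝ≥0) : ℝ≥0∞) * μ Q := by gcongr
    _ = _ := by
        push_cast
        ring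

end HaarSystem

namespace DyadicSystem

variable {n : ℕ}

/-- The equivalence relation of lying in the same quadrant. -/
def quadrantSetoid (D : DyadicSystem n) (hn : 1 ≤ n) : Setoid (Fin n → ℝ) where
  r x y := ∃ k, D.cell k x = D.cell k y
  iseqv := by
    refine ⟨fun x => ⟨0, rfl⟩, fun ⟨k, h⟩ => ⟨k, h.symm⟩, ?_⟩
    rintro x y z ⟨k, h⟩ ⟨l, h'⟩
    exact ⟨min k l, (D.cell_eq_of_le hn (min_le_left k l) h).trans
      (D.cell_eq_of_le hn (min_le_right k l) h')⟩

theorem exists_basepoint (D : DyadicSystem n) (hn : 1 ≤ n) :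
    ∃ b : (Fin n → ℝ) → (Fin n → ℝ), (∀ x, ∃ k, D.cell k x = D.cell k (b x)) ∧
      ∀ x y k, D.cell k x = D.cell k y → b x = b y := by
  refine ⟨fun x => (Quotient.mk (D.quadrantSetoid hn) x).out, fun x => ?_, fun x y k hk => ?_⟩
  · obtain ⟨k, hk⟩ := Quotient.mk_out (s := D.quadrantSetoid hn) x
    exact ⟨k, hk.symm⟩
  · have : Quotient.mk (D.quadrantSetoid hn) x = Quotient.mk (D.quadrantSetoid hn) y :=
      Quotient.sound ⟨k, hk⟩
    simp only [this]

end DyadicSystem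

namespace HaarSystem

open Filter Topology

variable {n : ℕ} {D : DyadicSystem n} {μ : Measure (Fin n → ℝ)}

/-- A sequence that is locally square summable is the sequence of the Haar coefficients of a
function. -/
theorem exists_function_coef_eq (h : HaarSystem D μ) (hn : 1 ≤ n)
    (hμ : ∀ Q ∈ D.cubes, 0 < μ Q ∧ μ Q < ∞) {c : D.cubes × Fin (2 ^ n - 1) → ℝ}
    (hc : ∀ Q ∈ D.cubes, ∑' p, (below D Q).indicator (fun p => ‖c p‖ₑ ^ 2) p ≠ ∞) :
    ∃ g : (Fin n → ℝ) → ℝ, AEStronglyMeasurable g μ ∧ (∀ Q ∈ D.cubes, IntegrableOn g Q μ) ∧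
      h.coef g = c := by
  have hex : ∀ Q : D.cubes, ∃ F : Lp ℝ 2 μ, h.coef F = (below D Q.1).indicator c := fun Q =>
    h.exists_coef_eq_indicator (hc Q.1 Q.2)
  choose F hF using hex
  have hFi : ∀ (A : D.cubes) (Q), Q ∈ D.cubes → IntegrableOn (F A) Q μ := fun A Q hQ =>
    integrableOn_of_memLp hμ (Lp.memLp (F A)) hQ
  have hcomp : ∀ (A A' : D.cubes) (I), I ∈ D.cubes → I ⊆ A.1 → I ⊆ A'.1 →
      ∃ d : ℝ, ∀ᵐ x ∂μ.restrict I, F A x = F A' x + d := fun A A' I hI hA hA' => by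
    refine h.exists_ae_eq_add_const hn hμ hI (hFi A I hI) (hFi A' I hI) fun p hp => ?_
    rw [hF, hF, indicator_of_mem (show p ∈ below D A.1 from hp.trans hA),
      indicator_of_mem (show p ∈ below D A'.1 from hp.trans hA')]
  obtain ⟨b, hb, hb'⟩ := D.exists_basepoint hn
  have hκ : ∀ x, ∃ k ≤ 0, D.cell k x = D.cell k (b x) := fun x => by
    obtain ⟨k, hk⟩ := hb x
    exact ⟨min k 0, min_le_right _ _, D.cell_eq_of_le hn (min_le_left _ _) hk⟩
  choose κ hκ0 hκ using hκ
  set G : (Fin n → ℝ) → (Fin n → ℝ) → ℝ := fun y x =>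
    F (D.cellCube (κ y) y) x - ⨍ z in D.cell 0 (b y), F (D.cellCube (κ y) y) z ∂μ with hG
  obtain ⟨rep, hrep_mem, hrep_eq⟩ : ∃ rep : (Fin n → ℝ) → (Fin n → ℝ),
      (∀ x, rep x ∈ D.cell 0 x) ∧ ∀ x y, y ∈ D.cell 0 x → rep y = rep x := by
    have hne : ∀ Q : D.cubes, Q.1.Nonempty := fun Q => D.nonempty_of_gen (D.mem_gen_level Q)
    choose ρ hρ using hne
    refine ⟨fun x => ρ (D.cellCube 0 x), fun x => hρ (D.cellCube 0 x), fun x y hy => ?_⟩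
    exact congrArg ρ (Subtype.ext (D.cell_eq_of_mem hy))
  set g : (Fin n → ℝ) → ℝ := fun x => G (rep x) x with hg
  -- On a cube that contains the base cube of its quadrant `g` is a translate of one function.
  have hkey : ∀ (z : Fin n → ℝ) (k : ℤ), k ≤ 0 → D.cell k z = D.cell k (b z) →
      ∃ d : ℝ, ∀ᵐ x ∂μ.restrict (D.cell k z), g x = F (D.cellCube k z) x + d := by
    intro z k hk0 hk
    refine ⟨- ⨍ w in D.cell 0 (b z), F (D.cellCube k z) w ∂μ, ?_⟩
    have hQ0 : ∀ Q₀ ∈ D.gen 0, ∀ᵐ x ∂μ, x ∈ Q₀ → x ∈ D.cell k z →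
        g x = F (D.cellCube k z) x + - ⨍ w in D.cell 0 (b z), F (D.cellCube k z) w ∂μ := by
      intro Q₀ hQ₀
      by_cases hne : ∃ x₀ ∈ Q₀, x₀ ∈ D.cell k z
      swap
      · exact Eventually.of_forall fun x hx hx' => absurd ⟨x, hx, hx'⟩ hne
      obtain ⟨x₀, hx₀, hx₀z⟩ := hne
      have hcell : D.cell 0 x₀ = Q₀ := D.cell_eq hQ₀ hx₀
      set y := rep x₀ with hy
      have hyQ : D.cell 0 y = Q₀ := by rw [D.cell_eq_of_mem (hrep_mem x₀), hcell]
      have hyz : D.cell k y = D.cell k z := by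
        rw [D.cell_eq_of_le hn hk0 (hyQ.trans hcell.symm), D.cell_eq_of_mem hx₀z]
      have hby : b y = b z := hb' y z k hyz
      obtain ⟨l, hl0, hlA, hlQ⟩ : ∃ l ≤ 0, D.cell l y ⊆ D.cell (κ y) y ∧
          D.cell l y ⊆ D.cell k y ∧ D.cell l y = D.cell l (b y) := by
        rcases le_total (κ y) k with hle | hle
        · exact ⟨k, hk0, D.cell_subset hn hle y, subset_rfl, by rw [hyz, hby, hk]⟩
        · exact ⟨κ y, hκ0 y, subset_rfl, D.cell_subset hn hle y, hκ y⟩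
      obtain ⟨d, hd⟩ := hcomp (D.cellCube (κ y) y) (D.cellCube k z) (D.cell l y)
        (D.cell_mem_cubes l y) hlA (hlQ.1.trans hyz.subset)
      have hB : D.cell 0 (b z) ⊆ D.cell l y := by
        rw [hlQ.2, hby]
        exact D.cell_subset hn hl0 _
      have hμB := hμ _ (D.cell_mem_cubes 0 (b z))
      have havg : ⨍ w in D.cell 0 (b z), F (D.cellCube (κ y) y) w ∂μ =
          (⨍ w in D.cell 0 (b z), F (D.cellCube k z) w ∂μ) + d := by
        have h0 : μ.real (D.cell 0 (b z)) ≠ 0 := (ENNReal.toReal_pos hμB.1.ne' hμB.2.ne).ne'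
        rw [setAverage_eq, setAverage_eq,
          integral_congr_ae (ae_restrict_of_ae_restrict_of_subset hB hd),
          integral_add (hFi _ _ (D.cell_mem_cubes 0 _)) (integrableOn_const hμB.2.ne),
          setIntegral_const, smul_add, smul_smul, inv_mul_cancel₀ h0, one_smul]
      have hd' := (ae_restrict_iff' (D.measurableSet_cell l y)).1 hd
      filter_upwards [hd'] with x hx hxQ _
      have hxy : rep x = y := hrep_eq x₀ x (by rwa [hcell])
      have hxl : x ∈ D.cell l y := by
        apply D.cell_subset hn hl0 y
        rwa [hyQ]
      simp only [hg, hG, hxy, hby, havg, hx hxl]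
      ring
    have hall := (ae_ball_iff (D.countable_gen 0)).2 hQ0
    rw [ae_restrict_iff' (D.measurableSet_cell k z)]
    filter_upwards [hall] with x hx
    exact hx _ (D.cell_mem 0 x) (D.mem_cell 0 x)
  have hloc : ∀ Q ∈ D.cubes, ∃ (A : D.cubes) (d : ℝ), Q ⊆ A.1 ∧
      ∀ᵐ x ∂μ.restrict A.1, g x = F A x + d := by
    rintro Q ⟨q, hQ⟩
    obtain ⟨z, hz⟩ := D.nonempty_of_gen hQ
    obtain ⟨k, hk⟩ := hb z
    obtain ⟨d, hd⟩ := hkey z (min k (min q 0)) (by simp) (D.cell_eq_of_le hn (by simp) hk)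
    refine ⟨_, d, ?_, hd⟩
    rw [← D.cell_eq hQ hz]
    exact D.cell_subset hn (by simp) z
  have hgi : ∀ Q ∈ D.cubes, IntegrableOn g Q μ := fun Q hQ => by
    obtain ⟨A, d, hA, hd⟩ := hloc Q hQ
    have h1 : IntegrableOn (fun x => F A x + d) Q μ :=
      (hFi A Q hQ).add (integrableOn_const (hμ Q hQ).2.ne)
    exact h1.congr ((ae_restrict_of_ae_restrict_of_subset hA hd).mono fun x hx => hx.symm)
  refine ⟨g, ?_, hgi, ?_⟩
  · have hU : ⋃ Q : D.cubes, Q.1 = univ :=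
      eq_univ_of_forall fun x => mem_iUnion.2 ⟨D.cellCube 0 x, D.mem_cell 0 x⟩
    rw [← Measure.restrict_univ (μ := μ), ← hU]
    exact AEStronglyMeasurable.iUnion fun Q => (hgi Q.1 Q.2).aestronglyMeasurable
  · funext p
    obtain ⟨A, d, hA, hd⟩ := hloc p.1.1 p.1.2
    have h1 : g =ᵐ[μ.restrict p.1.1] (F A : (Fin n → ℝ) → ℝ) + fun _ => d :=
      ae_restrict_of_ae_restrict_of_subset hA hd
    rw [h.coef_congr h1, h.coef_add hn (hFi A _ p.1.2) (integrableOn_const (hμ _ p.1.2).2.ne),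
      h.coef_const, add_zero, hF, indicator_of_mem (show p ∈ below D A.1 from hA)]

/-- Functions in `L¹(μ)` and in `L²(μ)` with the same Haar coefficients agree. -/
theorem ae_eq_of_coef_eq (h : HaarSystem D μ) (hn : 1 ≤ n)
    (hμ : ∀ Q ∈ D.cubes, 0 < μ Q ∧ μ Q < ∞) (hquad : ∀ Q ∈ D.cubes, μ (D.quadrant Q) = ∞)
    {u v : (Fin n → ℝ) → ℝ} (hu : Integrable u μ) (hv : MemLp v 2 μ)
    (huv : h.coef u = h.coef v) : u =ᵐ[μ] v := by
  have hconst : ∀ Q ∈ D.cubes, ∃ c : ℝ, ∀ᵐ x ∂μ.restrict Q, u x = v x + c := fun Q hQ =>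
    h.exists_ae_eq_add_const hn hμ hQ hu.integrableOn (integrableOn_of_memLp hμ hv hQ)
      fun p _ => by rw [huv]
  have hzero : ∀ Q ∈ D.cubes, ∀ᵐ x ∂μ.restrict Q, u x = v x := by
    intro Q hQ
    obtain ⟨c, hc⟩ := hconst Q hQ
    by_cases hc0 : c = 0
    · simpa [hc0] using hc
    exfalso
    have hne : NeZero (μ.restrict Q) := ⟨by simpa using (hμ Q hQ).1.ne'⟩
    have hR : ∀ R ∈ {R | R ∈ D.cubes ∧ Q ⊆ R}, ∀ᵐ x ∂μ, x ∈ R → u x = v x + c := by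
      rintro R ⟨hR, hQR⟩
      obtain ⟨c', hc'⟩ := hconst R hR
      obtain ⟨x, hx1, hx2⟩ := (hc.and (ae_restrict_of_ae_restrict_of_subset hQR hc')).exists
      have hcc : c' = c := by linarith
      obtain ⟨k, hk⟩ := hR
      rw [hcc, ae_restrict_iff' (D.measurableSet_of_gen hk)] at hc'
      exact hc'
    have hcount : {R | R ∈ D.cubes ∧ Q ⊆ R}.Countable := D.countable_cubes.mono fun R hR => hR.1
    have hall := (ae_ball_iff hcount).2 hR
    have hmeas : MeasurableSet (D.quadrant Q) :=
      MeasurableSet.sUnion hcount fun R hR => by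
        obtain ⟨k, hk⟩ := hR.1
        exact D.measurableSet_of_gen hk
    have hle : μ (D.quadrant Q) ≤ ∫⁻ x, (‖(2 / c) * u x‖ₑ + ‖(2 / c) * v x‖ₑ ^ 2) ∂μ := by
      rw [← setLIntegral_one]
      refine le_trans ?_ (setLIntegral_le_lintegral (D.quadrant Q) _)
      refine lintegral_mono_ae ((ae_restrict_iff' hmeas).2 ?_)
      filter_upwards [hall] with x hx hxQ
      obtain ⟨R, hR', hxR⟩ := hxQ
      have h1 : (2 / c) * u x - (2 / c) * v x = 2 := by
        rw [hx R hR' hxR]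
        field_simp
        ring
      rw [← ofReal_norm, ← ofReal_norm, ← ENNReal.ofReal_pow (norm_nonneg _),
        ← ENNReal.ofReal_add (norm_nonneg _) (sq_nonneg _), ENNReal.one_le_ofReal,
        Real.norm_eq_abs, Real.norm_eq_abs, sq_abs]
      generalize (2 / c) * u x = s at h1
      generalize (2 / c) * v x = t at h1
      have h2 : s = 2 + t := by linarith
      rw [h2]
      nlinarith [le_abs_self (2 + t), sq_nonneg (t + 1 / 2)]
    have hfin : ∫⁻ x, (‖(2 / c) * u x‖ₑ + ‖(2 / c) * v x‖ₑ ^ 2) ∂μ < ∞ := by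
      rw [lintegral_add_left' (hu.const_mul _).aestronglyMeasurable.enorm]
      refine ENNReal.add_lt_top.2 ⟨(hu.const_mul _).2, ?_⟩
      have h1 := (hv.const_mul (2 / c)).2
      rw [eLpNorm_lt_top_iff_lintegral_rpow_enorm_lt_top (by norm_num) (by norm_num)] at h1
      simpa only [ENNReal.toReal_ofNat, ENNReal.rpow_ofNat] using h1
    exact (hle.trans_lt hfin).ne (hquad Q hQ)
  have h2 : ∀ Q ∈ D.gen 0, ∀ᵐ x ∂μ, x ∈ Q → u x = v x := fun Q hQ =>
    (ae_restrict_iff' (D.measurableSet_of_gen hQ)).1 (hzero Q ⟨0, hQ⟩)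
  filter_upwards [(ae_ball_iff (D.countable_gen 0)).2 h2] with x hx
  exact hx _ (D.cell_mem 0 x) (D.mem_cell 0 x)

/-- The Haar coefficient as a functional on `L¹(μ)`. -/
theorem exists_coefL (h : HaarSystem D μ) (hn : 1 ≤ n) (p : D.cubes × Fin (2 ^ n - 1)) :
    ∃ Φ : Lp ℝ 1 μ →L[ℝ] ℝ, ∀ g, Φ g = h.coef g p := by
  obtain ⟨C, hC⟩ := h.exists_haar_le hn p
  refine ⟨LinearMap.mkContinuous
    { toFun := fun g => h.coef g p
      map_add' := fun f g => ?_
      map_smul' := fun c f => ?_ } C fun g => ?_, fun g => rfl⟩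
  · rw [h.coef_congr' (Lp.coeFn_add f g), h.coef_add hn (L1.integrable_coeFn f).integrableOn
      (L1.integrable_coeFn g).integrableOn]
  · rw [h.coef_congr' (Lp.coeFn_smul c f), h.coef_smul]
    rfl
  · have hg := L1.integrable_coeFn g
    simp only [LinearMap.coe_mk, AddHom.coe_mk]
    rw [L1.norm_eq_integral_norm, ← integral_const_mul]
    refine (norm_integral_le_integral_norm _).trans
      (integral_mono (h.integrable_mul_haar hn hg.integrableOn).norm (hg.norm.const_mul C)
        fun x => ?_)
    simp only [norm_mul]
    rw [mul_comm]
    gcongr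
    exact hC x

theorem tendsto_hardy_restr_compl (h : HaarSystem D μ) (hn : 1 ≤ n)
    {c : D.cubes × Fin (2 ^ n - 1) → ℝ} (hc : h.hardy c ≠ ∞) :
    Tendsto (fun t : Finset D.cubes => h.hardy (restr (t : Set D.cubes)ᶜ c)) atTop (𝓝 0) := by
  rw [← lintegral_zero (μ := μ)]
  refine tendsto_lintegral_filter_of_dominated_convergence
    (fun x => (∑' Q, ‖h.blk c Q x‖ₑ ^ 2) ^ (1 / 2 : ℝ))
    (Eventually.of_forall fun t => h.measurable_tsum_blk hn _)
    (Eventually.of_forall fun t => Eventually.of_forall fun x => ?_) hc ?_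
  · refine ENNReal.rpow_le_rpow (ENNReal.tsum_le_tsum fun Q => ?_) (by norm_num)
    by_cases hQ : Q ∈ (t : Set D.cubes)ᶜ
    · rw [h.blk_restr_of_mem c hQ]
    · simp [h.blk_restr_of_notMem c hQ]
  · filter_upwards [ae_lt_top (h.measurable_tsum_blk hn c) hc] with x hx
    have hx' : ∑' Q, ‖h.blk c Q x‖ₑ ^ 2 ≠ ∞ := fun h' => by
      rw [h'] at hx
      simp at hx
    have h1 := (ENNReal.tendsto_tsum_compl_atTop_zero hx').ennrpow_const (1 / 2 : ℝ)
    rw [ENNReal.zero_rpow_of_pos (by norm_num)] at h1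
    refine h1.congr fun t => ?_
    congr 1
    rw [show ∑' Q : {Q // Q ∉ t}, ‖h.blk c Q x‖ₑ ^ 2 =
      ∑' Q : ((t : Set D.cubes)ᶜ : Set D.cubes), ‖h.blk c Q x‖ₑ ^ 2 from rfl,
      tsum_subtype ((t : Set D.cubes)ᶜ) fun Q => ‖h.blk c Q x‖ₑ ^ 2]
    refine tsum_congr fun Q => ?_
    by_cases hQ : Q ∈ (t : Set D.cubes)ᶜ
    · rw [indicator_of_mem hQ, h.blk_restr_of_mem c hQ]
    · rw [indicator_of_notMem hQ, h.blk_restr_of_notMem c hQ]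
      simp

/-- A sequence of finite Hardy norm is the sequence of the Haar coefficients of a function in
`L¹(μ)`. -/
theorem exists_integrable_coef_eq (h : HaarSystem D μ) (hn : 1 ≤ n)
    (hμ : ∀ Q ∈ D.cubes, 0 < μ Q ∧ μ Q < ∞) {C : ℝ≥0} (hC : h.MassBound C)
    {c : D.cubes × Fin (2 ^ n - 1) → ℝ} (hc : h.hardy c ≠ ∞) :
    ∃ g : Lp ℝ 1 μ, h.coef g = c := by
  classical
  set w : D.cubes → Lp ℝ 1 μ := fun Q => (h.integrable_blk hn hμ c Q).toL1 (h.blk c Q) with hw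
  have hwc : ∀ Q, (w Q : (Fin n → ℝ) → ℝ) =ᵐ[μ] h.blk c Q := fun Q => Integrable.coeFn_toL1 _
  have hws : ∀ t : Finset D.cubes, ‖∑ Q ∈ t, w Q‖ₑ = ∫⁻ x, ‖∑ Q ∈ t, h.blk c Q x‖ₑ ∂μ := by
    intro t
    have h1 : ∑ Q ∈ t, w Q = (integrable_finsetSum t fun Q _ =>
        h.integrable_blk hn hμ c Q).toL1 (fun x => ∑ Q ∈ t, h.blk c Q x) := by
      refine Lp.ext ((Lp.coeFn_finsetSum t w).trans (EventuallyEq.trans ?_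
        (Integrable.coeFn_toL1 _).symm))
      have h2 : ∀ Q ∈ t, ∀ᵐ x ∂μ, w Q x = h.blk c Q x := fun Q _ => hwc Q
      filter_upwards [(ae_ball_iff t.countable_toSet).2 h2] with x hx
      rw [Finset.sum_apply]
      exact Finset.sum_congr rfl hx
    rw [h1, Lp.enorm_def, eLpNorm_one_eq_lintegral_enorm]
    exact lintegral_congr_ae ((Integrable.coeFn_toL1 _).fun_comp fun y => ‖y‖ₑ)
  set K : ℝ≥0∞ := 2 * (2 ^ n * C + 1 : ℝ≥0) with hK
  have hK' : K ≠ ∞ := ENNReal.mul_ne_top (by simp) ENNReal.coe_ne_top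
  have hsum : Summable w := by
    rw [summable_iff_vanishing_norm]
    intro ε hε
    have h1 := ENNReal.Tendsto.const_mul (a := K) (h.tendsto_hardy_restr_compl hn hc) (Or.inr hK')
    rw [mul_zero] at h1
    obtain ⟨t, ht⟩ := (h1.eventually (gt_mem_nhds (ENNReal.ofReal_pos.2 hε))).exists
    refine ⟨t, fun t' ht' => ?_⟩
    have h2 : ‖∑ Q ∈ t', w Q‖ₑ < ENNReal.ofReal ε := by
      rw [hws]
      refine lt_of_le_of_lt (h.lintegral_sum_blk_le hC hn hμ c t') (lt_of_le_of_lt ?_ ht)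
      gcongr
      have h3 : restr (t' : Set D.cubes) c =
          restr (t' : Set D.cubes) (restr (t : Set D.cubes)ᶜ c) := by
        simp only [restr, indicator_indicator]
        congr 1
        ext p
        simp only [mem_preimage, Finset.mem_coe, mem_inter_iff, mem_compl_iff]
        exact ⟨fun hp => ⟨hp, Finset.disjoint_left.1 ht' hp⟩, fun hp => hp.1⟩
      rw [h3]
      exact h.hardy_restr_le _ _
    rwa [← ofReal_norm, ENNReal.ofReal_lt_ofReal_iff hε] at h2
  refine ⟨∑' Q, w Q, funext fun p => ?_⟩
  obtain ⟨Φ, hΦ⟩ := h.exists_coefL hn p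
  rw [← hΦ, Φ.map_tsum hsum, tsum_eq_single p.1]
  · rw [hΦ, h.coef_congr' (hwc _), h.coef_blk hn hμ, if_pos rfl]
  · intro Q hQ
    rw [hΦ, h.coef_congr' (hwc _), h.coef_blk hn hμ, if_neg hQ.symm]

/-- A shift extends to a bounded operator on the martingale Hardy space. -/
theorem IsShift.exists_extension_H1 {h : HaarSystem D μ} (hn : 1 ≤ n)
    (hμ : ∀ Q ∈ D.cubes, 0 < μ Q ∧ μ Q < ∞) (hquad : ∀ Q ∈ D.cubes, μ (D.quadrant Q) = ∞)
    {r s : ℕ} {T : Lp ℝ 2 μ →L[ℝ] Lp ℝ 2 μ} (hT : h.IsShift r s T) {C : ℝ≥0}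
    (hC : h.MassBound C) :
    ∃ T₁ : D.H1 μ →ₗ[ℝ] D.H1 μ,
      (∃ C : ℝ≥0, ∀ f : D.H1 μ, D.h1Norm μ (T₁ f).1 ≤ C * D.h1Norm μ f.1) ∧
      (∀ (f : D.H1 μ) (F : Lp ℝ 2 μ), f.1 =ᵐ[μ] F → (T₁ f).1 =ᵐ[μ] T F) := by
  obtain ⟨K, hK⟩ := hT.exists_hardy_act_le hn hμ hC
  have hint : ∀ (f : Lp ℝ 1 μ) (Q : Set (Fin n → ℝ)), IntegrableOn f Q μ := fun f Q =>
    (L1.integrable_coeFn f).integrableOn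
  have hnorm : ∀ f : Lp ℝ 1 μ, D.h1Norm μ f = h.hardy (h.coef f) := fun f =>
    h.h1Norm_eq_hardy hn hμ fun Q _ => hint f Q
  have huniq : ∀ f g : Lp ℝ 1 μ, h.coef f = h.coef g → f = g := fun f g hfg => by
    have h0 : f - g =ᵐ[μ] (0 : (Fin n → ℝ) → ℝ) := by
      refine h.ae_eq_of_coef_eq hn hμ hquad (L1.integrable_coeFn _) MemLp.zero (funext fun p => ?_)
      rw [h.coef_congr' (Lp.coeFn_sub f g), h.coef_sub hn (hint f _) (hint g _), hfg, sub_self]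
      exact (h.coef_const 0 p).symm
    exact sub_eq_zero.1 (Lp.ext (h0.trans (Lp.coeFn_zero ℝ 1 μ).symm))
  have hbound : ∀ (f : D.H1 μ) (g : Lp ℝ 1 μ), h.coef g = h.act T (h.coef f.1) →
      D.h1Norm μ g ≤ K * D.h1Norm μ f.1 := fun f g hg => by
    rw [hnorm, hnorm, hg]
    exact hK _
  have hex : ∀ f : D.H1 μ, ∃ g : D.H1 μ, h.coef g.1 = h.act T (h.coef f.1) := fun f => by
    have hf : D.h1Norm μ f.1 < ∞ := f.2
    have hlt : K * D.h1Norm μ f.1 < ∞ := ENNReal.mul_lt_top ENNReal.coe_lt_top hf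
    obtain ⟨g, hg⟩ := h.exists_integrable_coef_eq hn hμ hC (c := h.act T (h.coef f.1))
      (((hK _).trans_eq (by rw [hnorm])).trans_lt hlt).ne
    exact ⟨⟨g, (hbound f g hg).trans_lt hlt⟩, hg⟩
  choose G hG using hex
  refine ⟨{ toFun := G, map_add' := fun f g => ?_, map_smul' := fun c f => ?_ },
    ⟨K, fun f => hbound f _ (hG f)⟩, fun f F hfF => ?_⟩
  · refine Subtype.ext (huniq _ _ ?_)
    have h1 : ∀ u v : Lp ℝ 1 μ, h.coef (u + v : Lp ℝ 1 μ) = h.coef u + h.coef v := fun u v => by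
      funext p
      rw [h.coef_congr' (Lp.coeFn_add u v), h.coef_add hn (hint u _) (hint v _), Pi.add_apply]
    rw [hG, Submodule.coe_add, h1, hT.act_add hn, Submodule.coe_add, h1, hG, hG]
  · refine Subtype.ext (huniq _ _ ?_)
    have h1 : ∀ u : Lp ℝ 1 μ, h.coef (c • u : Lp ℝ 1 μ) = c • h.coef u := fun u => by
      funext p
      rw [h.coef_congr' (Lp.coeFn_smul c u), h.coef_smul]
      rfl
    rw [hG, RingHom.id_apply, Submodule.coe_smul, h1, h.act_smul, Submodule.coe_smul, h1, hG]
  · refine h.ae_eq_of_coef_eq hn hμ hquad (L1.integrable_coeFn _) (Lp.memLp _) ?_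
    rw [h.coef_apply, ← h.coef_congr' hfF]
    exact hG f

theorem carleson_coef_BMO (h : HaarSystem D μ) (hn : 1 ≤ n)
    (hμ : ∀ Q ∈ D.cubes, 0 < μ Q ∧ μ Q < ∞) (f : D.BMO μ) :
    h.Carleson (h.coef f.1) (23 * (D.bmoNorm μ f.1).toNNReal) :=
  h.carleson_coef_of_meanOscLE hn hμ (DyadicSystem.meanOscLE_of_bmoNorm hn hμ f.2.1 f.2.2)

theorem bmoNorm_eq_zero_iff (h : HaarSystem D μ) (hn : 1 ≤ n)
    (hμ : ∀ Q ∈ D.cubes, 0 < μ Q ∧ μ Q < ∞) {C : ℝ≥0} (hC : h.MassBound C) (f : D.BMO μ) :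
    D.bmoNorm μ f.1 = 0 ↔ h.coef f.1 = 0 := by
  constructor
  · intro hf
    funext p
    have h1 := (h.carleson_coef_BMO hn hμ f).abs_le p
    rw [hf] at h1
    simpa using h1
  · intro hf
    have h1 : h.Carleson (h.coef f.1) 0 := by
      rw [hf]
      exact ⟨fun p => by simp, fun Q => by simp⟩
    simpa using h1.bmoNorm_le hn hμ f.2.1 hC

theorem coef_BMO_add (h : HaarSystem D μ) (hn : 1 ≤ n) (f g : D.BMO μ) :
    h.coef (f + g).1 = h.coef f.1 + h.coef g.1 := by
  funext p
  rw [Submodule.coe_add, h.coef_congr' (AEEqFun.coeFn_add f.1 g.1),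
    h.coef_add hn (f.2.1 _ p.1.2) (g.2.1 _ p.1.2), Pi.add_apply]

theorem coef_BMO_smul (h : HaarSystem D μ) (c : ℝ) (f : D.BMO μ) :
    h.coef (c • f).1 = c • h.coef f.1 := by
  funext p
  rw [Submodule.coe_smul, h.coef_congr' (AEEqFun.coeFn_smul c f.1), h.coef_smul]
  rfl

theorem coef_BMO_sub (h : HaarSystem D μ) (hn : 1 ≤ n) (f g : D.BMO μ) :
    h.coef (f - g).1 = h.coef f.1 - h.coef g.1 := by
  rw [sub_eq_add_neg, ← neg_one_smul ℝ g, h.coef_BMO_add hn, h.coef_BMO_smul, neg_one_smul,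
    ← sub_eq_add_neg]

theorem toBMO_eq_iff (h : HaarSystem D μ) (hn : 1 ≤ n)
    (hμ : ∀ Q ∈ D.cubes, 0 < μ Q ∧ μ Q < ∞) {C : ℝ≥0} (hC : h.MassBound C) (f g : D.BMO μ) :
    D.toBMO μ f = D.toBMO μ g ↔ h.coef f.1 = h.coef g.1 := by
  rw [DyadicSystem.toBMO, DyadicSystem.toBMO, Submodule.mkQ_apply, Submodule.mkQ_apply,
    Submodule.Quotient.eq, ← sub_eq_zero (a := h.coef f.1), ← h.coef_BMO_sub hn]
  exact h.bmoNorm_eq_zero_iff hn hμ hC (f - g)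

/-- A shift extends to a bounded operator on martingale BMO. -/
theorem IsShift.exists_extension_BMO {h : HaarSystem D μ} (hn : 1 ≤ n)
    (hμ : ∀ Q ∈ D.cubes, 0 < μ Q ∧ μ Q < ∞)
    {r s : ℕ} {T : Lp ℝ 2 μ →L[ℝ] Lp ℝ 2 μ} (hT : h.IsShift r s T) {C : ℝ≥0}
    (hC : h.MassBound C) :
    ∃ T₂ : D.BMOSpace μ →ₗ[ℝ] D.BMOSpace μ,
      (∃ C : ℝ≥0, ∀ f g : D.BMO μ, T₂ (D.toBMO μ f) = D.toBMO μ g →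
        D.bmoNorm μ g.1 ≤ C * D.bmoNorm μ f.1) ∧
      (∀ (f : D.BMO μ) (F : Lp ℝ 2 μ), f.1 =ᵐ[μ] F →
        ∃ g : D.BMO μ, g.1 =ᵐ[μ] T F ∧ T₂ (D.toBMO μ f) = D.toBMO μ g) ∧
      (∀ f g : D.BMO μ, T₂ (D.toBMO μ f) = D.toBMO μ g →
        ∀ P ∈ D.cubes, ∀ Q ∈ D.desc (r + s) P,
          ∃ hF : MemLp (P.indicator f.1) 2 μ, ∃ c : ℝ,
            ∀ᵐ x ∂μ.restrict Q, g.1 x = T (hF.toLp (P.indicator f.1)) x + c) := by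
  set K : ℝ≥0 := ‖T‖₊ + (2 ^ n * s + 1) * actConst n C r s T with hK
  have hcar : ∀ f : D.BMO μ,
      h.Carleson (h.act T (h.coef f.1)) (K * (23 * (D.bmoNorm μ f.1).toNNReal)) := fun f =>
    hT.carleson_act hn hμ hC (h.carleson_coef_BMO hn hμ f)
  have hmem : ∀ (f : D.BMO μ) (g : (Fin n → ℝ) →ₘ[μ] ℝ), (∀ Q ∈ D.cubes, IntegrableOn g Q μ) →
      h.coef g = h.act T (h.coef f.1) → D.bmoNorm μ g ≤
        ((K * (23 * (D.bmoNorm μ f.1).toNNReal) * (2 ^ n * C + 1) : ℝ≥0) : ℝ≥0∞) :=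
    fun f g hg hgc => Carleson.bmoNorm_le hn hμ hg hC (hgc ▸ hcar f)
  have hex : ∀ f : D.BMO μ, ∃ g : D.BMO μ, h.coef g.1 = h.act T (h.coef f.1) := fun f => by
    obtain ⟨g, hgm, hgi, hgc⟩ := h.exists_function_coef_eq hn hμ (c := h.act T (h.coef f.1))
      fun Q hQ => (((hcar f).tsum_le ⟨Q, hQ⟩).trans_lt
        (ENNReal.mul_lt_top (ENNReal.pow_lt_top ENNReal.coe_lt_top) (hμ Q hQ).2)).ne
    have hae := AEEqFun.coeFn_mk g hgm
    have hgc' : h.coef (AEEqFun.mk g hgm) = h.act T (h.coef f.1) := (h.coef_congr' hae).trans hgc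
    have hgi' : ∀ Q ∈ D.cubes, IntegrableOn (AEEqFun.mk g hgm) Q μ := fun Q hQ =>
      (hgi Q hQ).congr (ae_restrict_of_ae hae.symm)
    exact ⟨⟨_, hgi', (hmem f _ hgi' hgc').trans_lt ENNReal.coe_lt_top⟩, hgc'⟩
  choose G hG using hex
  have heq := h.toBMO_eq_iff hn hμ hC
  let L : D.BMO μ →ₗ[ℝ] D.BMOSpace μ :=
    { toFun := fun f => D.toBMO μ (G f)
      map_add' := fun f g => by
        rw [← map_add, heq, hG, h.coef_BMO_add hn, hT.act_add hn, h.coef_BMO_add hn, hG, hG]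
      map_smul' := fun c f => by
        rw [RingHom.id_apply, ← map_smul, heq, hG, h.coef_BMO_smul, h.act_smul, h.coef_BMO_smul,
          hG] }
  have hL : D.BMONull μ ≤ LinearMap.ker L := fun f hf => by
    have hf0 : h.coef f.1 = 0 := (h.bmoNorm_eq_zero_iff hn hμ hC f).1 hf
    rw [LinearMap.mem_ker]
    change D.toBMO μ (G f) = 0
    have hz : h.coef (0 : D.BMO μ).1 = 0 := by simpa using h.coef_BMO_smul 0 (0 : D.BMO μ)
    have hz' : h.act T 0 = 0 := by simpa using h.act_smul T 0 0
    rw [← map_zero (D.BMONull μ).mkQ, heq, hG, hf0, hz, hz']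
  have hT₂ : ∀ f g : D.BMO μ, (D.BMONull μ).liftQ L hL (D.toBMO μ f) = D.toBMO μ g ↔
      h.coef g.1 = h.act T (h.coef f.1) := fun f g => by
    rw [DyadicSystem.toBMO, Submodule.mkQ_apply, Submodule.liftQ_apply]
    exact (heq (G f) g).trans (by rw [hG, eq_comm])
  refine ⟨(D.BMONull μ).liftQ L hL, ⟨K * 23 * (2 ^ n * C + 1), fun f g hfg => ?_⟩,
    fun f F hfF => ?_, fun f g hfg P hP Q hQ => ?_⟩
  · refine (hmem f g.1 g.2.1 ((hT₂ f g).1 hfg)).trans (le_of_eq ?_)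
    have hf : D.bmoNorm μ f.1 ≠ ∞ := f.2.2.ne
    rw [show K * (23 * (D.bmoNorm μ f.1).toNNReal) * (2 ^ n * C + 1) =
      K * 23 * (2 ^ n * C + 1) * (D.bmoNorm μ f.1).toNNReal by ring, ENNReal.coe_mul,
      ENNReal.coe_toNNReal hf]
  · have hc : h.coef (T F) = h.act T (h.coef f.1) := by
      rw [h.coef_apply, h.coef_congr' hfF]
    have hi : ∀ Q ∈ D.cubes, IntegrableOn (T F) Q μ := fun Q hQ =>
      integrableOn_of_memLp hμ (Lp.memLp _) hQ
    exact ⟨⟨(T F).1, hi, (hmem f (T F).1 hi hc).trans_lt ENNReal.coe_lt_top⟩,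
      EventuallyEq.rfl, (hT₂ _ _).2 hc⟩
  · have hF : MemLp (P.indicator f.1) 2 μ :=
      (DyadicSystem.meanOscLE_of_bmoNorm hn hμ f.2.1 f.2.2).memLp_indicator hn hμ hP
    obtain ⟨k, hPk, hQk, hQP⟩ := hQ
    have hQc : Q ∈ D.cubes := ⟨_, hQk⟩
    refine ⟨hF, h.exists_ae_eq_add_const hn hμ hQc (g.2.1 Q hQc)
      (integrableOn_of_memLp hμ (Lp.memLp _) hQc) fun p hp => ?_⟩
    rw [(hT₂ f g).1 hfg, h.coef_apply, h.coef_congr' hF.coeFn_toLp]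
    refine hT.act_congr fun q hq => h.coef_congr ?_
    have hle := D.le_of_gen_subset hn hQk (D.mem_gen_level p.1) hp
    have hqP : q.1.1 ⊆ P :=
      hq.subset hn hPk (Subset.trans hp hQP) (by push_cast at hle; omega)
    rw [EventuallyEq, ae_restrict_iff' (D.measurableSet_of_gen (D.mem_gen_level q.1))]
    exact Eventually.of_forall fun x hx => (indicator_of_mem (hqP hx) _).symm

end HaarSystem

theorem theoremA {n : ℕ} (hn : 1 ≤ n) (D : DyadicSystem n) (μ : Measure (Fin n → ℝ))
    (hμ : ∀ Q ∈ D.cubes, 0 < μ Q ∧ μ Q < ∞)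
    (hquad : ∀ Q ∈ D.cubes, μ (D.quadrant Q) = ∞)
    (h : HaarSystem D μ) (hbal : h.Balanced)
    (r s : ℕ) (T : Lp ℝ 2 μ →L[ℝ] Lp ℝ 2 μ) (hT : h.IsHaarShift r s T) :
    -- (i) `T` extends to a bounded operator on the martingale Hardy space
    (∃ T₁ : D.H1 μ →ₗ[ℝ] D.H1 μ,
      (∃ C : ℝ≥0, ∀ f : D.H1 μ, D.h1Norm μ (T₁ f).1 ≤ C * D.h1Norm μ f.1) ∧
      (∀ (f : D.H1 μ) (F : Lp ℝ 2 μ), f.1 =ᵐ[μ] F → (T₁ f).1 =ᵐ[μ] T F)) ∧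
    -- (ii) `T` extends to a bounded operator on martingale BMO
    (∃ T₂ : D.BMOSpace μ →ₗ[ℝ] D.BMOSpace μ,
      (∃ C : ℝ≥0, ∀ f g : D.BMO μ, T₂ (D.toBMO μ f) = D.toBMO μ g →
        D.bmoNorm μ g.1 ≤ C * D.bmoNorm μ f.1) ∧
      -- it agrees with `T` on `L² ∩ BMO`
      (∀ (f : D.BMO μ) (F : Lp ℝ 2 μ), f.1 =ᵐ[μ] F →
        ∃ g : D.BMO μ, g.1 =ᵐ[μ] T F ∧ T₂ (D.toBMO μ f) = D.toBMO μ g) ∧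
      -- on each cube `Q` it is, up to an additive constant, `T (f 1_P)`, where `P` is the
      -- `(r + s)`-th dyadic ancestor of `Q`
      (∀ f g : D.BMO μ, T₂ (D.toBMO μ f) = D.toBMO μ g →
        ∀ P ∈ D.cubes, ∀ Q ∈ D.desc (r + s) P,
          ∃ hF : MemLp (P.indicator f.1) 2 μ, ∃ c : ℝ,
            ∀ᵐ x ∂μ.restrict Q, g.1 x = T (hF.toLp (P.indicator f.1)) x + c)) := by
  obtain ⟨C, hC⟩ := hbal.exists_massBound hn hμ
  exact ⟨hT.isShift.exists_extension_H1 hn hμ hquad hC,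
    hT.isShift.exists_extension_BMO hn hμ hC⟩
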